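/- Let $2\le m\le n$, let $\Omega\subset\mathbb C^n$ be a (possibly unbounded) domain and let $p\in\partial\Omega$ be a strongly pseudoconvex polyhedral boundary point: there are a neighbourhood $U$ of $p$ and $C^2$ strongly plurisubharmonic functions $\rho_1,\dots,\rho_m:U\to\mathbb R$ with $\rho_1(p)=\dots=\rho_m(p)=0$, $\Omega\cap U=\{z\in U:\rho_1(z)<0,\dots,\rho_m(z)<0\}$ and $\partial\rho_1|_p,\dots,\partial\rho_m|_p$ linearly independent over $\mathbb C$. For an open set $D\subset\mathbb C^n$ let $A^2(D)$ be the Hilbert space of square-integrable holomorphic functions on $D$, $K_D(z)=\sum_j|\varphi_j(z)|^2$ (with $\{\varphi_j\}$ an orthonormal basis of $A^2(D)$) its Bergman kernel function, and $J_D=\det\bigl(\partial^2\log K_D/\partial z_i\partial\bar z_j\bigr)/K_D$ its Bergman canonical invariant, defined on the set $D^*$ of points $z\in D$ such that some $f\in A^2(D)$ has $f(z)\ne0$ and for every $X\in\mathbb C^n\setminus\{0\}$ some $f\in A^2(D)$ has $\sum_jX_j\,\partial f/\partial z_j(z)\neq0$. Call holomorphic coordinates $z$ on a neighbourhood $V$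 of $p$, centred at $p$, normalized if $$\Omega\cap V=\{z\in V:\operatorname{Im}z_j>\Phi_j(z),\ 1\le j\le m\},\qquad \Phi_j(z)=\sum_{\alpha,\beta=1}^n a^j_{\alpha\bar\beta}z_\alpha\bar z_\beta+R_j(z),$$ where the matrices $a^j$ are Hermitian positive definite, $\sum a^1_{\alpha\bar\beta}z_\alpha\bar z_\beta=|z_1|^2+|(z_2,\dots,z_m)P|^2+\sum_{j=m+1}^n|z_j|^2$ for an invertible matrix $P$ of order $m-1$, and $R_j\in C^2(V)$, $R_j(z)=o(|z|^2)$ as $z\to0$. Let $A_0$ be the smallest of all eigenvalues of $a^1,\dots,a^m$. Call $\varepsilon_0>0$ admissible if $U_0=\{|z_j|<\varepsilon_0,\ 1\le j\le n\}$ lies in the image of $V$ under the coordinates and $|R_j(z)|\le\frac{A_0}2|z|^2$ on $U_0$ for $1\le j\le m$. For $\delta>0$ put $$L_\delta(z)=(\delta^{-2}z_1,\delta^{-3/2}z_2,\dots,\delta^{-3/2}z_m,\delta^{-1}z_{m+1},\dots,\delta^{-1}z_n),$$ $$\Phi(z)=\Bigl(\tfrac{z_1-i}{z_1+i},\dots,\tfrac{z_m-i}{z_m+i},\tfrac{2z_{m+1}}{z_1+i},\dots,\tfrac{2z_n}{z_1+i}\Bigr),\qquad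 \widehat\Omega_{\delta,0}=\Phi\bigl(L_\delta(\Omega\cap U_0)\bigr),$$ with $\Omega\cap U_0$ taken in the normalized coordinates, and let $$B=\Bigl\{w\in\mathbb C^n:|w_1|^2+\sum_{j=m+1}^n|w_j|^2<1,\ |w_k|<1\ (2\le k\le m)\Bigr\}$$ be the product of the unit ball of $\mathbb C^{n-m+1}$ and the unit polydisk of $\mathbb C^{m-1}$ with reordered coordinates. Then normalized coordinates with an admissible $\varepsilon_0$ exist, and for every choice of normalized coordinates and admissible $\varepsilon_0$ the following holds. The function $K_B$ is $C^\infty$ on $B$, $B^*=B$, and $K_{\widehat\Omega_{\delta,0}}$ is $C^\infty$ on $\widehat\Omega_{\delta,0}$ for all sufficiently small $\delta>0$. For every compact $S\subset B$ one has $S\subset(\widehat\Omega_{\delta,0})^*$ for all sufficiently small $\delta>0$, and, as $\delta\to0^+$, all partial derivatives of every order (including order $0$) of $K_{\widehat\Omega_{\delta,0}}$ converge uniformly on $S$ to those of $K_B$, and $J_{\widehat\Omega_{\delta,0}}\to J_B$ uniformly on $S$. -/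

import Mathlib

open MeasureTheory Filter Topology Set
open scoped ContDiff ComplexConjugate ComplexOrder

noncomputable section

/-! ### The Bergman space and the Bergman kernel -/

/-- The Bergman space `A²(Ω)`: the `L²`-classes on `Ω` (for Lebesgue measure) that have a
representative which is holomorphic on `Ω`. -/
def bergmanSpace {n : ℕ} (Ω : Set (Fin n → ℂ)) :
    Submodule ℂ (Lp ℂ 2 ((volume : Measure (Fin n → ℂ)).restrict Ω)) where
  carrier := {f | ∃ g : (Fin n → ℂ) → ℂ,
    DifferentiableOn ℂ g Ω ∧ f =ᵐ[(volume : Measure (Fin n → ℂ)).restrict Ω] g}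
  zero_mem' := ⟨0, differentiableOn_const 0, Lp.coeFn_zero _ _ _⟩
  add_mem' := by
    rintro f₁ f₂ ⟨g₁, h₁, e₁⟩ ⟨g₂, h₂, e₂⟩
    exact ⟨g₁ + g₂, h₁.add h₂, (Lp.coeFn_add f₁ f₂).trans (e₁.add e₂)⟩
  smul_mem' := by
    rintro c f ⟨g, h, e⟩
    exact ⟨c • g, h.const_smul c, (Lp.coeFn_smul c f).trans (e.const_smul c)⟩

/-- The holomorphic function on `Ω` represented by an element of `A²(Ω)`. For open `Ω` its values
on `Ω` are uniquely determined; only these are used. -/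
def bergmanRep {n : ℕ} {Ω : Set (Fin n → ℂ)} (f : bergmanSpace Ω) : (Fin n → ℂ) → ℂ :=
  Classical.choose f.2

/-- An orthonormal basis (i.e. a maximal orthonormal system) of the Hilbert space `A²(Ω)`. -/
def bergmanBasis {n : ℕ} (Ω : Set (Fin n → ℂ)) : Set (bergmanSpace Ω) :=
  Classical.choose (exists_maximal_orthonormal (𝕜 := ℂ) (E := bergmanSpace Ω) (s := ∅)
    (orthonormal_empty ℂ (bergmanSpace Ω)))

/-- The Bergman kernel function on the diagonal, `K_Ω(z, z̄) = ∑ⱼ φⱼ(z) conj(φⱼ(z))`, for an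
orthonormal basis `φⱼ` of `A²(Ω)`. -/
def bergmanKernel {n : ℕ} (Ω : Set (Fin n → ℂ)) (z : Fin n → ℂ) : ℝ :=
  ∑' φ : bergmanBasis Ω, ‖bergmanRep φ.1 z‖ ^ 2

/-- `Ω*`: the points of `Ω` at which `A²(Ω)` is base-point free and separates holomorphic
directions. -/
def bergmanStar {n : ℕ} (Ω : Set (Fin n → ℂ)) : Set (Fin n → ℂ) :=
  {z | z ∈ Ω ∧ (∃ f : bergmanSpace Ω, bergmanRep f z ≠ 0) ∧
    ∀ X : Fin n → ℂ, X ≠ 0 → ∃ f : bergmanSpace Ω, fderiv ℂ (bergmanRep f) z X ≠ 0}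

/-! ### Wirtinger derivatives, Bergman metric, canonical invariant -/

/-- `∂f/∂zₖ`. -/
def wirtinger {n : ℕ} (k : Fin n) (f : (Fin n → ℂ) → ℂ) (z : Fin n → ℂ) : ℂ :=
  (fderiv ℝ f z (Pi.single k 1) - Complex.I * fderiv ℝ f z (Pi.single k Complex.I)) / 2

/-- `∂f/∂z̄ₖ`. -/
def wirtingerBar {n : ℕ} (k : Fin n) (f : (Fin n → ℂ) → ℂ) (z : Fin n → ℂ) : ℂ :=
  (fderiv ℝ f z (Pi.single k 1) + Complex.I * fderiv ℝ f z (Pi.single k Complex.I)) / 2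

/-- The complex Hessian `(∂²f / ∂zᵢ ∂z̄ⱼ)` of a real-valued function. -/
def complexHessian {n : ℕ} (f : (Fin n → ℂ) → ℝ) (z : Fin n → ℂ) : Matrix (Fin n) (Fin n) ℂ :=
  Matrix.of fun i j => wirtinger i (wirtingerBar j fun w => (f w : ℂ)) z

/-- The matrix `G_Ω = (∂² log K_Ω / ∂zᵢ ∂z̄ⱼ)` of the Bergman metric. -/
def bergmanMetric {n : ℕ} (Ω : Set (Fin n → ℂ)) (z : Fin n → ℂ) : Matrix (Fin n) (Fin n) ℂ :=
  complexHessian (fun w => Real.log (bergmanKernel Ω w)) z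

/-- The Bergman canonical invariant `J_Ω = det G_Ω / K_Ω` (`G_Ω` is Hermitian, so its determinant
is real). -/
def bergmanInvariant {n : ℕ} (Ω : Set (Fin n → ℂ)) (z : Fin n → ℂ) : ℝ :=
  (bergmanMetric Ω z).det.re / bergmanKernel Ω z

/-! ### Strongly pseudoconvex polyhedral boundary points -/

/-- `p ∈ ∂Ω` is a strongly pseudoconvex polyhedral boundary point with `m` local defining
functions, all of them vanishing at `p`. -/
def IsStronglyPseudoconvexPolyhedral {n : ℕ} (m : ℕ) (Ω : Set (Fin n → ℂ)) (p : Fin n → ℂ) :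
    Prop :=
  p ∈ frontier Ω ∧ ∃ (U : Set (Fin n → ℂ)) (ρ : Fin m → (Fin n → ℂ) → ℝ),
    IsOpen U ∧ p ∈ U ∧
    (∀ j, ContDiffOn ℝ 2 (ρ j) U) ∧
    (∀ j, ∀ z ∈ U, (complexHessian (ρ j) z).PosDef) ∧
    (∀ j, ρ j p = 0) ∧
    Ω ∩ U = {z | z ∈ U ∧ ∀ j, ρ j z < 0} ∧
    LinearIndependent ℂ fun (j : Fin m) (k : Fin n) => wirtinger k (fun w => (ρ j w : ℂ)) p

/-! ### Normalized coordinates -/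

/-- The Hermitian form `∑ a_{αβ̄} z_α z̄_β`. -/
def hermForm {n : ℕ} (a : Matrix (Fin n) (Fin n) ℂ) (z : Fin n → ℂ) : ℝ :=
  (∑ α, ∑ β, a α β * z α * conj (z β)).re

/-- Holomorphic coordinates centred at `p` in which `Ω` is given by
`Im zⱼ > Φⱼ(z)`, `Φⱼ = ∑ aʲ_{αβ̄} z_α z̄_β + Rⱼ`, for `j = 1, …, m`, with `aʲ` positive definite,
`∑ a¹_{αβ̄} z_α z̄_β = |z₁|² + |z' P|² + |z''|²` and `Rⱼ = o(|z|²)`; here `z' = (z₂, …, z_m)` and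
`z'' = (z_{m+1}, …, z_n)`. Indices are shifted by one: `z₁` is the coordinate with index `0`. -/
structure NormalizedChart {n m : ℕ} (hm : 2 ≤ m) (hmn : m ≤ n) (Ω : Set (Fin n → ℂ))
    (p : Fin n → ℂ) where
  /-- The coordinate map; its source is the coordinate neighbourhood of `p`. -/
  chart : OpenPartialHomeomorph (Fin n → ℂ) (Fin n → ℂ)
  mem_source : p ∈ chart.source
  chart_center : chart p = 0
  holomorphic : DifferentiableOn ℂ chart chart.source
  holomorphic_symm : DifferentiableOn ℂ chart.symm chart.target
  /-- The matrices `aʲ`. -/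
  a : Fin m → Matrix (Fin n) (Fin n) ℂ
  posDef : ∀ j, (a j).PosDef
  /-- The matrix `P` of order `m - 1`. -/
  P : Matrix (Fin (m - 1)) (Fin (m - 1)) ℂ
  isUnit_P : IsUnit P
  hermForm_first : ∀ z : Fin n → ℂ, hermForm (a ⟨0, by omega⟩) z =
    ‖z ⟨0, by omega⟩‖ ^ 2
      + ∑ l : Fin (m - 1), ‖∑ k : Fin (m - 1), z ⟨(k : ℕ) + 1, by omega⟩ * P k l‖ ^ 2
      + ∑ j : Fin n, if m ≤ (j : ℕ) then ‖z j‖ ^ 2 else 0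
  /-- The remainders `Rⱼ`. -/
  R : Fin m → (Fin n → ℂ) → ℝ
  contDiffOn_R : ∀ j, ContDiffOn ℝ 2 (R j) chart.target
  isLittleO_R : ∀ j, R j =o[𝓝 0] fun z : Fin n → ℂ => ‖z‖ ^ 2
  image_eq : chart '' (Ω ∩ chart.source) =
    {z | z ∈ chart.target ∧ ∀ j : Fin m, hermForm (a j) z + R j z < (z (Fin.castLE hmn j)).im}

/-- `U₀ = {|zⱼ| < ε, j = 1, …, n}`. -/
def polydisk (n : ℕ) (ε : ℝ) : Set (Fin n → ℂ) := {z | ∀ j, ‖z j‖ < ε}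

namespace NormalizedChart

variable {n m : ℕ} {hm : 2 ≤ m} {hmn : m ≤ n} {Ω : Set (Fin n → ℂ)} {p : Fin n → ℂ}

/-- `A₀`: the smallest eigenvalue of the matrices `a¹, …, aᵐ`. -/
def minEigenvalue (C : NormalizedChart hm hmn Ω p) : ℝ :=
  ⨅ j : Fin m, ⨅ i : Fin n, (C.posDef j).isHermitian.eigenvalues i

/-- The smallness required of the radius `ε₀` of `U₀`: `U₀` lies in the coordinate patch and
`|Rⱼ| ≤ (A₀/2) |z|²` on `U₀`. -/
structure IsAdmissible (C : NormalizedChart hm hmn Ω p) (ε : ℝ) : Prop where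
  pos : 0 < ε
  subset_target : polydisk n ε ⊆ C.chart.target
  remainder_le : ∀ j, ∀ z ∈ polydisk n ε,
    |C.R j z| ≤ C.minEigenvalue / 2 * ∑ k, ‖z k‖ ^ 2

/-- `D₀ = Ω ∩ U₀`, in the normalized coordinates. -/
def localDomain (C : NormalizedChart hm hmn Ω p) (ε : ℝ) : Set (Fin n → ℂ) :=
  C.chart '' (Ω ∩ C.chart.source) ∩ polydisk n ε

end NormalizedChart

/-! ### Scaling, linear fractional map, rescaled domains -/

/-- `L_δ(z) = (δ⁻² z₁, δ^{-3/2} z₂, …, δ^{-3/2} z_m, δ⁻¹ z_{m+1}, …, δ⁻¹ z_n)`. -/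
def scalingMap {n : ℕ} (m : ℕ) (δ : ℝ) (z : Fin n → ℂ) : Fin n → ℂ := fun j =>
  if (j : ℕ) = 0 then ((δ ^ (-2 : ℝ) : ℝ) : ℂ) * z j
  else if (j : ℕ) < m then ((δ ^ (-(3 / 2) : ℝ) : ℝ) : ℂ) * z j
  else ((δ ^ (-1 : ℝ) : ℝ) : ℂ) * z j

/-- The linear fractional map with components `(zⱼ - i)/(zⱼ + i)` for `j ≤ m` and
`2 zⱼ/(z₁ + i)` for `j > m`. -/
def cayleyMap {n m : ℕ} (hm : 2 ≤ m) (hmn : m ≤ n) (z : Fin n → ℂ) : Fin n → ℂ := fun j =>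
  if (j : ℕ) < m then (z j - Complex.I) / (z j + Complex.I)
  else 2 * z j / (z ⟨0, by omega⟩ + Complex.I)

/-- The rescaled domain `Ω̂_{δ,0}`, the image of `Ω ∩ U₀` under `L_δ` followed by the linear
fractional map. -/
def NormalizedChart.rescaledDomain {n m : ℕ} {hm : 2 ≤ m} {hmn : m ≤ n} {Ω : Set (Fin n → ℂ)}
    {p : Fin n → ℂ} (C : NormalizedChart hm hmn Ω p) (ε δ : ℝ) : Set (Fin n → ℂ) :=
  cayleyMap hm hmn '' (scalingMap m δ '' C.localDomain ε)

/-- The product of the unit ball of `ℂ^{n-m+1}` and the unit polydisk of `ℂ^{m-1}`, with reordered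
coordinates: `|w₁|² + ∑_{j>m} |wⱼ|² < 1` and `|w_k| < 1` for `2 ≤ k ≤ m`. -/
def ballPolydisk {n m : ℕ} (hm : 2 ≤ m) (hmn : m ≤ n) : Set (Fin n → ℂ) :=
  {w | ‖w ⟨0, by omega⟩‖ ^ 2 + (∑ j : Fin n, if m ≤ (j : ℕ) then ‖w j‖ ^ 2 else 0) < 1 ∧
    ∀ k : Fin n, 1 ≤ (k : ℕ) → (k : ℕ) < m → ‖w k‖ < 1}

end

/-! The proof has two independent halves: stability of Bergman kernels under a squeezing of domains,
and the geometry of the coordinates.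

Stability. By Parseval `bergmanKernel D z` is the squared norm of the vector reproducing evaluation
at `z`, and the off-diagonal kernel, with its second variable conjugated, is holomorphic. If `D' ⊆
D`, the reproducing vectors at `w` differ in `A²(D')` by at most `K_{D'}(w) - K_D(w)` in squared
norm (`norm_bergmanOffDiag_sub_sq_le`). Suppose that for every `r < 1` eventually `rB ⊆ D_δ ⊆ r⁻¹B`.
The monotonicity and scaling of kernels (`bergmanKernel_smul_le`) then confine the diagonal kernels
of `rB`, `B` and `D_δ` between two quantities that both tend to `K_B` as `r → 1`. Comparing both `B`
and `D_δ` with `rB` gives locally uniform convergence of the off-diagonal kernels. Cauchy's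
estimates upgrade this to all derivatives, and restriction to `(z, z̄)` gives those of `K`. The
invariant `J` is a continuous function of the 2-jet of `K` where `K ≠ 0`.

Squeezing. A fixed `w ∈ B` pulls back to a point `u = δV` with `V → (0, 0, z'')`. Hence `Φ₁(u) / δ²
→ |z''|²`, against `Im u₁ = δ² Im z₁`, which is the Siegel form of the ball inequality. For `2 ≤ j ≤
m`, `Φⱼ(u) = O(δ²)` is beaten by `Im uⱼ`, of order `δ^{3/2}`. This gives the inner inclusion. For
the outer one, `|z''|² < (1 + η) Im z₁` holds where `|z₁ + i|` is bounded, and `|z''|² < 2 Im z₁`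
holds everywhere; points with large `|z₁ + i|` are harmless because their distance to the ball is
damped by `|z₁ + i|⁻¹`.

Coordinates. Up to `o(|w|²)`, `ρⱼ` is the real part of a holomorphic polynomial `λⱼ + Qⱼ` plus its
Levi form, and `ζⱼ = -i(λⱼ + Qⱼ)` turns `ρⱼ < 0` into `Im ζⱼ > Φⱼ`. The special shape of `a¹` comes
from multiplying `ρ₁` by a positive factor `1 + 2 Re b`: this adds `Re(λ₁ b̄)` to the Levi form,
which is enough to decouple `ζ₁` from the other coordinates (`exists_adapted_coordinates`). -/

noncomputable section

/-! ### Holomorphic maps on normed spaces: Cauchy estimates and Weierstrass convergence. -/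

section Holomorphic

variable {E F : Type*} [NormedAddCommGroup E] [NormedSpace ℂ E]
  [NormedAddCommGroup F] [NormedSpace ℂ F]

/-- Cauchy's estimate for the Fréchet derivative. -/
theorem norm_fderiv_le_of_forall_mem_ball {f : E → F} {c : E} {R C : ℝ} (hR : 0 < R)
    (hd : DifferentiableOn ℂ f (Metric.ball c R)) (hC : ∀ z ∈ Metric.ball c R, ‖f z‖ ≤ C) :
    ‖fderiv ℂ f c‖ ≤ 2 * C / R := by
  -- The Schwarz-type bound needs a target ball centred at `f c`; its radius is `2 * C`.
  refine Complex.norm_fderiv_le_div_of_mapsTo_ball hd (fun z hz => ?_) hR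
  rw [Metric.mem_closedBall, dist_eq_norm]
  have h1 := hC z hz
  have h2 := hC c (Metric.mem_ball_self hR)
  linarith [norm_sub_le (f z) (f c)]

/-- Cauchy's estimate for the second order Taylor remainder. -/
theorem norm_sub_sub_fderiv_le {f : E → F} {c z : E} {R C : ℝ}
    (hd : DifferentiableOn ℂ f (Metric.ball c R)) (hC : ∀ z ∈ Metric.ball c R, ‖f z‖ ≤ C)
    (hz : z ∈ Metric.ball c R) :
    ‖f z - f c - fderiv ℂ f c (z - c)‖ ≤ 4 * C * (‖z - c‖ / R) ^ 2 := by
  have hR : 0 < R := Metric.nonempty_ball.mp ⟨z, hz⟩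
  have hC0 := hC c (Metric.mem_ball_self hR)
  have hC' : 0 ≤ C := (norm_nonneg _).trans hC0
  -- Without its linear part the map is constant to first order at `c`, so the second-order Schwarz
  -- lemma applies. The radius is `4 * C = C + 2 * C + C`.
  set g : E → F := fun y => f y - fderiv ℂ f c (y - c) with hg
  have hgc : g c = f c := by simp [hg]
  have hgd : DifferentiableOn ℂ g (Metric.ball c R) := hd.sub (by fun_prop)
  have hfc : HasFDerivAt f (fderiv ℂ f c) c :=
    (hd.differentiableAt (Metric.ball_mem_nhds c hR)).hasFDerivAt
  have key := Complex.dist_le_mul_div_pow_of_mapsTo_ball_of_isLittleO (f := g) (c := c) (z := z)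
    (R₁ := R) (R₂ := 4 * C) (n := 1) hgd ?_ ?_ hz
  · rw [dist_eq_norm, dist_eq_norm, hgc] at key
    have e : f z - f c - fderiv ℂ f c (z - c) = g z - f c := by simp only [hg]; abel
    rw [e]; exact key
  · intro y hy
    rw [Metric.mem_closedBall, dist_eq_norm, hgc]
    have h1 := hC y hy
    have h2 := norm_fderiv_le_of_forall_mem_ball hR hd hC
    have h3 : ‖fderiv ℂ f c (y - c)‖ ≤ 2 * C / R * R := by
      refine (ContinuousLinearMap.le_opNorm _ _).trans ?_
      have := Metric.mem_ball.mp hy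
      rw [dist_eq_norm] at this
      gcongr
    rw [div_mul_cancel₀ _ hR.ne'] at h3
    calc ‖g y - f c‖ = ‖f y - fderiv ℂ f c (y - c) - f c‖ := rfl
      _ ≤ ‖f y‖ + ‖fderiv ℂ f c (y - c)‖ + ‖f c‖ :=
        (norm_sub_le _ _).trans (add_le_add_left (norm_sub_le _ _) _)
      _ ≤ 4 * C := by linarith
  · simp only [pow_one]
    refine Asymptotics.IsLittleO.norm_right (g' := fun w : E => w - c) ?_
    have := hasFDerivAt_iff_isLittleO.mp hfc
    refine this.congr_left fun y => ?_
    rw [hgc]; simp only [hg]; abel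

theorem closedBall_subset_of_mem_isOpen {X : Type*} [PseudoMetricSpace X] {U : Set X}
    (hU : IsOpen U) {x : X} (hx : x ∈ U) : ∃ r > 0, Metric.closedBall x r ⊆ U :=
  Metric.nhds_basis_closedBall.mem_iff.mp (hU.mem_nhds hx)

/-- Weierstrass' theorem: a locally uniform limit of holomorphic maps is holomorphic. -/
theorem DifferentiableOn.of_tendstoLocallyUniformlyOn [ProperSpace E] [CompleteSpace F]
    {ι : Type*} {l : Filter ι} [l.NeBot] {f : ι → E → F} {g : E → F} {U : Set E} (hU : IsOpen U)
    (hf : ∀ i, DifferentiableOn ℂ (f i) U) (hfg : TendstoLocallyUniformlyOn f g l U) :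
    DifferentiableOn ℂ g U := by
  intro x hx
  obtain ⟨r, hr, hrU⟩ := closedBall_subset_of_mem_isOpen hU hx
  have hunif : TendstoUniformlyOn f g l (Metric.closedBall x r) :=
    (tendstoLocallyUniformlyOn_iff_forall_isCompact hU).mp hfg _ hrU (isCompact_closedBall x r)
  have hsub : ∀ y ∈ Metric.ball x (r / 2), Metric.ball y (r / 2) ⊆ Metric.closedBall x r := by
    intro y hy w hw
    rw [Metric.mem_ball] at hy hw
    rw [Metric.mem_closedBall]
    linarith [dist_triangle w y x]
  -- Cauchy's estimate on balls of radius `r / 2`: differences below `ε * r / 8` have derivatives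
  -- below `ε / 2`. The Cauchy property is used because the limit of the derivatives is not yet
  -- known.
  have hcau : UniformCauchySeqOn (fun i => fderiv ℂ (f i)) l (Metric.ball x (r / 2)) := by
    have h1 := hunif.uniformCauchySeqOn
    intro u hu
    obtain ⟨ε, hε, hεu⟩ := Metric.mem_uniformity_dist.mp hu
    filter_upwards [h1 _ (Metric.dist_mem_uniformity (show 0 < ε * r / 8 by positivity))]
      with i hi y hy
    have hyU : Metric.ball y (r / 2) ⊆ U := (hsub y hy).trans hrU
    have hyn := Metric.isOpen_ball.mem_nhds (Metric.mem_ball_self (x := y) (half_pos hr))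
    have hd : ∀ j, DifferentiableOn ℂ (f j) (Metric.ball y (r / 2)) := fun j => (hf j).mono hyU
    apply hεu
    have h2 := norm_fderiv_le_of_forall_mem_ball (half_pos hr) ((hd i.1).sub (hd i.2))
      (C := ε * r / 8) fun z hz => by
        have : Dist.dist (f i.1 z) (f i.2 z) < _ := hi z (hsub y hy hz)
        rw [dist_eq_norm] at this
        exact this.le
    rw [dist_eq_norm, ← fderiv_sub ((hd i.1).differentiableAt hyn) ((hd i.2).differentiableAt hyn)]
    refine h2.trans_lt ?_
    field_simp
    norm_num
  have hlim : ∀ y ∈ Metric.ball x (r / 2), ∃ L, Tendsto (fun i => fderiv ℂ (f i) y) l (𝓝 L) :=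
    fun y hy => cauchy_map_iff_exists_tendsto.mp (hcau.cauchy_map hy)
  choose! g' hg' using hlim
  have h2 : TendstoUniformlyOn (fun i => fderiv ℂ (f i)) g' l (Metric.ball x (r / 2)) :=
    hcau.tendstoUniformlyOn_of_tendsto hg'
  have h3 := hasFDerivAt_of_tendstoUniformlyOn (𝕜 := ℂ) Metric.isOpen_ball h2
    (fun i y hy => ((hf i).differentiableAt (hU.mem_nhds (hrU (hsub y hy
      (Metric.mem_ball_self (half_pos hr)))))).hasFDerivAt)
    (fun y hy => hunif.tendsto_at (hsub y hy (Metric.mem_ball_self (half_pos hr))))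
    (Metric.mem_ball_self (x := x) (half_pos hr))
  exact h3.differentiableAt.differentiableWithinAt

/-- Directional derivatives of a holomorphic map are holomorphic. -/
theorem DifferentiableOn.fderiv_apply_const [ProperSpace E] [CompleteSpace F] {f : E → F}
    {U : Set E} (hU : IsOpen U) (hf : DifferentiableOn ℂ f U) (v : E) :
    DifferentiableOn ℂ (fun z => fderiv ℂ f z v) U := by
  intro x hx
  obtain ⟨r, hr, hrU⟩ := closedBall_subset_of_mem_isOpen hU hx
  obtain ⟨C, hC⟩ := (isCompact_closedBall x r).exists_bound_of_continuousOn
    (hf.continuousOn.mono hrU)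
  have hC0 : 0 ≤ C := (norm_nonneg _).trans (hC x (Metric.mem_closedBall_self hr.le))
  have hsub : ∀ y ∈ Metric.ball x (r / 2), Metric.ball y (r / 2) ⊆ Metric.closedBall x r := by
    intro y hy w hw
    rw [Metric.mem_ball] at hy hw
    rw [Metric.mem_closedBall]
    linarith [dist_triangle w y x]
  obtain ⟨s, hs, hsv⟩ : ∃ s : ℝ, 0 < s ∧ s * ‖v‖ < r / 2 := by
    refine ⟨r / (2 * (‖v‖ + 1)), by positivity, ?_⟩
    rw [div_mul_eq_mul_div, div_lt_div_iff₀ (by positivity) (by positivity)]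
    nlinarith [norm_nonneg v]
  set t : ℕ → ℝ := fun k => s / (k + 1) with ht
  have ht0 : ∀ k, 0 < t k := fun k => by simp only [ht]; positivity
  have hts : ∀ k, t k ≤ s := fun k => div_le_self hs.le (by linarith [k.cast_nonneg (α := ℝ)])
  have htv : ∀ k, ‖((t k : ℝ) : ℂ) • v‖ = t k * ‖v‖ := fun k => by
    rw [norm_smul, Complex.norm_real, Real.norm_of_nonneg (ht0 k).le]
  have hmem : ∀ k, ∀ y, y + ((t k : ℝ) : ℂ) • v ∈ Metric.ball y (r / 2) := fun k y => by
    rw [Metric.mem_ball, dist_eq_norm, add_sub_cancel_left, htv]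
    exact (mul_le_mul_of_nonneg_right (hts k) (norm_nonneg v)).trans_lt hsv
  -- The directional derivative is a uniform limit of difference quotients: dividing the Taylor
  -- remainder `4C (t‖v‖ / (r/2))²` by `t` leaves `t * (16 C ‖v‖² / r²)`.
  have hlim : TendstoUniformlyOn
      (fun k z => ((t k : ℝ) : ℂ)⁻¹ • (f (z + ((t k : ℝ) : ℂ) • v) - f z))
      (fun z => fderiv ℂ f z v) atTop (Metric.ball x (r / 2)) := by
    rw [Metric.tendstoUniformlyOn_iff]
    intro ε hε
    have ht' : Tendsto (fun k => t k * (16 * C * ‖v‖ ^ 2 / r ^ 2)) atTop (𝓝 0) := by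
      have : Tendsto t atTop (𝓝 0) := by
        simpa [ht, div_eq_mul_inv] using
          (tendsto_one_div_add_atTop_nhds_zero_nat (𝕜 := ℝ)).const_mul s
      simpa using this.mul_const _
    filter_upwards [ht'.eventually (gt_mem_nhds hε)] with k hk y hy
    have h1 := norm_sub_sub_fderiv_le (hf.mono ((hsub y hy).trans hrU))
      (fun z hz => hC z (hsub y hy hz)) (hmem k y)
    rw [add_sub_cancel_left, htv, map_smul] at h1
    have hne : ((t k : ℝ) : ℂ) ≠ 0 := by exact_mod_cast (ht0 k).ne'
    have e : fderiv ℂ f y v - ((t k : ℝ) : ℂ)⁻¹ • (f (y + ((t k : ℝ) : ℂ) • v) - f y)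
        = -(((t k : ℝ) : ℂ)⁻¹ • (f (y + ((t k : ℝ) : ℂ) • v) - f y
          - ((t k : ℝ) : ℂ) • fderiv ℂ f y v)) := by
      rw [smul_sub (((t k : ℝ) : ℂ)⁻¹) (_ - _), inv_smul_smul₀ hne]; abel
    rw [dist_eq_norm, e, norm_neg, norm_smul, norm_inv, Complex.norm_real,
      Real.norm_of_nonneg (ht0 k).le]
    refine lt_of_le_of_lt ?_ hk
    rw [inv_mul_le_iff₀ (ht0 k)]
    refine h1.trans_eq ?_
    field_simp
    ring
  have hW := DifferentiableOn.of_tendstoLocallyUniformlyOn Metric.isOpen_ball (fun k => ?_)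
    hlim.tendstoLocallyUniformlyOn
  · exact (hW.differentiableAt (Metric.ball_mem_nhds x (half_pos hr))).differentiableWithinAt
  · refine DifferentiableOn.const_smul (DifferentiableOn.sub ?_ ?_) _
    · exact hf.comp (by fun_prop) fun y hy => hrU (hsub y hy (hmem k y))
    · exact hf.mono fun y hy => hrU (hsub y hy (Metric.mem_ball_self (half_pos hr)))

/-- Holomorphic maps on an open subset of a finite dimensional space are smooth. -/
theorem DifferentiableOn.contDiffOn_of_finiteDimensional [FiniteDimensional ℂ E] [CompleteSpace F]
    {f : E → F} {U : Set E} (hU : IsOpen U) (hf : DifferentiableOn ℂ f U) :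
    ContDiffOn ℂ ∞ f U := by
  have : ProperSpace E := FiniteDimensional.proper ℂ E
  rw [contDiffOn_infty]
  intro k
  induction k generalizing f with
  | zero => exact contDiffOn_zero.mpr hf.continuousOn
  | succ k ih =>
    rw [Nat.cast_succ, contDiffOn_succ_iff_fderiv_of_isOpen hU]
    refine ⟨hf, fun h => by simp at h, contDiffOn_clm_apply.mpr fun v => ?_⟩
    exact ih (hf.fderiv_apply_const hU v)

/-- If holomorphic maps converge uniformly on compact sets, so do their derivatives. -/
theorem tendstoUniformlyOn_fderiv_of_forall_isCompact [ProperSpace E] {ι : Type*} {l : Filter ι}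
    {f : ι → E → F} {g : E → F} {U : Set E} (hU : IsOpen U)
    (hf : ∀ K ⊆ U, IsCompact K → ∀ᶠ i in l, ∀ y ∈ K, DifferentiableAt ℂ (f i) y)
    (hg : DifferentiableOn ℂ g U)
    (hfg : ∀ K ⊆ U, IsCompact K → TendstoUniformlyOn f g l K) {K : Set E} (hKU : K ⊆ U)
    (hK : IsCompact K) :
    TendstoUniformlyOn (fun i => fderiv ℂ (f i)) (fderiv ℂ g) l K := by
  obtain ⟨r, hr, hrU⟩ := hK.exists_cthickening_subset_open hU hKU
  rw [Metric.tendstoUniformlyOn_iff]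
  intro ε hε
  have hc : IsCompact (Metric.cthickening r K) := hK.cthickening
  filter_upwards [hf _ hrU hc, Metric.tendstoUniformlyOn_iff.mp (hfg _ hrU hc) (ε * r / 4)
    (by positivity)] with i hi h y hy
  have hsub : Metric.ball y r ⊆ Metric.cthickening r K :=
    Metric.ball_subset_closedBall.trans (Metric.closedBall_subset_cthickening hy r)
  have hy' : y ∈ Metric.cthickening r K := hsub (Metric.mem_ball_self hr)
  have hdg : DifferentiableOn ℂ g (Metric.ball y r) := hg.mono (hsub.trans hrU)
  have h2 := norm_fderiv_le_of_forall_mem_ball hr (f := g - f i) (c := y) (C := ε * r / 4)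
    (hdg.sub fun z hz => (hi z (hsub hz)).differentiableWithinAt) fun z hz => by
      have := h z (hsub hz)
      rw [dist_eq_norm] at this
      exact this.le
  rw [dist_eq_norm, ← fderiv_sub (hdg.differentiableAt (Metric.ball_mem_nhds y hr)) (hi y hy')]
  refine h2.trans_lt ?_
  field_simp
  norm_num

/-- Iterates the first-order case through currying. Smoothness of `f i` is asked only eventually on
each compact set, since the domains will vary with `i`. -/
theorem tendstoUniformlyOn_iteratedFDeriv_of_forall_isCompact [ProperSpace E] {ι : Type*}
    {l : Filter ι} {f : ι → E → F} {g : E → F} {U : Set E} (hU : IsOpen U)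
    (hf : ∀ K ⊆ U, IsCompact K → ∀ᶠ i in l, ∀ y ∈ K, ContDiffAt ℂ ∞ (f i) y)
    (hg : ContDiffOn ℂ ∞ g U)
    (hfg : ∀ K ⊆ U, IsCompact K → TendstoUniformlyOn f g l K) (k : ℕ) {K : Set E} (hKU : K ⊆ U)
    (hK : IsCompact K) :
    TendstoUniformlyOn (fun i => iteratedFDeriv ℂ k (f i)) (iteratedFDeriv ℂ k g) l K := by
  induction k generalizing K with
  | zero =>
    simp only [iteratedFDeriv_zero_eq_comp]
    exact (continuousMultilinearCurryFin0 ℂ E F).symm.isometry.uniformContinuous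
      |>.comp_tendstoUniformlyOn (hfg K hKU hK)
  | succ k ih =>
    simp only [iteratedFDeriv_succ_eq_comp_left]
    refine (continuousMultilinearCurryLeftEquiv ℂ (fun _ : Fin (k + 1) => E) F).symm.isometry
      |>.uniformContinuous.comp_tendstoUniformlyOn ?_
    refine tendstoUniformlyOn_fderiv_of_forall_isCompact hU (fun K hKU hK => ?_) (fun x hx => ?_)
      (fun K hKU hK => ih hKU hK) hKU hK
    · filter_upwards [hf K hKU hK] with i hi y hy
      exact (hi y hy).differentiableAt_iteratedFDeriv (by exact_mod_cast WithTop.coe_lt_top _)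
    · exact ((hg.contDiffAt (hU.mem_nhds hx)).differentiableAt_iteratedFDeriv
        (by exact_mod_cast WithTop.coe_lt_top _)).differentiableWithinAt

/-- A locally bounded family of functionals which depends pointwise holomorphically on a parameter
is holomorphic in norm. -/
theorem differentiableOn_of_forall_apply {H : Type*} [NormedAddCommGroup H] [NormedSpace ℂ H]
    {U : Set E} {g : E → H →L[ℂ] ℂ}
    (hb : ∀ x ∈ U, ∃ r > 0, ∃ C, Metric.ball x r ⊆ U ∧ ∀ y ∈ Metric.ball x r, ‖g y‖ ≤ C)
    (hg : ∀ h, DifferentiableOn ℂ (fun z => g z h) U) : DifferentiableOn ℂ g U := by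
  intro c hc
  obtain ⟨R, hR, C, hRU, hC⟩ := hb c hc
  have hC0 : 0 ≤ C := (norm_nonneg _).trans (hC c (Metric.mem_ball_self hR))
  have hd : ∀ h, DifferentiableOn ℂ (fun z => g z h) (Metric.ball c R) := fun h => (hg h).mono hRU
  have hda : ∀ h, DifferentiableAt ℂ (fun z => g z h) c := fun h =>
    (hd h).differentiableAt (Metric.ball_mem_nhds c hR)
  have hbd : ∀ h, ∀ z ∈ Metric.ball c R, ‖g z h‖ ≤ C * ‖h‖ := fun h z hz =>
    ((g z).le_opNorm h).trans (mul_le_mul_of_nonneg_right (hC z hz) (norm_nonneg h))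
  -- The candidate derivative is assembled from the scalar ones. Cauchy's estimates bound it, and
  -- also the Taylor remainder, linearly in `‖h‖`, so differentiability holds in operator norm.
  let B : E →ₗ[ℂ] H →ₗ[ℂ] ℂ := LinearMap.mk₂ ℂ (fun v h => fderiv ℂ (fun z => g z h) c v)
    (fun v w h => map_add _ v w) (fun a v h => map_smul _ a v)
    (fun v h h' => by
      have : (fun z => g z (h + h')) = (fun z => g z h) + fun z => g z h' := by
        ext z; simp
      rw [this, fderiv_add (hda h) (hda h')]; rfl)
    (fun a v h => by
      have : (fun z => g z (a • h)) = a • fun z => g z h := by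
        ext z; simp
      rw [this, fderiv_const_smul (hda h)]; rfl)
  let L : E →L[ℂ] H →L[ℂ] ℂ := B.mkContinuous₂ (2 * C / R) fun v h => by
    refine ((fderiv ℂ (fun z => g z h) c).le_opNorm v).trans ?_
    have := norm_fderiv_le_of_forall_mem_ball hR (hd h) (hbd h)
    calc _ ≤ 2 * (C * ‖h‖) / R * ‖v‖ := mul_le_mul_of_nonneg_right this (norm_nonneg v)
      _ = _ := by ring
  have hL : HasFDerivAt g L c := by
    rw [hasFDerivAt_iff_isLittleO]
    have h1 : (fun z => g z - g c - L (z - c)) =O[𝓝 c] fun z => ‖z - c‖ ^ 2 := by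
      refine Asymptotics.IsBigO.of_bound (4 * C / R ^ 2) ?_
      filter_upwards [Metric.ball_mem_nhds c hR] with z hz
      refine ContinuousLinearMap.opNorm_le_bound _ (by positivity) fun h => ?_
      have := norm_sub_sub_fderiv_le (hd h) (hbd h) hz
      refine (show _ = _ from rfl).trans_le this |>.trans_eq ?_
      rw [norm_pow, norm_norm]
      field_simp
    refine h1.trans_isLittleO ?_
    have h2 : (fun z => ‖z - c‖ ^ 2) =o[𝓝 c] fun z => ‖z - c‖ ^ 1 := by
      have : Tendsto (fun z => z - c) (𝓝 c) (𝓝 0) := by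
        simpa using (continuous_id.sub continuous_const).tendsto c (f := fun z : E => z - c)
      exact (Asymptotics.isLittleO_norm_pow_norm_pow one_lt_two).comp_tendsto this
    simpa using h2
  exact hL.differentiableAt.differentiableWithinAt

end Holomorphic

/-! ### The sub-mean value inequality for `|g|²`. -/

section MeanValue

variable {n : ℕ}

theorem measurePreserving_circle_smul (c : Circle) :
    MeasurePreserving (fun u : Fin n → ℂ => (c : ℂ) • u) := by
  have h : MeasurePreserving (fun w : ℂ => (c : ℂ) * w) := by
    have := (rotation c).measurePreserving
    exact this
  exact volume_preserving_pi (f := fun (_ : Fin n) (w : ℂ) => (c : ℂ) * w) fun _ => h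

/-- The mean value inequality along circles for the square of a holomorphic function. -/
theorem two_pi_mul_enorm_sq_le_lintegral {g : (Fin n → ℂ) → ℂ} {z u : Fin n → ℂ} {r : ℝ}
    (hg : DifferentiableOn ℂ g (Metric.ball z r)) (hu : ‖u‖ < r) :
    ENNReal.ofReal (2 * Real.pi) * ‖g z‖ₑ ^ 2 ≤
      ∫⁻ θ in Ioc 0 (2 * Real.pi), ‖g (z + (Circle.exp θ : ℂ) • u)‖ₑ ^ 2 := by
  set φ : ℂ → ℂ := fun c => g (z + c • u) ^ 2 with hφ
  have hmaps : MapsTo (fun c : ℂ => z + c • u) (Metric.closedBall 0 1) (Metric.ball z r) := by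
    intro c hc
    rw [mem_closedBall_zero_iff] at hc
    rw [Metric.mem_ball, dist_eq_norm, add_sub_cancel_left, norm_smul]
    exact (mul_le_of_le_one_left (norm_nonneg u) hc).trans_lt hu
  have hd : DifferentiableOn ℂ φ (Metric.closedBall 0 1) :=
    (hg.comp (f := fun c : ℂ => z + c • u) (by fun_prop) hmaps).pow 2
  have hcl : DiffContOnCl ℂ φ (Metric.ball 0 |(1 : ℝ)|) := by
    rw [abs_one]
    exact DifferentiableOn.diffContOnCl (by rwa [closure_ball _ one_ne_zero])
  have hav := hcl.circleAverage
  rw [Real.circleAverage_def, intervalIntegral.integral_of_le Real.two_pi_pos.le] at hav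
  have h1 : ((2 * Real.pi : ℝ) : ℂ) * g z ^ 2
      = ∫ θ in Ioc 0 (2 * Real.pi), φ (circleMap 0 1 θ) := by
    have h2 : φ 0 = g z ^ 2 := by simp [hφ]
    rw [← h2, ← hav, Complex.real_smul, ← mul_assoc, ← Complex.ofReal_mul,
      mul_inv_cancel₀ Real.two_pi_pos.ne', Complex.ofReal_one, one_mul]
  calc ENNReal.ofReal (2 * Real.pi) * ‖g z‖ₑ ^ 2
      = ‖((2 * Real.pi : ℝ) : ℂ) * g z ^ 2‖ₑ := by
        rw [enorm_mul, enorm_pow]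
        congr 1
        rw [← ofReal_norm, Complex.norm_real, Real.norm_of_nonneg Real.two_pi_pos.le]
    _ ≤ ∫⁻ θ in Ioc 0 (2 * Real.pi), ‖φ (circleMap 0 1 θ)‖ₑ := by
        rw [h1]; exact enorm_integral_le_lintegral_enorm _
    _ = _ := by
        refine lintegral_congr fun θ => ?_
        simp only [hφ, enorm_pow, circleMap, Circle.coe_exp, Complex.ofReal_one, one_mul, zero_add]

/-- The sub-mean value property on balls for the square of a holomorphic function. -/
theorem enorm_sq_mul_volume_ball_le {g : (Fin n → ℂ) → ℂ} {z : Fin n → ℂ} {r : ℝ}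
    (hg : DifferentiableOn ℂ g (Metric.ball z r)) :
    ‖g z‖ₑ ^ 2 * volume (Metric.ball (0 : Fin n → ℂ) r) ≤
      ∫⁻ w in Metric.ball z r, ‖g w‖ₑ ^ 2 := by
  classical
  set G : (Fin n → ℂ) → ENNReal := (Metric.ball z r).indicator fun w => ‖g w‖ₑ ^ 2 with hG
  have hGm : Measurable G := by
    have h1 : Measurable ((Metric.ball z r).piecewise g 0) :=
      hg.continuousOn.measurable_piecewise continuousOn_const Metric.isOpen_ball.measurableSet
    have h2 : G = fun w => ‖(Metric.ball z r).piecewise g 0 w‖ₑ ^ 2 := by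
      ext w
      by_cases hw : w ∈ Metric.ball z r <;> simp [hG, hw]
    rw [h2]; fun_prop
  have hInt : ∫⁻ w in Metric.ball z r, ‖g w‖ₑ ^ 2 = ∫⁻ w, G w := by
    rw [hG, lintegral_indicator Metric.isOpen_ball.measurableSet]
  -- Rotations preserve volume, so after integrating the circle inequality over `u` and exchanging
  -- integrals the inner integral no longer depends on `θ`.
  have hGu : ∀ θ : ℝ, ∫⁻ u, G (z + (Circle.exp θ : ℂ) • u) = ∫⁻ w, G w := fun θ => by
    rw [(measurePreserving_circle_smul (Circle.exp θ)).lintegral_comp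
      (f := fun u => G (z + u)) (by fun_prop)]
    exact lintegral_add_left_eq_self G z
  have hsub : ∀ u ∈ Metric.ball (0 : Fin n → ℂ) r, ENNReal.ofReal (2 * Real.pi) * ‖g z‖ₑ ^ 2 ≤
      ∫⁻ θ in Ioc 0 (2 * Real.pi), G (z + (Circle.exp θ : ℂ) • u) := by
    intro u hu
    rw [mem_ball_zero_iff] at hu
    refine (two_pi_mul_enorm_sq_le_lintegral hg hu).trans_eq ?_
    refine lintegral_congr fun θ => ?_
    have : z + (Circle.exp θ : ℂ) • u ∈ Metric.ball z r := by
      rw [Metric.mem_ball, dist_eq_norm, add_sub_cancel_left, norm_smul, Circle.norm_coe, one_mul]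
      exact hu
    rw [hG, indicator_of_mem this]
  have hpi0 : ENNReal.ofReal (2 * Real.pi) ≠ 0 := by simp [Real.pi_pos]
  have hmeas : Measurable (Function.uncurry fun (u : Fin n → ℂ) (θ : ℝ) =>
      G (z + (Circle.exp θ : ℂ) • u)) := by
    refine hGm.comp ?_
    have : Continuous fun p : (Fin n → ℂ) × ℝ => z + (Circle.exp p.2 : ℂ) • p.1 := by fun_prop
    exact this.measurable
  have key : ENNReal.ofReal (2 * Real.pi) *
      (‖g z‖ₑ ^ 2 * volume (Metric.ball (0 : Fin n → ℂ) r)) ≤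
      ENNReal.ofReal (2 * Real.pi) * ∫⁻ w, G w := by
    calc _ = ∫⁻ _ in Metric.ball (0 : Fin n → ℂ) r, ENNReal.ofReal (2 * Real.pi) * ‖g z‖ₑ ^ 2 := by
          rw [setLIntegral_const, mul_assoc]
      _ ≤ ∫⁻ u in Metric.ball (0 : Fin n → ℂ) r, ∫⁻ θ in Ioc 0 (2 * Real.pi),
            G (z + (Circle.exp θ : ℂ) • u) :=
          setLIntegral_mono' Metric.isOpen_ball.measurableSet hsub
      _ ≤ ∫⁻ u, ∫⁻ θ in Ioc 0 (2 * Real.pi), G (z + (Circle.exp θ : ℂ) • u) :=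
          setLIntegral_le_lintegral _ _
      _ = ∫⁻ θ in Ioc 0 (2 * Real.pi), ∫⁻ u, G (z + (Circle.exp θ : ℂ) • u) :=
          lintegral_lintegral_swap hmeas.aemeasurable
      _ = _ := by
          simp only [hGu, setLIntegral_const, Real.volume_Ioc, sub_zero]
          rw [mul_comm]
  rw [hInt]
  exact (ENNReal.mul_le_mul_iff_right hpi0 ENNReal.ofReal_ne_top).mp key

end MeanValue

/-! ### The Bergman space as a Hilbert space with bounded evaluations. -/

section BergmanSpace

variable {n : ℕ} {D : Set (Fin n → ℂ)}

theorem differentiableOn_bergmanRep (f : bergmanSpace D) : DifferentiableOn ℂ (bergmanRep f) D :=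
  (Classical.choose_spec f.2).1

theorem coeFn_ae_eq_bergmanRep (f : bergmanSpace D) :
    (f : Lp ℂ 2 ((volume : Measure (Fin n → ℂ)).restrict D)) =ᵐ[volume.restrict D] bergmanRep f :=
  (Classical.choose_spec f.2).2

/-- Continuous functions that agree a.e. on an open set agree on it. This makes all later statements
independent of the choice inside `bergmanRep`. -/
theorem eqOn_bergmanRep (hD : IsOpen D) {f : bergmanSpace D} {g : (Fin n → ℂ) → ℂ}
    (hg : ContinuousOn g D)
    (hfg : (f : Lp ℂ 2 ((volume : Measure (Fin n → ℂ)).restrict D)) =ᵐ[volume.restrict D] g) :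
    EqOn (bergmanRep f) g D :=
  Measure.eqOn_open_of_ae_eq ((coeFn_ae_eq_bergmanRep f).symm.trans hfg) hD
    (differentiableOn_bergmanRep f).continuousOn hg

theorem enorm_sq_eq_lintegral_bergmanRep (f : bergmanSpace D) :
    ‖f‖ₑ ^ 2 = ∫⁻ w in D, ‖bergmanRep f w‖ₑ ^ 2 := by
  have h1 : ‖f‖ₑ = eLpNorm (bergmanRep f) 2 (volume.restrict D) := by
    rw [← eLpNorm_congr_ae (coeFn_ae_eq_bergmanRep f), ← Lp.enorm_def]; rfl
  have := eLpNorm_nnreal_pow_eq_lintegral (μ := volume.restrict D) (f := bergmanRep f) (p := 2)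
    two_ne_zero
  rw [h1]
  norm_cast at this ⊢
  simpa using this

/-- A square-integrable holomorphic function defines an element of the Bergman space. -/
theorem exists_bergmanRep_eqOn (hD : IsOpen D) {g : (Fin n → ℂ) → ℂ} (hg : DifferentiableOn ℂ g D)
    (hi : ∫⁻ w in D, ‖g w‖ₑ ^ 2 ≠ ⊤) :
    ∃ f : bergmanSpace D, EqOn (bergmanRep f) g D := by
  have hm : AEStronglyMeasurable g (volume.restrict D) :=
    hg.continuousOn.aestronglyMeasurable hD.measurableSet
  have hL : MemLp g 2 (volume.restrict D) := by
    refine ⟨hm, ?_⟩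
    have := eLpNorm_nnreal_pow_eq_lintegral (μ := volume.restrict D) (f := g) (p := 2)
      two_ne_zero
    rw [lt_top_iff_ne_top]
    intro h
    apply hi
    norm_cast at this
    rw [h] at this
    simpa using this.symm
  exact ⟨⟨hL.toLp g, g, hg, hL.coeFn_toLp⟩, eqOn_bergmanRep hD hg.continuousOn hL.coeFn_toLp⟩

theorem bergmanRep_add (hD : IsOpen D) (f g : bergmanSpace D) {z : Fin n → ℂ} (hz : z ∈ D) :
    bergmanRep (f + g) z = bergmanRep f z + bergmanRep g z :=
  eqOn_bergmanRep hD (f := f + g) ((differentiableOn_bergmanRep f).continuousOn.add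
    (differentiableOn_bergmanRep g).continuousOn)
    ((Lp.coeFn_add f.1 g.1).trans ((coeFn_ae_eq_bergmanRep f).add (coeFn_ae_eq_bergmanRep g))) hz

theorem bergmanRep_smul (hD : IsOpen D) (c : ℂ) (f : bergmanSpace D) {z : Fin n → ℂ}
    (hz : z ∈ D) : bergmanRep (c • f) z = c • bergmanRep f z :=
  eqOn_bergmanRep hD (f := c • f) ((differentiableOn_bergmanRep f).continuousOn.const_smul c)
    ((Lp.coeFn_smul c f.1).trans ((coeFn_ae_eq_bergmanRep f).const_smul c)) hz

theorem bergmanRep_sub (hD : IsOpen D) (f g : bergmanSpace D) {z : Fin n → ℂ} (hz : z ∈ D) :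
    bergmanRep (f - g) z = bergmanRep f z - bergmanRep g z := by
  have := bergmanRep_add hD (f - g) g hz
  rw [sub_add_cancel] at this
  rw [this, add_sub_cancel_right]

/-- Point evaluations are bounded on the Bergman space, locally uniformly. -/
theorem exists_norm_bergmanRep_le {r : ℝ} (hr : 0 < r) (D : Set (Fin n → ℂ)) :
    ∃ C : ℝ, 0 ≤ C ∧ ∀ z, Metric.ball z r ⊆ D → ∀ f : bergmanSpace D,
      ‖bergmanRep f z‖ ≤ C * ‖f‖ := by
  set v := volume (Metric.ball (0 : Fin n → ℂ) r) with hv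
  have hv0 : v ≠ 0 := (Metric.measure_ball_pos volume _ hr).ne'
  have hvt : v ≠ ⊤ := measure_ball_lt_top.ne
  have hvr : 0 < v.toReal := ENNReal.toReal_pos hv0 hvt
  refine ⟨(Real.sqrt v.toReal)⁻¹, by positivity, fun z hz f => ?_⟩
  have h1 := enorm_sq_mul_volume_ball_le ((differentiableOn_bergmanRep f).mono hz)
  have h2 : ‖bergmanRep f z‖ₑ ^ 2 * v ≤ ‖f‖ₑ ^ 2 := by
    rw [enorm_sq_eq_lintegral_bergmanRep]
    exact h1.trans (lintegral_mono_set hz)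
  have h3 := ENNReal.toReal_mono (by simp) h2
  rw [ENNReal.toReal_mul, ENNReal.toReal_pow, ENNReal.toReal_pow, toReal_enorm, toReal_enorm] at h3
  rw [inv_mul_eq_div, le_div_iff₀ (Real.sqrt_pos.mpr hvr)]
  refine abs_le_of_sq_le_sq' ?_ (norm_nonneg _) |>.2
  rw [mul_pow, Real.sq_sqrt hvr.le]
  exact h3

/-- Bounded point evaluations turn an `L²` limit into a locally uniform one, which is holomorphic by
Weierstrass; an a.e. convergent subsequence identifies the two limits. -/
theorem isClosed_bergmanSpace (hD : IsOpen D) :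
    IsClosed (bergmanSpace D : Set (Lp ℂ 2 ((volume : Measure (Fin n → ℂ)).restrict D))) := by
  refine IsSeqClosed.isClosed fun f f₀ hf hlim => ?_
  set F : ℕ → bergmanSpace D := fun k => ⟨f k, hf k⟩ with hF
  have hcau : CauchySeq F := by
    have h1 : CauchySeq f := hlim.cauchySeq
    rw [Metric.cauchySeq_iff] at h1 ⊢
    exact h1
  have hu : ∀ K ⊆ D, IsCompact K → UniformCauchySeqOn (fun k => bergmanRep (F k)) atTop K := by
    intro K hKD hK
    obtain ⟨r, hr, hrU⟩ := hK.exists_thickening_subset_open hD hKD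
    obtain ⟨C, hC0, hC⟩ := exists_norm_bergmanRep_le hr D
    rw [Metric.uniformCauchySeqOn_iff]
    intro ε hε
    obtain ⟨N, hN⟩ := Metric.cauchySeq_iff.mp hcau (ε / (C + 1)) (by positivity)
    refine ⟨N, fun j hj k hk x hx => ?_⟩
    have hb : Metric.ball x r ⊆ D := (Metric.ball_subset_thickening hx r).trans hrU
    have h2 := hN j hj k hk
    rw [dist_eq_norm] at h2
    rw [dist_eq_norm, ← bergmanRep_sub hD _ _ (hKD hx)]
    refine (hC x hb _).trans_lt ?_
    rw [lt_div_iff₀ (by positivity)] at h2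
    nlinarith [norm_nonneg (F j - F k)]
  have hpt : ∀ z ∈ D, ∃ L, Tendsto (fun k => bergmanRep (F k) z) atTop (𝓝 L) := fun z hz =>
    cauchy_map_iff_exists_tendsto.mp
      ((hu {z} (singleton_subset_iff.mpr hz) isCompact_singleton).cauchy_map (mem_singleton z))
  choose! g hg using hpt
  have hloc : TendstoLocallyUniformlyOn (fun k => bergmanRep (F k)) g atTop D :=
    (tendstoLocallyUniformlyOn_iff_forall_isCompact hD).mpr fun K hKD hK =>
      (hu K hKD hK).tendstoUniformlyOn_of_tendsto fun z hz => hg z (hKD hz)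
  refine ⟨g, DifferentiableOn.of_tendstoLocallyUniformlyOn hD
    (fun k => differentiableOn_bergmanRep (F k)) hloc, ?_⟩
  obtain ⟨ns, hns, hae⟩ := (tendstoInMeasure_of_tendsto_Lp hlim).exists_seq_tendsto_ae
  have hrep : ∀ᵐ x ∂(volume : Measure (Fin n → ℂ)).restrict D, ∀ k, f k x = bergmanRep (F k) x :=
    ae_all_iff.mpr fun k => coeFn_ae_eq_bergmanRep (F k)
  filter_upwards [hae, hrep, ae_restrict_mem hD.measurableSet] with x hx hr hxD
  refine tendsto_nhds_unique hx ?_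
  simp only [hr]
  exact (hg x hxD).comp hns.tendsto_atTop

theorem completeSpace_bergmanSpace (hD : IsOpen D) : CompleteSpace (bergmanSpace D) :=
  (isClosed_bergmanSpace hD).completeSpace_coe

end BergmanSpace

/-! ### Reproducing vectors and the holomorphic off-diagonal kernel. -/

section BergmanKernel

variable {n : ℕ} {D : Set (Fin n → ℂ)}

theorem exists_norm_bergmanRep_le_of_mem (hD : IsOpen D) {z : Fin n → ℂ} (hz : z ∈ D) :
    ∃ C : ℝ, ∀ f : bergmanSpace D, ‖bergmanRep f z‖ ≤ C * ‖f‖ := by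
  obtain ⟨r, hr, hrD⟩ := Metric.isOpen_iff.mp hD z hz
  obtain ⟨C, -, hC⟩ := exists_norm_bergmanRep_le hr D
  exact ⟨C, hC z hrD⟩

open Classical in
/-- Evaluation at `z` as a functional on the Bergman space of an open set `D` (zero if `z ∉ D`). -/
def bergmanEval (D : Set (Fin n → ℂ)) (z : Fin n → ℂ) : bergmanSpace D →L[ℂ] ℂ :=
  if h : IsOpen D ∧ z ∈ D then
    LinearMap.mkContinuousOfExistsBound
      { toFun := fun f => bergmanRep f z
        map_add' := fun f g => bergmanRep_add h.1 f g h.2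
        map_smul' := fun c f => bergmanRep_smul h.1 c f h.2 }
      (exists_norm_bergmanRep_le_of_mem h.1 h.2)
  else 0

theorem bergmanEval_apply (hD : IsOpen D) {z : Fin n → ℂ} (hz : z ∈ D) (f : bergmanSpace D) :
    bergmanEval D z f = bergmanRep f z := by
  rw [bergmanEval, dif_pos ⟨hD, hz⟩]; rfl

/-- Holomorphy in operator norm follows from holomorphy of each `f` and local boundedness of
evaluations. -/
theorem differentiableOn_bergmanEval (hD : IsOpen D) :
    DifferentiableOn ℂ (bergmanEval D) D := by
  refine differentiableOn_of_forall_apply (fun x hx => ?_) fun f => ?_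
  · obtain ⟨r, hr, hrD⟩ := Metric.isOpen_iff.mp hD x hx
    obtain ⟨C, hC0, hC⟩ := exists_norm_bergmanRep_le (half_pos hr) D
    refine ⟨r / 2, half_pos hr, C, (Metric.ball_subset_ball (by linarith)).trans hrD,
      fun y hy => ContinuousLinearMap.opNorm_le_bound _ hC0 fun f => ?_⟩
    have hb : Metric.ball y (r / 2) ⊆ D := by
      refine (Metric.ball_subset_ball' ?_).trans hrD
      rw [Metric.mem_ball] at hy
      linarith
    rw [bergmanEval_apply hD (hb (Metric.mem_ball_self (half_pos hr)))]
    exact hC y hb f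
  · exact (differentiableOn_bergmanRep f).congr fun z hz => bergmanEval_apply hD hz f

/-- The reproducing vector of the Bergman space at `z`. -/
def bergmanVector (hD : IsOpen D) (z : Fin n → ℂ) : bergmanSpace D :=
  haveI := completeSpace_bergmanSpace hD
  (InnerProductSpace.toDual ℂ (bergmanSpace D)).symm (bergmanEval D z)

theorem inner_bergmanVector (hD : IsOpen D) {z : Fin n → ℂ} (hz : z ∈ D) (f : bergmanSpace D) :
    inner ℂ (bergmanVector hD z) f = bergmanRep f z := by
  have := completeSpace_bergmanSpace hD
  rw [bergmanVector, InnerProductSpace.toDual_symm_apply, bergmanEval_apply hD hz]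

/-- Parseval's identity for a maximal orthonormal system. -/
theorem hasSum_norm_inner_sq_of_maximal {H : Type*} [NormedAddCommGroup H] [InnerProductSpace ℂ H]
    [CompleteSpace H] {v : Set H} (hv : Orthonormal ℂ ((↑) : v → H))
    (hmax : ∀ u ⊇ v, Orthonormal ℂ ((↑) : u → H) → u = v) (x : H) :
    HasSum (fun φ : v => ‖inner ℂ x φ.1‖ ^ 2) (‖x‖ ^ 2) := by
  have hbot := (maximal_orthonormal_iff_orthogonalComplement_eq_bot hv).mp hmax
  let b : HilbertBasis v ℂ H := HilbertBasis.mkOfOrthogonalEqBot hv (by simpa using hbot)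
  have hb : ∀ φ : v, b φ = φ.1 := fun φ => by
    simp only [b, HilbertBasis.coe_mkOfOrthogonalEqBot]
  have h := b.hasSum_inner_mul_inner x x
  rw [inner_self_eq_norm_sq_to_K] at h
  refine Complex.hasSum_ofReal.mp ?_
  have e : (fun φ : v => ((‖inner ℂ x φ.1‖ ^ 2 : ℝ) : ℂ))
      = fun φ : v => inner ℂ x (b φ) * inner ℂ (b φ) x := by
    funext φ
    rw [hb, ← inner_conj_symm φ.1 x, Complex.mul_conj, Complex.normSq_eq_norm_sq]
  rw [e]
  simpa using h

/-- Parseval for the reproducing vector, whose inner product with a basis element `φ` is `φ(z)`.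
From here on the chosen basis plays no role. -/
theorem bergmanKernel_eq_norm_sq (hD : IsOpen D) {z : Fin n → ℂ} (hz : z ∈ D) :
    bergmanKernel D z = ‖bergmanVector hD z‖ ^ 2 := by
  have := completeSpace_bergmanSpace hD
  obtain ⟨-, hon, hmax⟩ := Classical.choose_spec (exists_maximal_orthonormal (𝕜 := ℂ)
    (E := bergmanSpace D) (s := ∅) (orthonormal_empty ℂ (bergmanSpace D)))
  have h := hasSum_norm_inner_sq_of_maximal hon hmax (bergmanVector hD z)
  simp only [inner_bergmanVector hD hz] at h
  exact h.tsum_eq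

theorem bergmanRep_bergmanVector_self (hD : IsOpen D) {z : Fin n → ℂ} (hz : z ∈ D) :
    bergmanRep (bergmanVector hD z) z = (bergmanKernel D z : ℂ) := by
  rw [← inner_bergmanVector hD hz, bergmanKernel_eq_norm_sq hD hz]
  simp

theorem bergmanKernel_nonneg (D : Set (Fin n → ℂ)) (z : Fin n → ℂ) : 0 ≤ bergmanKernel D z :=
  tsum_nonneg fun _ => by positivity

theorem norm_bergmanRep_sq_le (hD : IsOpen D) {z : Fin n → ℂ} (hz : z ∈ D) (f : bergmanSpace D) :
    ‖bergmanRep f z‖ ^ 2 ≤ bergmanKernel D z * ‖f‖ ^ 2 := by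
  rw [← inner_bergmanVector hD hz, bergmanKernel_eq_norm_sq hD hz, ← mul_pow]
  gcongr
  exact norm_inner_le_norm (𝕜 := ℂ) (bergmanVector hD z) f

/-- The extremal property of the Bergman kernel. -/
theorem enorm_sq_le_bergmanKernel_mul (hD : IsOpen D) {z : Fin n → ℂ} (hz : z ∈ D)
    {g : (Fin n → ℂ) → ℂ} (hg : DifferentiableOn ℂ g D) {M : ℝ} (hM : 0 ≤ M)
    (hgM : ∫⁻ w in D, ‖g w‖ₑ ^ 2 ≤ ENNReal.ofReal M) :
    ‖g z‖ ^ 2 ≤ bergmanKernel D z * M := by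
  obtain ⟨f, hf⟩ := exists_bergmanRep_eqOn hD hg (ne_top_of_le_ne_top ENNReal.ofReal_ne_top hgM)
  rw [← hf hz]
  refine (norm_bergmanRep_sq_le hD hz f).trans ?_
  refine mul_le_mul_of_nonneg_left ?_ (bergmanKernel_nonneg D z)
  rw [← ENNReal.ofReal_le_ofReal_iff hM, ENNReal.ofReal_pow (norm_nonneg f), ofReal_norm,
    enorm_sq_eq_lintegral_bergmanRep, setLIntegral_congr_fun hD.measurableSet
      (fun w hw => by rw [hf hw])]
  exact hgM

/-- The off-diagonal Bergman kernel, with the second variable conjugated to make it holomorphic. -/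
def bergmanOffDiag (hD : IsOpen D) (q : (Fin n → ℂ) × (Fin n → ℂ)) : ℂ :=
  bergmanEval D q.1 (bergmanVector hD (star q.2))

theorem bergmanOffDiag_eq (hD : IsOpen D) {q : (Fin n → ℂ) × (Fin n → ℂ)} (hq : q.1 ∈ D) :
    bergmanOffDiag hD q = bergmanRep (bergmanVector hD (star q.2)) q.1 :=
  bergmanEval_apply hD hq _

theorem bergmanOffDiag_diag (hD : IsOpen D) {z : Fin n → ℂ} (hz : z ∈ D) :
    bergmanOffDiag hD (z, star z) = (bergmanKernel D z : ℂ) := by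
  rw [bergmanOffDiag_eq hD hz, star_star, bergmanRep_bergmanVector_self hD hz]

/-- The set on which the off-diagonal kernel of `D` is holomorphic. -/
def conjProd (D : Set (Fin n → ℂ)) : Set ((Fin n → ℂ) × (Fin n → ℂ)) :=
  {q | q.1 ∈ D ∧ star q.2 ∈ D}

theorem isOpen_conjProd (hD : IsOpen D) : IsOpen (conjProd D) :=
  (hD.preimage continuous_fst).inter (hD.preimage (continuous_star.comp continuous_snd))

/-- Coordinatewise conjugation as a semilinear map. -/
def piStar (n : ℕ) : (Fin n → ℂ) →SL[starRingEnd ℂ] (Fin n → ℂ) where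
  toFun := star
  map_add' := star_add
  map_smul' := fun c w => star_smul c w
  cont := continuous_star

/-- The Riesz isomorphism and `star` are both conjugate-linear; composing with both leaves a
holomorphic map. -/
theorem differentiableOn_bergmanVector_star (hD : IsOpen D) :
    DifferentiableOn ℂ (fun w => bergmanVector hD (star w)) {w | star w ∈ D} := by
  have := completeSpace_bergmanSpace hD
  intro w hw
  have h1 : DifferentiableAt ℂ (bergmanEval D) (piStar n w) :=
    (differentiableOn_bergmanEval hD).differentiableAt (hD.mem_nhds hw)
  let L : StrongDual ℂ (bergmanSpace D) →SL[starRingEnd ℂ] bergmanSpace D :=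
    (InnerProductSpace.toDual ℂ (bergmanSpace D)).symm.toContinuousLinearEquiv
  exact (DifferentiableAt.comp_semilinear₂ (V := Fin n → ℂ) (V' := Fin n → ℂ)
    (W := StrongDual ℂ (bergmanSpace D)) (W' := bergmanSpace D) L (piStar n)
    h1).differentiableWithinAt

theorem differentiableOn_bergmanOffDiag (hD : IsOpen D) :
    DifferentiableOn ℂ (bergmanOffDiag hD) (conjProd D) := by
  have h1 : DifferentiableOn ℂ (fun q : (Fin n → ℂ) × (Fin n → ℂ) => bergmanEval D q.1)
      (conjProd D) :=
    DifferentiableOn.comp (G := bergmanSpace D →L[ℂ] ℂ) (g := bergmanEval D) (t := D)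
      (differentiableOn_bergmanEval hD) (f := Prod.fst)
      (differentiable_fst (𝕜 := ℂ)).differentiableOn fun (q) (hq : q ∈ conjProd D) => hq.1
  have h2 : DifferentiableOn ℂ
      (fun q : (Fin n → ℂ) × (Fin n → ℂ) => bergmanVector hD (star q.2)) (conjProd D) :=
    (differentiableOn_bergmanVector_star hD).comp (f := Prod.snd)
      (differentiable_snd (𝕜 := ℂ)).differentiableOn fun (q) (hq : q ∈ conjProd D) => hq.2
  exact h1.clm_apply h2

theorem contDiffOn_bergmanOffDiag (hD : IsOpen D) :
    ContDiffOn ℂ ∞ (bergmanOffDiag hD) (conjProd D) :=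
  (differentiableOn_bergmanOffDiag hD).contDiffOn_of_finiteDimensional (isOpen_conjProd hD)

/-- The real-linear map `z ↦ (z, z̄)`. -/
def diagStar (n : ℕ) : (Fin n → ℂ) →L[ℝ] (Fin n → ℂ) × (Fin n → ℂ) :=
  (ContinuousLinearMap.id ℝ _).prod (starL' ℝ : (Fin n → ℂ) ≃L[ℝ] (Fin n → ℂ))

theorem diagStar_apply (z : Fin n → ℂ) : diagStar n z = (z, star z) := rfl

theorem diagStar_mem_conjProd {z : Fin n → ℂ} : diagStar n z ∈ conjProd D ↔ z ∈ D := by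
  simp [diagStar_apply, conjProd]

theorem bergmanKernel_eqOn (hD : IsOpen D) :
    EqOn (bergmanKernel D) (Complex.reCLM ∘ bergmanOffDiag hD ∘ diagStar n) D := fun z hz => by
  simp only [Function.comp_apply, diagStar_apply, bergmanOffDiag_diag hD hz, Complex.reCLM_apply,
    Complex.ofReal_re]

/-- The Bergman kernel function of an open set is smooth. -/
theorem contDiffOn_bergmanKernel (hD : IsOpen D) : ContDiffOn ℝ ∞ (bergmanKernel D) D := by
  refine ContDiffOn.congr ?_ (bergmanKernel_eqOn hD)
  refine Complex.reCLM.contDiff.comp_contDiffOn ?_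
  exact ((contDiffOn_bergmanOffDiag hD).restrict_scalars ℝ).comp (diagStar n).contDiff.contDiffOn
    fun z hz => diagStar_mem_conjProd.mpr hz

/-- Real derivatives of the kernel are the image of complex derivatives of the off-diagonal kernel
under a linear operation that does not depend on `D`, so convergence passes through it. -/
theorem iteratedFDeriv_bergmanKernel (hD : IsOpen D) {z : Fin n → ℂ} (hz : z ∈ D) (k : ℕ) :
    iteratedFDeriv ℝ k (bergmanKernel D) z =
      Complex.reCLM.compContinuousMultilinearMap
        (((iteratedFDeriv ℂ k (bergmanOffDiag hD) (diagStar n z)).restrictScalars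
          ℝ).compContinuousLinearMap fun _ => diagStar n) := by
  have hU := isOpen_conjProd hD
  have hpre : (diagStar n) ⁻¹' (conjProd D) = D := by
    ext z; exact diagStar_mem_conjProd
  have hz' : diagStar n z ∈ conjProd D := diagStar_mem_conjProd.mpr hz
  have hC := contDiffOn_bergmanOffDiag hD
  have hR : ContDiffOn ℝ k (bergmanOffDiag hD) (conjProd D) :=
    (hC.restrict_scalars ℝ).of_le (by exact_mod_cast le_top)
  have hRd : ContDiffOn ℝ k (bergmanOffDiag hD ∘ diagStar n) D :=
    hR.comp (diagStar n).contDiff.contDiffOn fun z hz => diagStar_mem_conjProd.mpr hz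
  have hev : bergmanKernel D =ᶠ[𝓝 z] Complex.reCLM ∘ bergmanOffDiag hD ∘ diagStar n :=
    (bergmanKernel_eqOn hD).eventuallyEq_of_mem (hD.mem_nhds hz)
  rw [(hev.iteratedFDeriv ℝ k).eq_of_nhds,
    Complex.reCLM.iteratedFDeriv_comp_left (hRd.contDiffAt (hD.mem_nhds hz)) le_rfl]
  congr 1
  rw [← iteratedFDerivWithin_of_isOpen k hD hz]
  have h1 := (diagStar n).iteratedFDerivWithin_comp_right hR hU.uniqueDiffOn
    (by rw [hpre]; exact hD.uniqueDiffOn) hz' le_rfl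
  rw [hpre, iteratedFDerivWithin_of_isOpen k hU hz'] at h1
  rw [h1]
  congr 1
  exact ((hC.contDiffAt (hU.mem_nhds hz')).of_le
    (by exact_mod_cast le_top)).restrictScalars_iteratedFDeriv.symm

end BergmanKernel

/-! ### Bounded domains: positivity of the kernel and `D* = D`. -/

section BoundedDomain

variable {n : ℕ} {D : Set (Fin n → ℂ)}

/-- On a bounded open set, bounded holomorphic functions are in the Bergman space. -/
theorem exists_bergmanRep_eqOn_of_bounded (hD : IsOpen D) (hb : Bornology.IsBounded D)
    {g : (Fin n → ℂ) → ℂ} (hg : Differentiable ℂ g) :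
    ∃ f : bergmanSpace D, EqOn (bergmanRep f) g D := by
  refine exists_bergmanRep_eqOn hD hg.differentiableOn ?_
  obtain ⟨C, hC⟩ := hb.isCompact_closure.exists_bound_of_continuousOn hg.continuous.continuousOn
  have hle : ∀ w ∈ D, ‖g w‖ₑ ^ 2 ≤ ENNReal.ofReal C ^ 2 := fun w hw => by
    gcongr
    rw [← ofReal_norm]
    exact ENNReal.ofReal_le_ofReal (hC w (subset_closure hw))
  refine ne_top_of_le_ne_top ?_ (setLIntegral_mono' hD.measurableSet hle)
  rw [setLIntegral_const]
  exact ENNReal.mul_ne_top (by simp) hb.measure_lt_top.ne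

/-- On a bounded set the constant 1 and the coordinate functions are square integrable, and they
suffice: for `X ≠ 0` take a coordinate with `X j ≠ 0`. -/
theorem bergmanStar_eq_of_bounded (hD : IsOpen D) (hb : Bornology.IsBounded D) :
    bergmanStar D = D := by
  refine subset_antisymm (fun z hz => hz.1) fun z hz => ⟨hz, ?_, fun X hX => ?_⟩
  · obtain ⟨f, hf⟩ := exists_bergmanRep_eqOn_of_bounded hD hb (differentiable_const (1 : ℂ))
    exact ⟨f, by rw [hf hz]; exact one_ne_zero⟩
  · obtain ⟨j, hj⟩ := Function.ne_iff.mp hX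
    obtain ⟨f, hf⟩ := exists_bergmanRep_eqOn_of_bounded hD hb
      (ContinuousLinearMap.proj (R := ℂ) (φ := fun _ : Fin n => ℂ) j).differentiable
    refine ⟨f, ?_⟩
    rw [(hf.eventuallyEq_of_mem (hD.mem_nhds hz)).fderiv_eq, ContinuousLinearMap.fderiv]
    exact hj

theorem bergmanKernel_pos_of_bounded (hD : IsOpen D) (hb : Bornology.IsBounded D)
    {z : Fin n → ℂ} (hz : z ∈ D) : 0 < bergmanKernel D z := by
  obtain ⟨f, hf⟩ := exists_bergmanRep_eqOn_of_bounded hD hb (differentiable_const (1 : ℂ))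
  have h := norm_bergmanRep_sq_le hD hz f
  rw [hf hz, norm_one, one_pow] at h
  refine (bergmanKernel_nonneg D z).lt_of_ne fun h0 => ?_
  rw [← h0, zero_mul] at h
  linarith

end BoundedDomain

/-! ### Comparison of kernels of different domains. -/

section Comparison

variable {n : ℕ} {D D' : Set (Fin n → ℂ)}

theorem lintegral_comp_real_smul_le {c : ℝ} (hc : 0 < c) (hD : IsOpen D) (hD' : IsOpen D')
    (hmap : ∀ z ∈ D, c • z ∈ D') (φ : (Fin n → ℂ) → ENNReal) :
    ∫⁻ w in D, φ (c • w) ≤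
      ENNReal.ofReal ((c ^ Module.finrank ℝ (Fin n → ℂ))⁻¹) * ∫⁻ w in D', φ w := by
  calc ∫⁻ w in D, φ (c • w) = ∫⁻ w in D, D'.indicator φ (c • w) :=
        setLIntegral_congr_fun hD.measurableSet fun w hw => by
          rw [indicator_of_mem (hmap w hw)]
    _ ≤ ∫⁻ w, D'.indicator φ (c • w) := setLIntegral_le_lintegral _ _
    _ = ∫⁻ w, D'.indicator φ w ∂(Measure.map (c • ·) volume) :=
        ((Homeomorph.smulOfNeZero c hc.ne').measurableEmbedding.lintegral_map _).symm
    _ = _ := by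
        rw [Measure.map_addHaar_smul _ hc.ne', lintegral_smul_measure,
          lintegral_indicator hD'.measurableSet, abs_of_pos (by positivity), smul_eq_mul]

/-- Behaviour of the Bergman kernel under dilations and inclusions. -/
theorem bergmanKernel_smul_le {c : ℝ} (hc : 0 < c) (hD : IsOpen D) (hD' : IsOpen D')
    (hmap : ∀ z ∈ D, c • z ∈ D') {z : Fin n → ℂ} (hz : z ∈ D) :
    bergmanKernel D' (c • z) ≤ (c ^ Module.finrank ℝ (Fin n → ℂ))⁻¹ * bergmanKernel D z := by
  -- Test the extremal property on `D` with the pullback of this vector: its value at `z` is `K` and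
  -- its squared norm is at most `c⁻ᴺ K`, where `N` is the real dimension. Hence `K² ≤ K_D(z) c⁻ᴺ
  -- K`.
  set f := bergmanVector hD' (c • z) with hf
  set K := bergmanKernel D' (c • z) with hK
  have hK0 : 0 ≤ K := bergmanKernel_nonneg _ _
  have hn : ‖f‖ₑ ^ 2 = ENNReal.ofReal K := by
    rw [hK, bergmanKernel_eq_norm_sq hD' (hmap z hz), ENNReal.ofReal_pow (norm_nonneg _),
      ofReal_norm]
  have hd : DifferentiableOn ℂ (fun w => bergmanRep f (c • w)) D :=
    (differentiableOn_bergmanRep f).comp (f := fun w => c • w)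
      ((differentiable_id.const_smul c).differentiableOn) hmap
  have h := enorm_sq_le_bergmanKernel_mul hD hz hd
    (M := (c ^ Module.finrank ℝ (Fin n → ℂ))⁻¹ * K) (by positivity) (by
      rw [ENNReal.ofReal_mul (by positivity), ← hn, enorm_sq_eq_lintegral_bergmanRep]
      exact lintegral_comp_real_smul_le hc hD hD' hmap fun w => ‖bergmanRep f w‖ₑ ^ 2)
  rw [bergmanRep_bergmanVector_self hD' (hmap z hz), Complex.norm_real,
    Real.norm_of_nonneg hK0] at h
  rcases hK0.eq_or_lt with h0 | h0
  · rw [← h0]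
    exact mul_nonneg (by positivity) (bergmanKernel_nonneg _ _)
  · refine le_of_mul_le_mul_right ?_ h0
    calc K * K = K ^ 2 := (sq K).symm
      _ ≤ _ := h
      _ = _ := by ring

/-- Comparison of the off-diagonal kernels of two nested domains. -/
theorem norm_bergmanOffDiag_sub_sq_le (hD : IsOpen D) (hD' : IsOpen D') (hsub : D' ⊆ D)
    {q : (Fin n → ℂ) × (Fin n → ℂ)} (hq : q ∈ conjProd D') :
    ‖bergmanOffDiag hD' q - bergmanOffDiag hD q‖ ^ 2 ≤
      bergmanKernel D' q.1 * (bergmanKernel D' (star q.2) - bergmanKernel D (star q.2)) := by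
  set w := star q.2 with hw
  have hwD' : w ∈ D' := hq.2
  set k := bergmanVector hD w with hk
  have hkint : ∫⁻ x in D', ‖bergmanRep k x‖ₑ ^ 2 ≤ ‖k‖ₑ ^ 2 := by
    rw [enorm_sq_eq_lintegral_bergmanRep]; exact lintegral_mono_set hsub
  obtain ⟨g, hg⟩ := exists_bergmanRep_eqOn hD' ((differentiableOn_bergmanRep k).mono hsub)
    (ne_top_of_le_ne_top (by simp) hkint)
  have hgk : ‖g‖ ^ 2 ≤ bergmanKernel D w := by
    rw [bergmanKernel_eq_norm_sq hD (hsub hwD'), ← ENNReal.ofReal_le_ofReal_iff (by positivity),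
      ENNReal.ofReal_pow (norm_nonneg _), ENNReal.ofReal_pow (norm_nonneg _), ofReal_norm,
      ofReal_norm, enorm_sq_eq_lintegral_bergmanRep,
      setLIntegral_congr_fun hD'.measurableSet (fun x hx => by rw [hg hx])]
    exact hkint
  -- Expanding the square, the cross term is `-2 g(w) = -2 K_D(w)` by reproduction, and `‖g‖² ≤
  -- K_D(w)`.
  have hnorm : ‖bergmanVector hD' w - g‖ ^ 2 ≤ bergmanKernel D' w - bergmanKernel D w := by
    rw [norm_sub_sq (𝕜 := ℂ), inner_bergmanVector hD' hwD', hg hwD', hk,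
      bergmanRep_bergmanVector_self hD (hsub hwD'), ← bergmanKernel_eq_norm_sq hD' hwD']
    simp only [RCLike.re_to_complex, Complex.ofReal_re]
    linarith
  rw [bergmanOffDiag_eq hD' hq.1, bergmanOffDiag_eq hD (hsub hq.1), ← hg hq.1,
    ← bergmanRep_sub hD' _ _ hq.1]
  refine (norm_bergmanRep_sq_le hD' hq.1 _).trans ?_
  exact mul_le_mul_of_nonneg_left hnorm (bergmanKernel_nonneg _ _)

end Comparison

/-! ### Convergence of kernels of squeezed domains. -/

section Convergence

variable {n : ℕ} {B : Set (Fin n → ℂ)} {ι : Type*} {l : Filter ι} {D : ι → Set (Fin n → ℂ)}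

/-- The radii `r < 1` close to `1` for which the kernels of `r B` and `r⁻¹ B` are close. -/
theorem exists_dilation_bergmanKernel_close (hB : IsOpen B) {S : Set (Fin n → ℂ)}
    (hS : IsCompact S) (hSB : S ⊆ B) {ε : ℝ} (hε : 0 < ε) :
    ∃ r : ℝ, 0 < r ∧ r < 1 ∧ ∀ w ∈ S, r⁻¹ • w ∈ B ∧
      (r ^ Module.finrank ℝ (Fin n → ℂ))⁻¹ * bergmanKernel B (r⁻¹ • w) < bergmanKernel B w + 1 ∧
      (r ^ Module.finrank ℝ (Fin n → ℂ))⁻¹ * bergmanKernel B (r⁻¹ • w)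
        - r ^ Module.finrank ℝ (Fin n → ℂ) * bergmanKernel B (r • w) < ε ∧ r • w ∈ B := by
  have hcont : ContinuousOn (bergmanKernel B) B := (contDiffOn_bergmanKernel hB).continuousOn
  set N := Module.finrank ℝ (Fin n → ℂ)
  have hev : ∀ᶠ r in 𝓝 (1 : ℝ), ∀ w ∈ S, r⁻¹ • w ∈ B ∧
      (r ^ N)⁻¹ * bergmanKernel B (r⁻¹ • w) < bergmanKernel B w + 1 ∧
      (r ^ N)⁻¹ * bergmanKernel B (r⁻¹ • w) - r ^ N * bergmanKernel B (r • w) < ε ∧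
      r • w ∈ B := by
    -- All conditions are open in `(r, w)` and hold at `r = 1`; compactness of `S` makes the
    -- neighbourhood of `1` uniform in `w`.
    refine hS.eventually_forall_of_forall_eventually fun w hw => ?_
    have hK : ContinuousAt (bergmanKernel B) w := hcont.continuousAt (hB.mem_nhds (hSB hw))
    have h1 : Tendsto (fun p : ℝ × (Fin n → ℂ) => p.1) (𝓝 (1, w)) (𝓝 1) :=
      continuous_fst.tendsto (1, w)
    have h2 : Tendsto (fun p : ℝ × (Fin n → ℂ) => p.2) (𝓝 (1, w)) (𝓝 w) :=
      continuous_snd.tendsto (1, w)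
    have h3 : Tendsto (fun p : ℝ × (Fin n → ℂ) => p.1⁻¹ • p.2) (𝓝 (1, w)) (𝓝 w) := by
      simpa using (h1.inv₀ one_ne_zero).smul h2
    have h4 : Tendsto (fun p : ℝ × (Fin n → ℂ) => p.1 • p.2) (𝓝 (1, w)) (𝓝 w) := by
      simpa using h1.smul h2
    have hp : Tendsto (fun p : ℝ × (Fin n → ℂ) => p.1 ^ N) (𝓝 (1, w)) (𝓝 1) := by
      simpa using h1.pow N
    have h5 : Tendsto (fun p : ℝ × (Fin n → ℂ) => (p.1 ^ N)⁻¹ * bergmanKernel B (p.1⁻¹ • p.2))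
        (𝓝 (1, w)) (𝓝 (bergmanKernel B w)) := by
      simpa using (hp.inv₀ one_ne_zero).mul (hK.tendsto.comp h3)
    have h6 : Tendsto (fun p : ℝ × (Fin n → ℂ) => p.1 ^ N * bergmanKernel B (p.1 • p.2))
        (𝓝 (1, w)) (𝓝 (bergmanKernel B w)) := by
      simpa using hp.mul (hK.tendsto.comp h4)
    have h7 : Tendsto (fun p : ℝ × (Fin n → ℂ) => bergmanKernel B p.2 + 1)
        (𝓝 (1, w)) (𝓝 (bergmanKernel B w + 1)) := (hK.tendsto.comp h2).add_const 1
    have h8 : Tendsto (fun p : ℝ × (Fin n → ℂ) =>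
        (p.1 ^ N)⁻¹ * bergmanKernel B (p.1⁻¹ • p.2) - p.1 ^ N * bergmanKernel B (p.1 • p.2))
        (𝓝 (1, w)) (𝓝 0) := by simpa using h5.sub h6
    filter_upwards [h3.eventually (hB.mem_nhds (hSB hw)), h5.eventually_lt h7 (lt_add_one _),
      h8.eventually (gt_mem_nhds hε), h4.eventually (hB.mem_nhds (hSB hw))] with p a b c d
    exact ⟨a, b, c, d⟩
  have h2 : ∀ᶠ r in 𝓝[<] (1 : ℝ), 0 < r ∧ r < 1 :=
    (eventually_nhdsWithin_of_eventually_nhds (lt_mem_nhds one_pos)).and self_mem_nhdsWithin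
  obtain ⟨r, hr, h0, h1⟩ := ((eventually_nhdsWithin_of_eventually_nhds hev).and h2).exists
  exact ⟨r, h0, h1, hr⟩

/-- Both `B` and `D i` contain `rB` and lie in `r⁻¹B`, so both off-diagonal kernels are close to
that of `rB`, with an error governed by diagonal kernels of dilates of `B`. -/
theorem tendstoUniformlyOn_bergmanOffDiag (hB : IsOpen B) (hD : ∀ i, IsOpen (D i))
    (hin : ∀ r : ℝ, 0 < r → r < 1 → ∀ᶠ i in l, ∀ z, r⁻¹ • z ∈ B → z ∈ D i)
    (hBr : ∀ r : ℝ, 0 < r → r < 1 → ∀ z ∈ B, r • z ∈ B)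
    (hout : ∀ r : ℝ, 0 < r → r < 1 → ∀ᶠ i in l, ∀ z ∈ D i, r • z ∈ B)
    {Q : Set ((Fin n → ℂ) × (Fin n → ℂ))} (hQ : IsCompact Q) (hQB : Q ⊆ conjProd B) :
    TendstoUniformlyOn (fun i => bergmanOffDiag (hD i)) (bergmanOffDiag hB) l Q := by
  set S : Set (Fin n → ℂ) := Prod.fst '' Q ∪ (fun q => star q.2) '' Q with hSdef
  have hS : IsCompact S := (hQ.image continuous_fst).union
    (hQ.image (continuous_star.comp continuous_snd))
  have hSB : S ⊆ B := by
    rintro z (⟨q, hq, rfl⟩ | ⟨q, hq, rfl⟩)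
    exacts [(hQB hq).1, (hQB hq).2]
  obtain ⟨M, hM⟩ := hS.exists_bound_of_continuousOn
    ((contDiffOn_bergmanKernel hB).continuousOn.mono hSB)
  rw [Metric.tendstoUniformlyOn_iff]
  intro ε hε
  set M' := max M 0 + 1 with hM'
  have hM'0 : 0 < M' := by positivity
  obtain ⟨r, hr0, hr1, hr⟩ := exists_dilation_bergmanKernel_close hB hS hSB
    (ε := (ε / 2) ^ 2 / M') (by positivity)
  have hBo : IsOpen {z : Fin n → ℂ | r⁻¹ • z ∈ B} := hB.preimage (continuous_const_smul r⁻¹)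
  -- `B'` is the dilate `rB`.
  set B' := {z : Fin n → ℂ | r⁻¹ • z ∈ B} with hB'
  have hB'B : B' ⊆ B := fun z hz => by
    have := hBr r hr0 hr1 _ hz
    rwa [smul_inv_smul₀ hr0.ne'] at this
  set N := Module.finrank ℝ (Fin n → ℂ)
  have hKB' : ∀ z ∈ S, bergmanKernel B' z ≤ (r ^ N)⁻¹ * bergmanKernel B (r⁻¹ • z) := fun z hz => by
    have := bergmanKernel_smul_le hr0 hB hBo
      (fun z hz => show r⁻¹ • r • z ∈ B by rwa [inv_smul_smul₀ hr0.ne']) (hr z hz).1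
    rwa [smul_inv_smul₀ hr0.ne'] at this
  have hSB' : ∀ z ∈ S, z ∈ B' := fun z hz => (hr z hz).1
  have hgen : ∀ (E : Set (Fin n → ℂ)) (hE : IsOpen E), B' ⊆ E → (∀ z ∈ E, r • z ∈ B) →
      ∀ q ∈ Q, ‖bergmanOffDiag hBo q - bergmanOffDiag hE q‖ < ε / 2 := by
    intro E hE hBE hEB q hq
    have hz : q.1 ∈ S := Or.inl ⟨q, hq, rfl⟩
    have hw : star q.2 ∈ S := Or.inr ⟨q, hq, rfl⟩
    have h1 := norm_bergmanOffDiag_sub_sq_le hE hBo hBE (q := q) ⟨hSB' _ hz, hSB' _ hw⟩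
    have h2 := bergmanKernel_smul_le hr0 hE hB hEB (hBE (hSB' _ hw))
    rw [← div_eq_inv_mul, le_div_iff₀ (by positivity), mul_comm] at h2
    have h3 : bergmanKernel B' q.1 ≤ M' := by
      have h4 := hM _ hz
      rw [Real.norm_of_nonneg (bergmanKernel_nonneg _ _)] at h4
      linarith [hKB' _ hz, (hr _ hz).2.1, le_max_left M 0]
    have h5 : bergmanKernel B' (star q.2) - bergmanKernel E (star q.2) < (ε / 2) ^ 2 / M' := by
      linarith [hKB' _ hw, (hr _ hw).2.2.1]
    refine lt_of_pow_lt_pow_left₀ 2 (by positivity) (h1.trans_lt ?_)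
    rcases le_or_gt (bergmanKernel B' (star q.2) - bergmanKernel E (star q.2)) 0 with h6 | h6
    · exact (mul_nonpos_of_nonneg_of_nonpos (bergmanKernel_nonneg _ _) h6).trans_lt (by positivity)
    · calc _ ≤ M' * (bergmanKernel B' (star q.2) - bergmanKernel E (star q.2)) :=
            mul_le_mul_of_nonneg_right h3 h6.le
        _ < M' * ((ε / 2) ^ 2 / M') := mul_lt_mul_of_pos_left h5 hM'0
        _ = _ := by field_simp
  filter_upwards [hin r hr0 hr1, hout r hr0 hr1] with i hi ho q hq
  have h1 := hgen B hB hB'B (hBr r hr0 hr1) q hq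
  have h2 := hgen (D i) (hD i) hi ho q hq
  rw [dist_eq_norm]
  calc ‖bergmanOffDiag hB q - bergmanOffDiag (hD i) q‖
      = ‖(bergmanOffDiag hBo q - bergmanOffDiag (hD i) q)
          - (bergmanOffDiag hBo q - bergmanOffDiag hB q)‖ := by congr 1; abel
    _ ≤ _ := norm_sub_le _ _
    _ < ε := by linarith

/-- Convergence of all derivatives of the Bergman kernels, if the domains are squeezed between
dilates of the limit domain. -/
theorem tendstoUniformlyOn_iteratedFDeriv_bergmanKernel (hB : IsOpen B)
    (hD : ∀ᶠ i in l, IsOpen (D i))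
    (hin : ∀ r : ℝ, 0 < r → r < 1 → ∀ᶠ i in l, ∀ z, r⁻¹ • z ∈ B → z ∈ D i)
    (hBr : ∀ r : ℝ, 0 < r → r < 1 → ∀ z ∈ B, r • z ∈ B)
    (hout : ∀ r : ℝ, 0 < r → r < 1 → ∀ᶠ i in l, ∀ z ∈ D i, r • z ∈ B)
    (hK : ∀ K ⊆ B, IsCompact K → ∀ᶠ i in l, K ⊆ D i) (k : ℕ)
    {S : Set (Fin n → ℂ)} (hS : IsCompact S) (hSB : S ⊆ B) :
    TendstoUniformlyOn (fun i => iteratedFDeriv ℝ k (bergmanKernel (D i)))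
      (iteratedFDeriv ℝ k (bergmanKernel B)) l S := by
  -- `bergmanOffDiag` takes a proof of openness, while `D i` is open only eventually. The interior
  -- provides a family open for every index.
  have hInterior : ∀ᶠ i in l, interior (D i) = D i := hD.mono fun i hi => hi.interior_eq
  have hD' : ∀ i, IsOpen (interior (D i)) := fun i => isOpen_interior
  have hoff := fun (Q : Set ((Fin n → ℂ) × (Fin n → ℂ))) (hQB : Q ⊆ conjProd B)
      (hQ : IsCompact Q) =>
    tendstoUniformlyOn_bergmanOffDiag (l := l) (D := fun i => interior (D i)) hB hD'
    (fun r h0 h1 => by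
      filter_upwards [hInterior, hin r h0 h1] with i hi h
      rwa [hi]) hBr
    (fun r h0 h1 => by
      filter_upwards [hInterior, hout r h0 h1] with i hi h
      rwa [hi]) hQ hQB
  have hev : ∀ Q ⊆ conjProd B, IsCompact Q →
      ∀ᶠ i in l, ∀ y ∈ Q, ContDiffAt ℂ ∞ (bergmanOffDiag (hD' i)) y := by
    intro Q hQB hQ
    have h1 := hK _ (image_subset_iff.mpr fun q hq => (hQB hq).1) (hQ.image continuous_fst)
    have h2 := hK _ (image_subset_iff.mpr fun q hq => (hQB hq).2)
      (hQ.image (continuous_star.comp continuous_snd))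
    filter_upwards [h1, h2, hInterior] with i a b hi q hq
    refine (contDiffOn_bergmanOffDiag (hD' i)).contDiffAt
      ((isOpen_conjProd (hD' i)).mem_nhds ⟨?_, ?_⟩)
    · rw [hi]; exact a ⟨q, hq, rfl⟩
    · rw [hi]; exact b ⟨q, hq, rfl⟩
  have hconv := tendstoUniformlyOn_iteratedFDeriv_of_forall_isCompact (isOpen_conjProd hB) hev
    (contDiffOn_bergmanOffDiag hB) hoff k (K := diagStar n '' S)
    (image_subset_iff.mpr fun z hz => diagStar_mem_conjProd.mpr (hSB hz))
    (hS.image (diagStar n).continuous)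
  have hcomp := (hconv.comp (diagStar n)).mono (subset_preimage_image (diagStar n) S)
  let T₁ : ContinuousMultilinearMap ℂ (fun _ : Fin k => (Fin n → ℂ) × (Fin n → ℂ)) ℂ →L[ℝ]
      ContinuousMultilinearMap ℝ (fun _ : Fin k => (Fin n → ℂ) × (Fin n → ℂ)) ℂ :=
    ContinuousMultilinearMap.restrictScalarsLinear ℝ
  let T₂ : ContinuousMultilinearMap ℝ (fun _ : Fin k => (Fin n → ℂ) × (Fin n → ℂ)) ℂ →L[ℝ]
      ContinuousMultilinearMap ℝ (fun _ : Fin k => (Fin n → ℂ)) ℂ :=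
    ContinuousMultilinearMap.compContinuousLinearMapL fun _ : Fin k => diagStar n
  let T₃ : ContinuousMultilinearMap ℝ (fun _ : Fin k => (Fin n → ℂ)) ℂ →L[ℝ]
      ContinuousMultilinearMap ℝ (fun _ : Fin k => (Fin n → ℂ)) ℝ :=
    ContinuousLinearMap.compContinuousMultilinearMapL ℝ _ ℂ ℝ Complex.reCLM
  -- The passage from complex off-diagonal derivatives to real diagonal ones as a single continuous
  -- linear map, hence uniformly continuous.
  let T := T₃.comp (T₂.comp T₁)
  have hT := T.uniformContinuous.comp_tendstoUniformlyOn hcomp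
  refine (hT.congr ?_).congr_right fun z hz => ?_
  · filter_upwards [hInterior, hK S hSB hS] with i hi hSD z hz
    have hz' : z ∈ interior (D i) := by rw [hi]; exact hSD hz
    exact (iteratedFDeriv_bergmanKernel (hD' i) hz' k).symm.trans (by rw [hi])
  · exact (iteratedFDeriv_bergmanKernel hB (hSB hz) k).symm

end Convergence

/-! ### The complex Hessian in terms of real second derivatives. -/

section ComplexHessian

variable {n : ℕ}

/-- The `(u, v)` component of the Levi form attached to a real bilinear form `S`. -/
def leviOf (S : (Fin n → ℂ) → (Fin n → ℂ) → ℝ) (u v : Fin n → ℂ) : ℂ :=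
  (((S u v + S (Complex.I • u) (Complex.I • v) : ℝ) : ℂ)
    + Complex.I * ((S u (Complex.I • v) - S (Complex.I • u) v : ℝ) : ℂ)) / 4

theorem smul_single_one (i : Fin n) :
    Complex.I • (Pi.single i 1 : Fin n → ℂ) = Pi.single i Complex.I := by
  rw [← Pi.single_smul, smul_eq_mul, mul_one]

/-- Replaces the iterated Wirtinger derivatives by a linear expression in the real second
derivative, so that the Hessian depends visibly on the 2-jet alone. -/
theorem complexHessian_apply {f : (Fin n → ℂ) → ℝ} {z : Fin n → ℂ} (hf : ContDiffAt ℝ 2 f z)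
    (i j : Fin n) :
    complexHessian f z i j =
      leviOf (fun u v => fderiv ℝ (fderiv ℝ f) z u v) (Pi.single i 1) (Pi.single j 1) := by
  have hd : ∀ᶠ w in 𝓝 z, DifferentiableAt ℝ f w := by
    filter_upwards [hf.eventually (by simp)] with w hw
    exact hw.differentiableAt (by simp)
  have hd2 : DifferentiableAt ℝ (fderiv ℝ f) z :=
    (hf.fderiv_right (m := 1) (by norm_num)).differentiableAt (by simp)
  have hA : ∀ v, HasFDerivAt (fun w => ((fderiv ℝ f w v : ℝ) : ℂ))
      (Complex.ofRealCLM.comp ((fderiv ℝ (fderiv ℝ f) z).flip v)) z := fun v => by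
    have h1 : HasFDerivAt (fun w => fderiv ℝ f w v) ((fderiv ℝ (fderiv ℝ f) z).flip v) z := by
      have := hd2.hasFDerivAt.clm_apply (hasFDerivAt_const v z)
      simpa using this
    exact Complex.ofRealCLM.hasFDerivAt.comp z h1
  have hbar : wirtingerBar j (fun w => (f w : ℂ)) =ᶠ[𝓝 z] fun w =>
      (((fderiv ℝ f w (Pi.single j 1) : ℝ) : ℂ)
        + Complex.I * ((fderiv ℝ f w (Pi.single j Complex.I) : ℝ) : ℂ)) / 2 := by
    filter_upwards [hd] with w hw
    have : HasFDerivAt (fun w => (f w : ℂ)) (Complex.ofRealCLM.comp (fderiv ℝ f w)) w :=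
      Complex.ofRealCLM.hasFDerivAt.comp w hw.hasFDerivAt
    simp only [wirtingerBar, this.fderiv]
    rfl
  have hder : HasFDerivAt (fun w =>
      (((fderiv ℝ f w (Pi.single j 1) : ℝ) : ℂ)
        + Complex.I * ((fderiv ℝ f w (Pi.single j Complex.I) : ℝ) : ℂ)) / 2)
      ((2 : ℂ)⁻¹ • (Complex.ofRealCLM.comp ((fderiv ℝ (fderiv ℝ f) z).flip (Pi.single j 1))
        + Complex.I • Complex.ofRealCLM.comp
          ((fderiv ℝ (fderiv ℝ f) z).flip (Pi.single j Complex.I)))) z := by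
    have := ((hA (Pi.single j 1)).add
      ((hA (Pi.single j Complex.I)).const_mul Complex.I)).const_mul (2 : ℂ)⁻¹
    refine this.congr_of_eventuallyEq (Eventually.of_forall fun w => ?_)
    simp only [Pi.add_apply]
    ring
  simp only [complexHessian, Matrix.of_apply, wirtinger, hbar.fderiv_eq, hder.fderiv, leviOf,
    smul_single_one]
  simp
  linear_combination ((fderiv ℝ (fderiv ℝ f) z (Pi.single i Complex.I) (Pi.single j Complex.I) : ℝ)
    : ℂ) * (-1 / 4) * Complex.I_mul_I

theorem fderiv_fderiv_log_apply {f : (Fin n → ℂ) → ℝ} {z : Fin n → ℂ} (hf : ContDiffAt ℝ 2 f z)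
    (h0 : f z ≠ 0) (u v : Fin n → ℂ) :
    fderiv ℝ (fderiv ℝ fun w => Real.log (f w)) z u v =
      (f z)⁻¹ * fderiv ℝ (fderiv ℝ f) z u v
        - (f z)⁻¹ ^ 2 * (fderiv ℝ f z u * fderiv ℝ f z v) := by
  have hev : fderiv ℝ (fun w => Real.log (f w)) =ᶠ[𝓝 z] fun w => (f w)⁻¹ • fderiv ℝ f w := by
    filter_upwards [hf.eventually (by simp), hf.continuousAt.eventually_ne h0] with w hw hw0
    exact ((hw.differentiableAt (by simp)).hasFDerivAt.log hw0).fderiv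
  have hd2 : DifferentiableAt ℝ (fderiv ℝ f) z :=
    (hf.fderiv_right (m := 1) (by norm_num)).differentiableAt (by simp)
  have hd : HasFDerivAt f (fderiv ℝ f z) z := (hf.differentiableAt (by simp)).hasFDerivAt
  have hinv : HasFDerivAt (fun w => (f w)⁻¹) (-((f z) ^ 2)⁻¹ • fderiv ℝ f z) z :=
    (hasDerivAt_inv h0).comp_hasFDerivAt z hd
  have hs : HasFDerivAt (fun w => (f w)⁻¹ • fderiv ℝ f w) _ z := hinv.smul hd2.hasFDerivAt
  rw [hev.fderiv_eq, hs.fderiv]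
  simp
  ring

end ComplexHessian

/-! ### Convergence of the canonical invariant. -/

section InvariantConvergence

variable {n : ℕ}

/-- The Bergman canonical invariant as a function of the `2`-jet of the kernel. -/
def jetInvariant (p : ℝ × ((Fin n → ℂ) [×1]→L[ℝ] ℝ) × ((Fin n → ℂ) [×2]→L[ℝ] ℝ)) : ℝ :=
  (Matrix.of fun i j : Fin n => leviOf
    (fun u v => p.1⁻¹ * p.2.2 ![u, v] - p.1⁻¹ ^ 2 * (p.2.1 ![u] * p.2.1 ![v]))
    (Pi.single i 1) (Pi.single j 1)).det.re / p.1

theorem bergmanInvariant_eq_jetInvariant {D : Set (Fin n → ℂ)} {z : Fin n → ℂ}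
    (hK : ContDiffAt ℝ 2 (bergmanKernel D) z) (h0 : bergmanKernel D z ≠ 0) :
    bergmanInvariant D z = jetInvariant (bergmanKernel D z,
      iteratedFDeriv ℝ 1 (bergmanKernel D) z, iteratedFDeriv ℝ 2 (bergmanKernel D) z) := by
  simp only [bergmanInvariant, jetInvariant]
  congr 3
  ext i j
  rw [bergmanMetric, complexHessian_apply (hK.log h0)]
  simp only [Matrix.of_apply, fderiv_fderiv_log_apply hK h0, iteratedFDeriv_one_apply,
    iteratedFDeriv_two_apply]
  rfl

theorem continuousAt_jetInvariant
    {p : ℝ × ((Fin n → ℂ) [×1]→L[ℝ] ℝ) × ((Fin n → ℂ) [×2]→L[ℝ] ℝ)} (hp : p.1 ≠ 0) :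
    ContinuousAt jetInvariant p := by
  have h1 : ∀ m, ContinuousAt (fun p : ℝ × ((Fin n → ℂ) [×1]→L[ℝ] ℝ) ×
      ((Fin n → ℂ) [×2]→L[ℝ] ℝ) => p.2.1 m) p := fun m =>
    ((ContinuousMultilinearMap.apply ℝ (fun _ : Fin 1 => (Fin n → ℂ)) ℝ m).continuous.comp
      (continuous_fst.comp continuous_snd)).continuousAt
  have h2 : ∀ m, ContinuousAt (fun p : ℝ × ((Fin n → ℂ) [×1]→L[ℝ] ℝ) ×
      ((Fin n → ℂ) [×2]→L[ℝ] ℝ) => p.2.2 m) p := fun m =>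
    ((ContinuousMultilinearMap.apply ℝ (fun _ : Fin 2 => (Fin n → ℂ)) ℝ m).continuous.comp
      (continuous_snd.comp continuous_snd)).continuousAt
  have h3 : ContinuousAt (fun p : ℝ × ((Fin n → ℂ) [×1]→L[ℝ] ℝ) ×
      ((Fin n → ℂ) [×2]→L[ℝ] ℝ) => p.1⁻¹) p := continuousAt_fst.inv₀ hp
  have h4 : ∀ u v, ContinuousAt (fun p : ℝ × ((Fin n → ℂ) [×1]→L[ℝ] ℝ) ×
      ((Fin n → ℂ) [×2]→L[ℝ] ℝ) =>
        ((p.1⁻¹ * p.2.2 ![u, v] - p.1⁻¹ ^ 2 * (p.2.1 ![u] * p.2.1 ![v]) : ℝ))) p := fun u v =>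
    (h3.mul (h2 _)).sub ((h3.pow 2).mul ((h1 _).mul (h1 _)))
  refine ContinuousAt.div ?_ continuousAt_fst hp
  refine Complex.continuous_re.continuousAt.comp ?_
  refine (Continuous.matrix_det continuous_id).continuousAt.comp ?_
  refine continuousAt_pi.mpr fun i => continuousAt_pi.mpr fun j => ?_
  simp only [Matrix.of_apply, leviOf]
  refine ContinuousAt.div_const (ContinuousAt.add ?_ (continuousAt_const.mul ?_)) 4
  · exact Complex.continuous_ofReal.continuousAt.comp ((h4 _ _).add (h4 _ _))
  · exact Complex.continuous_ofReal.continuousAt.comp ((h4 _ _).sub (h4 _ _))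

/-- With a limit continuous at `x`, locally uniform convergence gives a limit along `l ×ˢ 𝓝 x`. In
this form it can be composed with a map continuous only at the limit value, such as `jetInvariant`.
-/
theorem TendstoLocallyUniformlyOn.tendsto_uncurry {X Y ι : Type*} [TopologicalSpace X]
    [UniformSpace Y] {l : Filter ι} {F : ι → X → Y} {f : X → Y} {U : Set X} (hU : IsOpen U)
    (h : TendstoLocallyUniformlyOn F f l U) {x : X} (hx : x ∈ U) (hf : ContinuousAt f x) :
    Tendsto (fun q : ι × X => F q.1 q.2) (l ×ˢ 𝓝 x) (𝓝 (f x)) :=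
  (hf.tendsto.comp tendsto_snd).congr_uniformity
    (hU.tendstoLocallyUniformlyOn_iff_forall_tendsto.mp h x hx)

theorem tendstoLocallyUniformlyOn_of_tendsto_uncurry {X Y ι : Type*} [TopologicalSpace X]
    [UniformSpace Y] {l : Filter ι} {F : ι → X → Y} {f : X → Y} {U : Set X} (hU : IsOpen U)
    (h : ∀ x ∈ U, Tendsto (fun q : ι × X => F q.1 q.2) (l ×ˢ 𝓝 x) (𝓝 (f x)))
    (hf : ∀ x ∈ U, ContinuousAt f x) : TendstoLocallyUniformlyOn F f l U := by
  refine hU.tendstoLocallyUniformlyOn_iff_forall_tendsto.mpr fun x hx => ?_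
  have h1 : Tendsto (fun q : ι × X => f q.2) (l ×ˢ 𝓝 x) (𝓝 (f x)) :=
    (hf x hx).tendsto.comp tendsto_snd
  exact (h1.prodMk_nhds (h x hx)).mono_right (nhds_le_uniformity (f x))

theorem tendstoUniformlyOn_bergmanInvariant {B : Set (Fin n → ℂ)} {ι : Type*} {l : Filter ι}
    {D : ι → Set (Fin n → ℂ)} (hB : IsOpen B) (hBb : Bornology.IsBounded B)
    (hD : ∀ᶠ i in l, IsOpen (D i)) (hKD : ∀ K ⊆ B, IsCompact K → ∀ᶠ i in l, K ⊆ D i)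
    (hconv : ∀ k ≤ 2, ∀ S ⊆ B, IsCompact S → TendstoUniformlyOn
      (fun i => iteratedFDeriv ℝ k (bergmanKernel (D i)))
      (iteratedFDeriv ℝ k (bergmanKernel B)) l S)
    {S : Set (Fin n → ℂ)} (hS : IsCompact S) (hSB : S ⊆ B) :
    TendstoUniformlyOn (fun i => bergmanInvariant (D i)) (bergmanInvariant B) l S := by
  have hsm : ∀ x ∈ B, ContDiffAt ℝ ∞ (bergmanKernel B) x := fun x hx =>
    (contDiffOn_bergmanKernel hB).contDiffAt (hB.mem_nhds hx)
  have hcd : ∀ k : ℕ, ∀ x ∈ B, ContinuousAt (iteratedFDeriv ℝ k (bergmanKernel B)) x :=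
    fun k x hx => ((hsm x hx).iteratedFDeriv_right (m := 0) (i := k)
      (by rw [zero_add]; exact_mod_cast le_top)).continuousAt
  have hpos : ∀ x ∈ B, 0 < bergmanKernel B x := fun x hx => bergmanKernel_pos_of_bounded hB hBb hx
  have hjet : ∀ k ≤ 2, ∀ x ∈ B, Tendsto
      (fun q : ι × (Fin n → ℂ) => iteratedFDeriv ℝ k (bergmanKernel (D q.1)) q.2)
      (l ×ˢ 𝓝 x) (𝓝 (iteratedFDeriv ℝ k (bergmanKernel B) x)) := fun k hk x hx =>
    TendstoLocallyUniformlyOn.tendsto_uncurry hB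
      ((tendstoLocallyUniformlyOn_iff_forall_isCompact hB).mpr fun K hKB hK => hconv k hk K hKB hK)
      hx (hcd k x hx)
  have hjet0 : ∀ x ∈ B, Tendsto (fun q : ι × (Fin n → ℂ) => bergmanKernel (D q.1) q.2)
      (l ×ˢ 𝓝 x) (𝓝 (bergmanKernel B x)) := fun x hx => by
    have := ((continuousMultilinearCurryFin0 ℝ (Fin n → ℂ) ℝ).continuous.tendsto _).comp
      (hjet 0 (by norm_num) x hx)
    simpa [Function.comp_def] using this
  have hJB : ∀ x ∈ B, bergmanInvariant B x = jetInvariant (bergmanKernel B x,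
      iteratedFDeriv ℝ 1 (bergmanKernel B) x, iteratedFDeriv ℝ 2 (bergmanKernel B) x) :=
    fun x hx => bergmanInvariant_eq_jetInvariant
      (contDiffAt_infty.mp (hsm x hx) 2) (hpos x hx).ne'
  have hloc : TendstoLocallyUniformlyOn (fun i => bergmanInvariant (D i)) (bergmanInvariant B)
      l B := by
    refine tendstoLocallyUniformlyOn_of_tendsto_uncurry hB (fun x hx => ?_) fun x hx => ?_
    · have h1 := (continuousAt_jetInvariant (p := (bergmanKernel B x,
        iteratedFDeriv ℝ 1 (bergmanKernel B) x, iteratedFDeriv ℝ 2 (bergmanKernel B) x))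
        (hpos x hx).ne').tendsto.comp ((hjet0 x hx).prodMk_nhds
          ((hjet 1 (by norm_num) x hx).prodMk_nhds (hjet 2 le_rfl x hx)))
      rw [← hJB x hx] at h1
      refine h1.congr' ?_
      obtain ⟨r, hr, hrB⟩ := closedBall_subset_of_mem_isOpen hB hx
      have h2 : ∀ᶠ q : ι × (Fin n → ℂ) in l ×ˢ 𝓝 x,
          (IsOpen (D q.1) ∧ Metric.closedBall x r ⊆ D q.1) ∧ q.2 ∈ Metric.closedBall x r :=
        (hD.and (hKD _ hrB (isCompact_closedBall x r))).prod_mk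
          (Metric.closedBall_mem_nhds x hr)
      -- The jet formula needs `bergmanKernel (D q.1) q.2 ≠ 0`; positivity is inherited from the
      -- limit kernel, with no boundedness of `D q.1`.
      filter_upwards [h2, (hjet0 x hx).eventually (lt_mem_nhds (hpos x hx))]
        with q hq hq0
      refine (bergmanInvariant_eq_jetInvariant (contDiffAt_infty.mp ?_ 2) hq0.ne').symm
      exact (contDiffOn_bergmanKernel hq.1.1).contDiffAt (hq.1.1.mem_nhds (hq.1.2 hq.2))
    · have h1 : ContinuousAt (fun y => jetInvariant (bergmanKernel B y,
          iteratedFDeriv ℝ 1 (bergmanKernel B) y, iteratedFDeriv ℝ 2 (bergmanKernel B) y)) x :=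
        (continuousAt_jetInvariant (hpos x hx).ne').comp
          (f := fun y => (bergmanKernel B y, iteratedFDeriv ℝ 1 (bergmanKernel B) y,
            iteratedFDeriv ℝ 2 (bergmanKernel B) y))
          ((hsm x hx).continuousAt.prodMk ((hcd 1 x hx).prodMk (hcd 2 x hx)))
      refine h1.congr ?_
      filter_upwards [hB.mem_nhds hx] with y hy
      exact (hJB y hy).symm
  exact (tendstoLocallyUniformlyOn_iff_forall_isCompact hB).mp hloc S hSB hS

end InvariantConvergence

/-! ### Hermitian forms and eigenvalue bounds. -/

section HermForm

open scoped Matrix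

variable {n : ℕ}

/-- The row index of `a` is paired with `z` and the column index with its conjugate, so the usual
quadratic form is evaluated at `star z`. -/
theorem hermForm_eq_dotProduct (a : Matrix (Fin n) (Fin n) ℂ) (z : Fin n → ℂ) :
    hermForm a z = (star (star z) ⬝ᵥ (a *ᵥ star z)).re := by
  rw [hermForm, star_star]
  congr 1
  simp only [dotProduct, Matrix.mulVec, Finset.mul_sum, Pi.star_apply, RCLike.star_def]
  exact Finset.sum_congr rfl fun i _ => Finset.sum_congr rfl fun j _ => by ring

theorem continuous_hermForm (a : Matrix (Fin n) (Fin n) ℂ) : Continuous (hermForm a) := by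
  unfold hermForm
  fun_prop

theorem hermForm_smul (a : Matrix (Fin n) (Fin n) ℂ) (c : ℝ) (z : Fin n → ℂ) :
    hermForm a (c • z) = c ^ 2 * hermForm a z := by
  have h : ∑ α, ∑ β, a α β * (c • z) α * conj ((c • z) β)
      = ((c ^ 2 : ℝ) : ℂ) * ∑ α, ∑ β, a α β * z α * conj (z β) := by
    simp only [Finset.mul_sum]
    refine Finset.sum_congr rfl fun i _ => Finset.sum_congr rfl fun j _ => ?_
    simp only [Pi.smul_apply, Complex.real_smul, map_mul, Complex.conj_ofReal]
    push_cast; ring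
  rw [hermForm, h, Complex.re_ofReal_mul, hermForm]

/-- A Hermitian form is bounded below by any lower bound of its eigenvalues. -/
theorem mul_sum_norm_sq_le_hermForm {a : Matrix (Fin n) (Fin n) ℂ} (ha : a.IsHermitian) {c : ℝ}
    (hc : ∀ i, c ≤ ha.eigenvalues i) (z : Fin n → ℂ) :
    c * ∑ k, ‖z k‖ ^ 2 ≤ hermForm a z := by
  have hps : (a - (c : ℂ) • (1 : Matrix (Fin n) (Fin n) ℂ)).PosSemidef := by
    set U : Matrix (Fin n) (Fin n) ℂ := (ha.eigenvectorUnitary : Matrix (Fin n) (Fin n) ℂ)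
    have h1 : a - (c : ℂ) • (1 : Matrix (Fin n) (Fin n) ℂ)
        = U * Matrix.diagonal (fun i => ((ha.eigenvalues i - c : ℝ) : ℂ)) * Uᴴ := by
      have h2 : a = U * Matrix.diagonal (RCLike.ofReal ∘ ha.eigenvalues) * Uᴴ := by
        have := ha.spectral_theorem
        rw [Unitary.conjStarAlgAut_apply] at this
        exact this
      have h3 : U * Uᴴ = 1 := Unitary.coe_mul_star_self ha.eigenvectorUnitary
      have h4 : Matrix.diagonal (fun i => ((ha.eigenvalues i - c : ℝ) : ℂ))
          = Matrix.diagonal (RCLike.ofReal ∘ ha.eigenvalues)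
            - (c : ℂ) • (1 : Matrix (Fin n) (Fin n) ℂ) := by
        ext i j
        by_cases hij : i = j
        · subst hij; simp
        · simp [hij]
      rw [h4, mul_sub, sub_mul, ← h2, Matrix.mul_smul, Matrix.smul_mul, mul_one, h3]
    rw [h1]
    refine (Matrix.PosSemidef.diagonal fun i => ?_).mul_mul_conjTranspose_same U
    have : 0 ≤ ha.eigenvalues i - c := sub_nonneg.mpr (hc i)
    exact Complex.zero_le_real.mpr this
  have h := hps.re_dotProduct_nonneg (star z)
  rw [Matrix.sub_mulVec, dotProduct_sub, Matrix.smul_mulVec, Matrix.one_mulVec, dotProduct_smul,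
    map_sub] at h
  have h5 : (RCLike.re ((c : ℂ) • (star (star z) ⬝ᵥ star z)) : ℝ) = c * ∑ k, ‖z k‖ ^ 2 := by
    rw [star_star]
    simp only [dotProduct, Pi.star_apply, RCLike.star_def, Complex.mul_conj, smul_eq_mul,
      RCLike.re_to_complex, Complex.re_ofReal_mul, Complex.re_sum, Complex.ofReal_re,
      Complex.normSq_eq_norm_sq]
  rw [h5] at h
  rw [hermForm_eq_dotProduct]
  simpa using h

end HermForm

/-! ### The rescaled domains as preimages under the inverse rescaling. -/

/-- The weights of the anisotropic dilation. -/
def scaleWeight (m : ℕ) {n : ℕ} (δ : ℝ) (j : Fin n) : ℝ :=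
  if (j : ℕ) = 0 then δ ^ (2 : ℝ) else if (j : ℕ) < m then δ ^ (3 / 2 : ℝ) else δ

/-- The inverse of the linear fractional map. -/
def cayleyInv {n m : ℕ} (hm : 2 ≤ m) (hmn : m ≤ n) (w : Fin n → ℂ) : Fin n → ℂ := fun j =>
  if (j : ℕ) < m then Complex.I * (1 + w j) / (1 - w j)
  else Complex.I * w j / (1 - w ⟨0, by omega⟩)

/-- The inverse of the rescaling `L_δ` followed by the linear fractional map. -/
def unscale {n m : ℕ} (hm : 2 ≤ m) (hmn : m ≤ n) (δ : ℝ) (w : Fin n → ℂ) : Fin n → ℂ := fun j =>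
  ((scaleWeight m δ j : ℝ) : ℂ) * cayleyInv hm hmn w j

section ChartGeometry

variable {n m : ℕ} {hm : 2 ≤ m} {hmn : m ≤ n} {Ω : Set (Fin n → ℂ)} {p : Fin n → ℂ}

theorem NormalizedChart.minEigenvalue_le (C : NormalizedChart hm hmn Ω p) (j : Fin m)
    (i : Fin n) : C.minEigenvalue ≤ (C.posDef j).isHermitian.eigenvalues i :=
  (ciInf_le (Set.finite_range _).bddBelow j).trans (ciInf_le (Set.finite_range _).bddBelow i)

theorem NormalizedChart.minEigenvalue_pos (C : NormalizedChart hm hmn Ω p) :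
    0 < C.minEigenvalue := by
  have : Nonempty (Fin m) := ⟨⟨0, by omega⟩⟩
  have : Nonempty (Fin n) := ⟨⟨0, by omega⟩⟩
  obtain ⟨j, hj⟩ := exists_eq_ciInf_of_finite
    (f := fun j : Fin m => ⨅ i : Fin n, (C.posDef j).isHermitian.eigenvalues i)
  obtain ⟨i, hi⟩ := exists_eq_ciInf_of_finite
    (f := fun i : Fin n => (C.posDef j).isHermitian.eigenvalues i)
  rw [minEigenvalue, ← hj, ← hi]
  exact (C.posDef j).eigenvalues_pos i

theorem NormalizedChart.minEigenvalue_mul_le_hermForm (C : NormalizedChart hm hmn Ω p)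
    (j : Fin m) (z : Fin n → ℂ) : C.minEigenvalue * ∑ k, ‖z k‖ ^ 2 ≤ hermForm (C.a j) z :=
  mul_sum_norm_sq_le_hermForm _ (C.minEigenvalue_le j) z

theorem isOpen_polydisk (n : ℕ) (ε : ℝ) : IsOpen (polydisk n ε) := by
  have : polydisk n ε = ⋂ j : Fin n, {z | ‖z j‖ < ε} := by
    ext z; simp [polydisk]
  rw [this]
  exact isOpen_iInter_of_finite fun j => isOpen_lt (by fun_prop) continuous_const

theorem NormalizedChart.isOpen_localDomain (C : NormalizedChart hm hmn Ω p) (hΩ : IsOpen Ω)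
    (ε : ℝ) : IsOpen (C.localDomain ε) :=
  (C.chart.isOpen_image_of_subset_source (hΩ.inter C.chart.open_source)
    inter_subset_right).inter (isOpen_polydisk n ε)

namespace NormalizedChart.IsAdmissible

variable {C : NormalizedChart hm hmn Ω p} {ε : ℝ}

theorem mem_localDomain_iff (h : C.IsAdmissible ε) {u : Fin n → ℂ} :
    u ∈ C.localDomain ε ↔ u ∈ polydisk n ε ∧
      ∀ j : Fin m, hermForm (C.a j) u + C.R j u < (u (Fin.castLE hmn j)).im := by
  rw [NormalizedChart.localDomain, C.image_eq]
  constructor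
  · rintro ⟨⟨-, h1⟩, h2⟩
    exact ⟨h2, h1⟩
  · rintro ⟨h1, h2⟩
    exact ⟨⟨h.subset_target h1, h2⟩, h1⟩

theorem abs_remainder_le (h : C.IsAdmissible ε) {u : Fin n → ℂ} (hu : u ∈ polydisk n ε)
    (j : Fin m) : |C.R j u| ≤ hermForm (C.a j) u / 2 := by
  have h1 := h.remainder_le j u hu
  have h2 := C.minEigenvalue_mul_le_hermForm j u
  linarith

/-- Half of the Hermitian form absorbs the remainder. The result controls `|u|²` by each `Im uⱼ`,
and puts these coordinates in the upper half-plane, away from the pole `-i`. -/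
theorem half_mul_lt_im (h : C.IsAdmissible ε) {u : Fin n → ℂ} (hu : u ∈ C.localDomain ε)
    (j : Fin m) : C.minEigenvalue / 2 * ∑ k, ‖u k‖ ^ 2 < (u (Fin.castLE hmn j)).im := by
  obtain ⟨h1, h2⟩ := h.mem_localDomain_iff.mp hu
  have h3 := h2 j
  have h4 := h.remainder_le j u h1
  have h5 := C.minEigenvalue_mul_le_hermForm j u
  linarith [neg_abs_le (C.R j u)]

theorem im_pos (h : C.IsAdmissible ε) {u : Fin n → ℂ} (hu : u ∈ C.localDomain ε) {k : Fin n}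
    (hk : (k : ℕ) < m) : 0 < (u k).im := by
  have h1 := h.half_mul_lt_im hu ⟨k, hk⟩
  have h2 : 0 ≤ C.minEigenvalue / 2 * ∑ k, ‖u k‖ ^ 2 := by
    have := C.minEigenvalue_pos
    positivity
  exact h2.trans_lt h1

end NormalizedChart.IsAdmissible

theorem scaleWeight_pos {δ : ℝ} (hδ : 0 < δ) (j : Fin n) : 0 < scaleWeight m δ j := by
  unfold scaleWeight
  split_ifs <;> positivity

theorem scalingMap_eq {δ : ℝ} (hδ : 0 < δ) (z : Fin n → ℂ) (j : Fin n) :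
    scalingMap m δ z j = (((scaleWeight m δ j)⁻¹ : ℝ) : ℂ) * z j := by
  unfold scalingMap scaleWeight
  split_ifs
  · rw [Real.rpow_neg hδ.le]
  · rw [Real.rpow_neg hδ.le]
  · rw [Real.rpow_neg_one]

theorem cayleyMap_cayleyInv {w : Fin n → ℂ} (hw : ∀ j : Fin n, (j : ℕ) < m → w j ≠ 1) :
    cayleyMap hm hmn (cayleyInv hm hmn w) = w := by
  have hI : Complex.I ≠ 0 := Complex.I_ne_zero
  have hden : ∀ j : Fin n, (j : ℕ) < m →
      Complex.I * (1 + w j) / (1 - w j) + Complex.I = 2 * Complex.I / (1 - w j) := fun j hj => by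
    have : 1 - w j ≠ 0 := sub_ne_zero.mpr (hw j hj).symm
    field_simp; ring
  funext j
  by_cases hj : (j : ℕ) < m
  · have h1 : 1 - w j ≠ 0 := sub_ne_zero.mpr (hw j hj).symm
    simp only [cayleyMap, cayleyInv, if_pos hj, hden j hj]
    field_simp
    ring
  · have h0 : ((⟨0, by omega⟩ : Fin n) : ℕ) < m := by simp; omega
    have h1 : 1 - w ⟨0, by omega⟩ ≠ 0 := sub_ne_zero.mpr (hw _ h0).symm
    simp only [cayleyMap, cayleyInv, if_neg hj]
    rw [if_pos (by omega), hden _ h0]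
    field_simp

theorem cayleyInv_cayleyMap {z : Fin n → ℂ} (hz : ∀ j : Fin n, (j : ℕ) < m → z j ≠ -Complex.I) :
    (∀ j : Fin n, (j : ℕ) < m → cayleyMap hm hmn z j ≠ 1) ∧
      cayleyInv hm hmn (cayleyMap hm hmn z) = z := by
  have hI : Complex.I ≠ 0 := Complex.I_ne_zero
  have hne : ∀ j : Fin n, (j : ℕ) < m → z j + Complex.I ≠ 0 := fun j hj h =>
    hz j hj (eq_neg_of_add_eq_zero_left h)
  have hone : ∀ j : Fin n, (j : ℕ) < m →
      1 - (z j - Complex.I) / (z j + Complex.I) = 2 * Complex.I / (z j + Complex.I) :=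
    fun j hj => by
      have := hne j hj
      field_simp; ring
  refine ⟨fun j hj h => ?_, ?_⟩
  · have h1 := hone j hj
    simp only [cayleyMap, if_pos hj] at h
    rw [h, sub_self] at h1
    exact (div_ne_zero (mul_ne_zero two_ne_zero hI) (hne j hj)) h1.symm
  · funext j
    by_cases hj : (j : ℕ) < m
    · have h1 := hne j hj
      simp only [cayleyMap, cayleyInv, if_pos hj, hone j hj]
      field_simp
      ring
    · have h0 : ((⟨0, by omega⟩ : Fin n) : ℕ) < m := by simp; omega
      have h1 := hne _ h0
      simp only [cayleyMap, cayleyInv, if_neg hj]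
      rw [if_pos (by omega), hone _ h0]
      field_simp

theorem continuousOn_cayleyInv :
    ContinuousOn (cayleyInv hm hmn) {w : Fin n → ℂ | ∀ j : Fin n, (j : ℕ) < m → w j ≠ 1} := by
  refine continuousOn_pi.mpr fun j => ?_
  unfold cayleyInv
  by_cases hj : (j : ℕ) < m
  · simp only [if_pos hj]
    refine ContinuousOn.div (by fun_prop) (by fun_prop) fun w hw => sub_ne_zero.mpr (hw j hj).symm
  · simp only [if_neg hj]
    refine ContinuousOn.div (by fun_prop) (by fun_prop) fun w hw =>
      sub_ne_zero.mpr (hw _ (by simp; omega)).symm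

theorem isOpen_ne_one :
    IsOpen {w : Fin n → ℂ | ∀ j : Fin n, (j : ℕ) < m → w j ≠ 1} := by
  have : {w : Fin n → ℂ | ∀ j : Fin n, (j : ℕ) < m → w j ≠ 1}
      = ⋂ j : Fin n, {w | (j : ℕ) < m → w j ≠ 1} := by ext; simp
  rw [this]
  refine isOpen_iInter_of_finite fun j => ?_
  by_cases hj : (j : ℕ) < m
  · simp only [hj, true_imp_iff]
    exact isOpen_ne_fun (by fun_prop) continuous_const
  · simp [hj]

variable {C : NormalizedChart hm hmn Ω p} {ε : ℝ}

/-- Positivity of the imaginary parts makes the fractional map invertible on the scaled domain, so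
an image becomes a preimage. The condition `w j ≠ 1` excludes points where `cayleyInv` divides by
zero and returns a default value. -/
theorem NormalizedChart.IsAdmissible.mem_rescaledDomain_iff (h : C.IsAdmissible ε) {δ : ℝ}
    (hδ : 0 < δ) {w : Fin n → ℂ} :
    w ∈ C.rescaledDomain ε δ ↔
      (∀ j : Fin n, (j : ℕ) < m → w j ≠ 1) ∧ unscale hm hmn δ w ∈ C.localDomain ε := by
  constructor
  · rintro ⟨z, ⟨u, hu, rfl⟩, rfl⟩
    have hz : ∀ j : Fin n, (j : ℕ) < m → scalingMap m δ u j ≠ -Complex.I := fun j hj he => by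
      have h1 := h.im_pos hu hj
      have h2 := congrArg Complex.im he
      rw [scalingMap_eq hδ, Complex.im_ofReal_mul] at h2
      have h3 : 0 < (scaleWeight m δ j)⁻¹ * (u j).im :=
        mul_pos (inv_pos.mpr (scaleWeight_pos hδ j)) h1
      rw [h2] at h3
      simp at h3
      linarith
    obtain ⟨h1, h2⟩ := cayleyInv_cayleyMap (hm := hm) (hmn := hmn) hz
    refine ⟨h1, ?_⟩
    convert hu
    funext j
    simp only [unscale, h2, scalingMap_eq hδ]
    rw [← mul_assoc, ← Complex.ofReal_mul, mul_inv_cancel₀ (scaleWeight_pos hδ j).ne',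
      Complex.ofReal_one, one_mul]
  · rintro ⟨h1, h2⟩
    refine ⟨cayleyInv hm hmn w, ⟨_, h2, ?_⟩, cayleyMap_cayleyInv h1⟩
    funext j
    rw [scalingMap_eq hδ, unscale, ← mul_assoc, ← Complex.ofReal_mul,
      inv_mul_cancel₀ (scaleWeight_pos hδ j).ne', Complex.ofReal_one, one_mul]

theorem NormalizedChart.IsAdmissible.isOpen_rescaledDomain (h : C.IsAdmissible ε)
    (hΩ : IsOpen Ω) {δ : ℝ} (hδ : 0 < δ) : IsOpen (C.rescaledDomain ε δ) := by
  have h1 : C.rescaledDomain ε δ = {w : Fin n → ℂ | ∀ j : Fin n, (j : ℕ) < m → w j ≠ 1}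
      ∩ unscale hm hmn δ ⁻¹' C.localDomain ε := by
    ext w; exact h.mem_rescaledDomain_iff hδ
  rw [h1]
  refine ContinuousOn.isOpen_inter_preimage ?_ isOpen_ne_one (C.isOpen_localDomain hΩ ε)
  exact continuousOn_pi.mpr fun j =>
    continuousOn_const.mul (continuousOn_pi.mp continuousOn_cayleyInv j)

end ChartGeometry

/-! ### The limit domain and its dilates. -/

section BallPolydisk

variable {n m : ℕ} {hm : 2 ≤ m} {hmn : m ≤ n}

theorem isOpen_ballPolydisk : IsOpen (ballPolydisk hm hmn) := by
  have : ballPolydisk hm hmn = {w : Fin n → ℂ | ‖w ⟨0, by omega⟩‖ ^ 2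
      + (∑ j : Fin n, if m ≤ (j : ℕ) then ‖w j‖ ^ 2 else 0) < 1}
      ∩ ⋂ k : Fin n, {w : Fin n → ℂ | 1 ≤ (k : ℕ) → (k : ℕ) < m → ‖w k‖ < 1} := by
    ext w; simp [ballPolydisk]
  rw [this]
  refine IsOpen.inter (isOpen_lt (Continuous.add (by fun_prop) ?_) continuous_const)
    (isOpen_iInter_of_finite fun k => ?_)
  · refine continuous_finsetSum _ fun j _ => ?_
    split_ifs <;> fun_prop
  · by_cases hk : 1 ≤ (k : ℕ) ∧ (k : ℕ) < m
    · simp only [hk.1, hk.2, true_imp_iff]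
      exact isOpen_lt (by fun_prop) continuous_const
    · have : {w : Fin n → ℂ | 1 ≤ (k : ℕ) → (k : ℕ) < m → ‖w k‖ < 1} = univ := by
        ext w; simp only [mem_ofPred_eq, mem_univ, iff_true]; tauto
      rw [this]; exact isOpen_univ

theorem norm_lt_one_of_mem_ballPolydisk {w : Fin n → ℂ} (hw : w ∈ ballPolydisk hm hmn)
    (j : Fin n) : ‖w j‖ < 1 := by
  have h0 : ∀ j : Fin n, 0 ≤ (if m ≤ (j : ℕ) then ‖w j‖ ^ 2 else 0) := fun j => by
    split_ifs <;> positivity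
  rcases Nat.lt_or_ge j m with hj | hj
  · rcases Nat.eq_zero_or_pos j with hj0 | hj0
    · rw [show w j = w ⟨0, by omega⟩ from congrArg w (Fin.ext hj0)]
      have := hw.1
      have h1 := Finset.sum_nonneg fun j (_ : j ∈ Finset.univ) => h0 j
      nlinarith [norm_nonneg (w ⟨0, by omega⟩)]
    · exact hw.2 j hj0 hj
  · have h1 := Finset.single_le_sum (fun j _ => h0 j) (Finset.mem_univ j)
    rw [if_pos hj] at h1
    have := hw.1
    nlinarith [norm_nonneg (w j), sq_nonneg ‖w ⟨0, by omega⟩‖]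

theorem isBounded_ballPolydisk : Bornology.IsBounded (ballPolydisk hm hmn) := by
  refine (Metric.isBounded_closedBall (x := (0 : Fin n → ℂ)) (r := 1)).subset fun w hw => ?_
  rw [mem_closedBall_zero_iff, pi_norm_le_iff_of_nonneg zero_le_one]
  exact fun j => (norm_lt_one_of_mem_ballPolydisk hw j).le

/-- Only the ball factor has to be shrunk: the fractional map sends the upper half-planes exactly
into the unit discs, while the ball inequality holds only approximately. -/
theorem smul_mem_ballPolydisk_of_le {r : ℝ} (hr0 : 0 < r) (hr1 : r ≤ 1) {w : Fin n → ℂ}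
    (hw : r ^ 2 * (‖w ⟨0, by omega⟩‖ ^ 2
      + ∑ j : Fin n, if m ≤ (j : ℕ) then ‖w j‖ ^ 2 else 0) < 1)
    (hk : ∀ k : Fin n, 1 ≤ (k : ℕ) → (k : ℕ) < m → ‖w k‖ < 1) :
    r • w ∈ ballPolydisk hm hmn := by
  have hn : ∀ j, ‖(r • w) j‖ = r * ‖w j‖ := fun j => by
    rw [Pi.smul_apply, norm_smul, Real.norm_of_nonneg hr0.le]
  refine ⟨?_, fun k h1 h2 => ?_⟩
  · simp only [hn, mul_pow]
    convert hw using 1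
    rw [mul_add, Finset.mul_sum]
    congr 1
    exact Finset.sum_congr rfl fun j _ => by split_ifs <;> simp
  · rw [hn]
    have := hk k h1 h2
    nlinarith [norm_nonneg (w k)]

theorem smul_mem_ballPolydisk {r : ℝ} (hr0 : 0 < r) (hr1 : r < 1) {w : Fin n → ℂ}
    (hw : w ∈ ballPolydisk hm hmn) : r • w ∈ ballPolydisk hm hmn := by
  refine smul_mem_ballPolydisk_of_le hr0 hr1.le ?_ hw.2
  have h0 : 0 ≤ ‖w ⟨0, by omega⟩‖ ^ 2 + ∑ j : Fin n, if m ≤ (j : ℕ) then ‖w j‖ ^ 2 else 0 := by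
    refine add_nonneg (by positivity) (Finset.sum_nonneg fun j _ => ?_)
    split_ifs <;> positivity
  have := hw.1
  nlinarith

/-- Each dilate `r B`, `r < 1`, is relatively compact in `B`. -/
theorem exists_isCompact_dilate_ballPolydisk {r : ℝ} (hr0 : 0 < r) (hr1 : r < 1) :
    ∃ K ⊆ ballPolydisk hm hmn, IsCompact K ∧
      ∀ z : Fin n → ℂ, r⁻¹ • z ∈ ballPolydisk hm hmn → z ∈ K := by
  set K : Set (Fin n → ℂ) := {w | ‖w ⟨0, by omega⟩‖ ^ 2
      + (∑ j : Fin n, if m ≤ (j : ℕ) then ‖w j‖ ^ 2 else 0) ≤ 1 ∧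
    ∀ k : Fin n, 1 ≤ (k : ℕ) → (k : ℕ) < m → ‖w k‖ ≤ 1} with hK
  have hsub : closure (ballPolydisk hm hmn) ⊆ K := by
    refine closure_minimal (fun w hw => ⟨hw.1.le, fun k h1 h2 => (hw.2 k h1 h2).le⟩) ?_
    have : K = {w : Fin n → ℂ | ‖w ⟨0, by omega⟩‖ ^ 2
        + (∑ j : Fin n, if m ≤ (j : ℕ) then ‖w j‖ ^ 2 else 0) ≤ 1}
        ∩ ⋂ k : Fin n, {w : Fin n → ℂ | 1 ≤ (k : ℕ) → (k : ℕ) < m → ‖w k‖ ≤ 1} := by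
      ext w; simp [hK]
    rw [this]
    refine IsClosed.inter (isClosed_le (Continuous.add (by fun_prop) ?_) continuous_const)
      (isClosed_iInter fun k => ?_)
    · refine continuous_finsetSum _ fun j _ => ?_
      split_ifs <;> fun_prop
    · by_cases hk : 1 ≤ (k : ℕ) ∧ (k : ℕ) < m
      · simp only [hk.1, hk.2, true_imp_iff]
        exact isClosed_le (by fun_prop) continuous_const
      · have : {w : Fin n → ℂ | 1 ≤ (k : ℕ) → (k : ℕ) < m → ‖w k‖ ≤ 1} = univ := by
          ext w; simp only [mem_ofPred_eq, mem_univ, iff_true]; tauto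
        rw [this]; exact isClosed_univ
  refine ⟨(fun w => r • w) '' closure (ballPolydisk hm hmn), ?_,
    isBounded_ballPolydisk.isCompact_closure.image (continuous_const_smul r), fun z hz => ?_⟩
  · rintro _ ⟨w, hw, rfl⟩
    obtain ⟨h1, h2⟩ := hsub hw
    have hn : ∀ j, ‖(r • w) j‖ = r * ‖w j‖ := fun j => by
      rw [Pi.smul_apply, norm_smul, Real.norm_of_nonneg hr0.le]
    refine ⟨?_, fun k hk1 hk2 => ?_⟩
    · have e : ‖(r • w) ⟨0, by omega⟩‖ ^ 2
          + (∑ j : Fin n, if m ≤ (j : ℕ) then ‖(r • w) j‖ ^ 2 else 0) = r ^ 2 *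
          (‖w ⟨0, by omega⟩‖ ^ 2 + ∑ j : Fin n, if m ≤ (j : ℕ) then ‖w j‖ ^ 2 else 0) := by
        simp only [hn, mul_pow]
        rw [mul_add, Finset.mul_sum]
        congr 1
        exact Finset.sum_congr rfl fun j _ => by split_ifs <;> simp
      refine e.trans_lt ?_
      nlinarith
    · have := h2 k hk1 hk2
      change ‖(r • w) k‖ < 1
      rw [hn]
      nlinarith [norm_nonneg (w k)]
  · exact ⟨r⁻¹ • z, subset_closure hz, smul_inv_smul₀ hr0.ne' z⟩

end BallPolydisk

/-! ### Outer inclusion: rescaled domains lie in `r⁻¹B`. -/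

section OuterBound

/-- The image under the Cayley transform of a thickened Siegel domain. -/
theorem norm_cayley_sq_add_lt {z₀ : ℂ} {N η : ℝ} (hη : 0 < η) (ht : 0 < z₀.im)
    (hN : N < 2 * z₀.im) (hN' : ‖z₀ + Complex.I‖ < 4 / η → N - z₀.im < η * z₀.im) :
    ‖(z₀ - Complex.I) / (z₀ + Complex.I)‖ ^ 2 + 4 * N / ‖z₀ + Complex.I‖ ^ 2 < 1 + η := by
  set t := z₀.im with htdef
  have hsq : ‖z₀ + Complex.I‖ ^ 2 = z₀.re ^ 2 + (t + 1) ^ 2 := by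
    rw [← Complex.normSq_eq_norm_sq, Complex.normSq_apply]; simp; ring
  have hsq' : ‖z₀ - Complex.I‖ ^ 2 = z₀.re ^ 2 + (t - 1) ^ 2 := by
    rw [← Complex.normSq_eq_norm_sq, Complex.normSq_apply]; simp; ring
  have hpos : 0 < ‖z₀ + Complex.I‖ ^ 2 := by rw [hsq]; positivity
  have hn0 : 0 < ‖z₀ + Complex.I‖ := by
    refine (norm_nonneg _).lt_of_ne fun h => ?_
    rw [← h] at hpos; norm_num at hpos
  rw [norm_div, div_pow, ← add_div, div_lt_iff₀ hpos]
  -- Since `|z₀ - i|² = |z₀ + i|² - 4t`, this is the whole claim. If `|z₀ + i| < 4/η`, use `N - t <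
  -- ηt` and `4t ≤ |z₀ + i|²`. Otherwise `N - t < t ≤ |z₀ + i| ≤ (η/4)|z₀ + i|²`.
  have key : 4 * (N - t) < η * ‖z₀ + Complex.I‖ ^ 2 := by
    by_cases hc : ‖z₀ + Complex.I‖ < 4 / η
    · have h1 := hN' hc
      have h2 : 4 * t ≤ ‖z₀ + Complex.I‖ ^ 2 := by
        rw [hsq]; nlinarith [sq_nonneg z₀.re, sq_nonneg (t - 1)]
      nlinarith
    · push Not at hc
      rw [div_le_iff₀ hη] at hc
      have h1 : t ≤ ‖z₀ + Complex.I‖ := by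
        refine abs_le_of_sq_le_sq' ?_ hn0.le |>.2
        rw [hsq]; nlinarith [sq_nonneg z₀.re]
      nlinarith
  rw [hsq']
  have : z₀.re ^ 2 + (t - 1) ^ 2 = ‖z₀ + Complex.I‖ ^ 2 - 4 * t := by rw [hsq]; ring
  rw [this]
  linarith

variable {n m : ℕ} {hm : 2 ≤ m} {hmn : m ≤ n} {Ω : Set (Fin n → ℂ)} {p : Fin n → ℂ}
  {C : NormalizedChart hm hmn Ω p} {ε : ℝ}

theorem sum_le_hermForm_first (C : NormalizedChart hm hmn Ω p) (u : Fin n → ℂ) :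
    (∑ j : Fin n, if m ≤ (j : ℕ) then ‖u j‖ ^ 2 else 0) ≤ hermForm (C.a ⟨0, by omega⟩) u := by
  rw [C.hermForm_first]
  have h1 : 0 ≤ ∑ l : Fin (m - 1),
      ‖∑ k : Fin (m - 1), u ⟨(k : ℕ) + 1, by omega⟩ * C.P k l‖ ^ 2 := by positivity
  have h2 : 0 ≤ ‖u ⟨0, by omega⟩‖ ^ 2 := by positivity
  linarith

theorem norm_sq_le_sum (u : Fin n → ℂ) : ‖u‖ ^ 2 ≤ ∑ k, ‖u k‖ ^ 2 := by
  have h : ‖u‖ ≤ Real.sqrt (∑ k, ‖u k‖ ^ 2) := by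
    refine (pi_norm_le_iff_of_nonneg (Real.sqrt_nonneg _)).mpr fun j => ?_
    refine Real.le_sqrt_of_sq_le ?_
    exact Finset.single_le_sum (f := fun k => ‖u k‖ ^ 2) (fun k _ => by positivity)
      (Finset.mem_univ j)
  calc ‖u‖ ^ 2 ≤ Real.sqrt (∑ k, ‖u k‖ ^ 2) ^ 2 := by gcongr
    _ = _ := Real.sq_sqrt (by positivity)

/-- The rescaled domains are eventually contained in any dilate `r⁻¹ B`, `r < 1`. -/
theorem NormalizedChart.IsAdmissible.eventually_smul_mem (h : C.IsAdmissible ε) {r : ℝ}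
    (hr0 : 0 < r) (hr1 : r < 1) :
    ∀ᶠ δ in 𝓝[>] (0 : ℝ), ∀ w ∈ C.rescaledDomain ε δ, r • w ∈ ballPolydisk hm hmn := by
  -- `1 + η = r⁻²` is the squared radius of the ball factor of `r⁻¹B`.
  obtain ⟨η, hη, hrη⟩ : ∃ η : ℝ, 0 < η ∧ r ^ 2 * (1 + η) = 1 := by
    refine ⟨(r ^ 2)⁻¹ - 1, ?_, by field_simp; ring⟩
    have : 1 < (r ^ 2)⁻¹ := (one_lt_inv₀ (by positivity)).mpr (by nlinarith)
    linarith
  set A := C.minEigenvalue with hA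
  have hA0 : 0 < A := C.minEigenvalue_pos
  -- The factor `η / 2` is chosen because `H < 2 Im u₁`, where `H` is the first Hermitian form: near
  -- the origin `|R₁| ≤ (η/2) H < η Im u₁`.
  obtain ⟨ρ, hρ, hR⟩ : ∃ ρ > 0, ∀ u : Fin n → ℂ, ‖u‖ < ρ →
      |C.R ⟨0, by omega⟩ u| ≤ η / 2 * A * ‖u‖ ^ 2 := by
    have h1 := (C.isLittleO_R ⟨0, by omega⟩).def (show 0 < η / 2 * A by positivity)
    obtain ⟨ρ, hρ, h2⟩ := Metric.eventually_nhds_iff_ball.mp h1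
    refine ⟨ρ, hρ, fun u hu => ?_⟩
    have := h2 u (mem_ball_zero_iff.mpr hu)
    rwa [Real.norm_eq_abs, Real.norm_of_nonneg (by positivity)] at this
  -- When `|z₁ + i| < 4/η`, one has `Im u₁ < 4δ²/η`, hence `|u|² < (2/A) · 4δ²/η`. This condition
  -- then forces `‖u‖ < ρ`.
  have hδ : ∀ᶠ δ in 𝓝[>] (0 : ℝ), 2 / A * (δ ^ 2 * (4 / η)) < ρ ^ 2 := by
    have h1 : Tendsto (fun δ : ℝ => 2 / A * (δ ^ 2 * (4 / η))) (𝓝 0) (𝓝 0) := by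
      have : Continuous fun δ : ℝ => 2 / A * (δ ^ 2 * (4 / η)) := by fun_prop
      simpa using this.tendsto 0
    exact eventually_nhdsWithin_of_eventually_nhds (h1.eventually (gt_mem_nhds (by positivity)))
  filter_upwards [hδ, self_mem_nhdsWithin] with δ hδ hδ0 w hw
  rw [mem_Ioi] at hδ0
  obtain ⟨z, ⟨u, hu, rfl⟩, rfl⟩ := hw
  set z := scalingMap m δ u with hz
  obtain ⟨hup, huim⟩ := h.mem_localDomain_iff.mp hu
  have hzim : ∀ k : Fin n, (k : ℕ) < m → 0 < (z k).im := fun k hk => by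
    rw [hz, scalingMap_eq hδ0, Complex.im_ofReal_mul]
    exact mul_pos (inv_pos.mpr (scaleWeight_pos hδ0 k)) (h.im_pos hu hk)
  refine smul_mem_ballPolydisk_of_le hr0 hr1.le ?_ fun k hk1 hk2 => ?_
  · rw [← hrη]
    refine mul_lt_mul_of_pos_left ?_ (by positivity)
    set N := ∑ j : Fin n, if m ≤ (j : ℕ) then ‖z j‖ ^ 2 else 0 with hN
    have hcay : ‖cayleyMap hm hmn z ⟨0, by omega⟩‖ ^ 2
        + (∑ j : Fin n, if m ≤ (j : ℕ) then ‖cayleyMap hm hmn z j‖ ^ 2 else 0)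
        = ‖(z ⟨0, by omega⟩ - Complex.I) / (z ⟨0, by omega⟩ + Complex.I)‖ ^ 2
          + 4 * N / ‖z ⟨0, by omega⟩ + Complex.I‖ ^ 2 := by
      congr 1
      · simp only [cayleyMap]; rw [if_pos (by omega)]
      · rw [hN, Finset.mul_sum, Finset.sum_div]
        refine Finset.sum_congr rfl fun j _ => ?_
        split_ifs with hj
        · simp only [cayleyMap]
          rw [if_neg (by omega), norm_div, norm_mul, div_pow, mul_pow]
          norm_num
        · simp
    rw [hcay]
    have hz0 : (z ⟨0, by omega⟩).im = (u ⟨0, by omega⟩).im / δ ^ 2 := by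
      rw [hz, scalingMap_eq hδ0, Complex.im_ofReal_mul]
      simp [scaleWeight, div_eq_inv_mul]
    have hNu : N = (∑ j : Fin n, if m ≤ (j : ℕ) then ‖u j‖ ^ 2 else 0) / δ ^ 2 := by
      rw [hN, Finset.sum_div]
      refine Finset.sum_congr rfl fun j _ => ?_
      split_ifs with hj
      · rw [hz, scalingMap_eq hδ0]
        have : scaleWeight m δ j = δ := by
          unfold scaleWeight
          rw [if_neg (by omega), if_neg (by omega)]
        rw [this, norm_mul, Complex.norm_real, norm_inv, Real.norm_of_nonneg hδ0.le]
        field_simp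
      · simp
    set H := hermForm (C.a ⟨0, by omega⟩) u with hH
    have hNH := sum_le_hermForm_first C u
    rw [← hH] at hNH
    have hRH := h.abs_remainder_le hup ⟨0, by omega⟩
    have him := huim ⟨0, by omega⟩
    have hd2 : 0 < δ ^ 2 := by positivity
    have him' : H + C.R ⟨0, by omega⟩ u < (u ⟨0, by omega⟩).im := him
    rw [← hH] at hRH
    have hH2 : H < 2 * (u ⟨0, by omega⟩).im := by linarith [neg_abs_le (C.R ⟨0, by omega⟩ u)]
    refine norm_cayley_sq_add_lt hη (hzim _ (by simp; omega)) ?_ fun hlt => ?_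
    · rw [hNu, hz0, div_lt_iff₀ hd2]
      field_simp
      linarith
    · have ht : (z ⟨0, by omega⟩).im < 4 / η := by
        refine lt_of_le_of_lt ?_ hlt
        have h1 := Complex.abs_im_le_norm (z ⟨0, by omega⟩ + Complex.I)
        have h2 := le_abs_self (z ⟨0, by omega⟩ + Complex.I).im
        simp at h1 h2
        linarith
      have hsum := h.half_mul_lt_im hu ⟨0, by omega⟩
      have hsum' : A / 2 * ∑ k, ‖u k‖ ^ 2 < (u ⟨0, by omega⟩).im := hsum
      rw [hz0, div_lt_iff₀ hd2] at ht
      have hnorm : ‖u‖ < ρ := by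
        refine lt_of_pow_lt_pow_left₀ 2 hρ.le ?_
        refine (norm_sq_le_sum u).trans_lt (lt_trans ?_ hδ)
        rw [div_mul_eq_mul_div, lt_div_iff₀ hA0]
        nlinarith
      have hRu := hR u hnorm
      have hAH := C.minEigenvalue_mul_le_hermForm ⟨0, by omega⟩ u
      rw [← hA, ← hH] at hAH
      have h1 : A * ‖u‖ ^ 2 ≤ H := (mul_le_mul_of_nonneg_left (norm_sq_le_sum u) hA0.le).trans hAH
      have h2 : |C.R ⟨0, by omega⟩ u| ≤ η / 2 * H := by
        refine hRu.trans ?_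
        rw [mul_assoc]
        exact mul_le_mul_of_nonneg_left h1 (by positivity)
      rw [hNu, hz0, ← sub_div, div_lt_iff₀ hd2]
      field_simp
      nlinarith [neg_abs_le (C.R ⟨0, by omega⟩ u)]
  · simp only [cayleyMap, if_pos hk2]
    have h1 := hzim k hk2
    rw [norm_div]
    have hlt : ‖z k - Complex.I‖ < ‖z k + Complex.I‖ := by
      refine lt_of_pow_lt_pow_left₀ 2 (norm_nonneg _) ?_
      rw [← Complex.normSq_eq_norm_sq, ← Complex.normSq_eq_norm_sq, Complex.normSq_apply,
        Complex.normSq_apply]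
      simp
      nlinarith
    rw [div_lt_one ((norm_nonneg _).trans_lt hlt)]
    exact hlt

end OuterBound

/-! ### Inner inclusion: compact subsets of `B` lie in the rescaled domains. -/

section InnerBound

variable {n m : ℕ} {hm : 2 ≤ m} {hmn : m ≤ n} {Ω : Set (Fin n → ℂ)} {p : Fin n → ℂ}
  {C : NormalizedChart hm hmn Ω p} {ε : ℝ}

theorem im_cayleyInv_apply {w : Fin n → ℂ} {j : Fin n} (hj : (j : ℕ) < m) :
    (cayleyInv hm hmn w j).im = (1 - ‖w j‖ ^ 2) / ‖1 - w j‖ ^ 2 := by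
  simp only [cayleyInv, if_pos hj]
  rw [← Complex.normSq_eq_norm_sq, ← Complex.normSq_eq_norm_sq, Complex.div_im]
  simp [Complex.normSq_apply]
  ring

theorem im_cayleyInv_pos {w : Fin n → ℂ} (hw : w ∈ ballPolydisk hm hmn) {j : Fin n}
    (hj : (j : ℕ) < m) : 0 < (cayleyInv hm hmn w j).im := by
  have h1 := norm_lt_one_of_mem_ballPolydisk hw j
  rw [im_cayleyInv_apply hj]
  have h2 : 1 - w j ≠ 0 := fun h => by
    rw [← sub_eq_zero.mp h, norm_one] at h1
    exact lt_irrefl _ h1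
  have h3 : 0 < ‖1 - w j‖ := norm_pos_iff.mpr h2
  have h4 : 0 < 1 - ‖w j‖ ^ 2 := by nlinarith [norm_nonneg (w j)]
  positivity

/-- The inverse Cayley transform takes the ball to the Siegel domain: divide the ball inequality by
`|1 - w₁|²`. -/
theorem sum_norm_cayleyInv_sq_lt {w : Fin n → ℂ} (hw : w ∈ ballPolydisk hm hmn) :
    (∑ j : Fin n, if m ≤ (j : ℕ) then ‖cayleyInv hm hmn w j‖ ^ 2 else 0)
      < (cayleyInv hm hmn w ⟨0, by omega⟩).im := by
  have h1 := norm_lt_one_of_mem_ballPolydisk hw ⟨0, by omega⟩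
  rw [im_cayleyInv_apply (by simp; omega)]
  have h2 : 1 - w ⟨0, by omega⟩ ≠ 0 := fun h => by
    rw [← sub_eq_zero.mp h, norm_one] at h1
    exact lt_irrefl _ h1
  have h3 : 0 < ‖1 - w ⟨0, by omega⟩‖ := norm_pos_iff.mpr h2
  have h4 : (∑ j : Fin n, if m ≤ (j : ℕ) then ‖cayleyInv hm hmn w j‖ ^ 2 else 0)
      = (∑ j : Fin n, if m ≤ (j : ℕ) then ‖w j‖ ^ 2 else 0) / ‖1 - w ⟨0, by omega⟩‖ ^ 2 := by
    rw [Finset.sum_div]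
    refine Finset.sum_congr rfl fun j _ => ?_
    split_ifs with hj
    · simp only [cayleyInv]
      rw [if_neg (by omega), norm_div, norm_mul, Complex.norm_I, one_mul, div_pow]
    · simp
  rw [h4]
  have := hw.1
  gcongr
  linarith

theorem ne_one_of_mem_ballPolydisk {w : Fin n → ℂ} (hw : w ∈ ballPolydisk hm hmn) (j : Fin n) :
    w j ≠ 1 := fun h => by
  have h1 := norm_lt_one_of_mem_ballPolydisk hw j
  rw [h, norm_one] at h1
  exact lt_irrefl _ h1

theorem tendsto_scaleWeight_div (j : Fin n) :
    Tendsto (fun δ : ℝ => scaleWeight m δ j / δ) (𝓝[>] 0)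
      (𝓝 (if (j : ℕ) = 0 then 0 else if (j : ℕ) < m then 0 else 1)) := by
  have hpow : ∀ s : ℝ, 1 < s → Tendsto (fun δ : ℝ => δ ^ s / δ) (𝓝[>] 0) (𝓝 0) := fun s hs => by
    have h1 : Tendsto (fun δ : ℝ => δ ^ (s - 1)) (𝓝[>] 0) (𝓝 0) := by
      have := (Real.continuousAt_rpow_const 0 (s - 1) (Or.inr (by linarith))).tendsto
      rw [Real.zero_rpow (by linarith)] at this
      exact this.mono_left nhdsWithin_le_nhds
    refine h1.congr' ?_
    filter_upwards [self_mem_nhdsWithin] with δ hδ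
    rw [Real.rpow_sub_one (ne_of_gt hδ)]
  unfold scaleWeight
  split_ifs
  · exact hpow 2 (by norm_num)
  · exact hpow (3 / 2) (by norm_num)
  · refine tendsto_const_nhds.congr' ?_
    filter_upwards [self_mem_nhdsWithin] with δ hδ
    rw [div_self (ne_of_gt hδ)]

/-- Points near `w₀ ∈ B` lie in the rescaled domains for small parameters. -/
theorem NormalizedChart.IsAdmissible.eventually_mem_rescaledDomain (h : C.IsAdmissible ε)
    {w₀ : Fin n → ℂ} (hw₀ : w₀ ∈ ballPolydisk hm hmn) :
    ∀ᶠ q in 𝓝[>] (0 : ℝ) ×ˢ 𝓝 w₀, q.2 ∈ C.rescaledDomain ε q.1 := by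
  set l := 𝓝[>] (0 : ℝ) ×ˢ 𝓝 w₀ with hl
  have hpos : ∀ᶠ q in l, 0 < q.1 := tendsto_fst.eventually self_mem_nhdsWithin
  have hfst : Tendsto (fun q : ℝ × (Fin n → ℂ) => q.1) l (𝓝 0) :=
    tendsto_fst.mono_right nhdsWithin_le_nhds
  have hne : ∀ᶠ q in l, ∀ j : Fin n, (j : ℕ) < m → q.2 j ≠ 1 :=
    tendsto_snd.eventually (isOpen_ne_one.mem_nhds fun j _ => ne_one_of_mem_ballPolydisk hw₀ j)
  have hψ : ∀ j, Tendsto (fun q : ℝ × (Fin n → ℂ) => cayleyInv hm hmn q.2 j) l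
      (𝓝 (cayleyInv hm hmn w₀ j)) := fun j =>
    (tendsto_pi_nhds.mp (continuousOn_cayleyInv.continuousAt (isOpen_ne_one.mem_nhds
      fun j _ => ne_one_of_mem_ballPolydisk hw₀ j)).tendsto j).comp tendsto_snd
  -- Factor a common `δ` out of the inverse rescaling. The remaining weights tend to 0 except on the
  -- last `n - m` coordinates, so the limit `y` retains only `z''`.
  set V : ℝ × (Fin n → ℂ) → Fin n → ℂ := fun q j =>
    ((scaleWeight m q.1 j / q.1 : ℝ) : ℂ) * cayleyInv hm hmn q.2 j with hV
  set y : Fin n → ℂ := fun j =>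
    ((if (j : ℕ) = 0 then 0 else if (j : ℕ) < m then 0 else 1 : ℝ) : ℂ) * cayleyInv hm hmn w₀ j
    with hy
  have hVy : Tendsto V l (𝓝 y) := tendsto_pi_nhds.mpr fun j =>
    ((Complex.continuous_ofReal.tendsto _).comp
      ((tendsto_scaleWeight_div j).comp tendsto_fst)).mul (hψ j)
  have hun : ∀ᶠ q in l, unscale hm hmn q.1 q.2 = q.1 • V q := by
    filter_upwards [hpos] with q hq
    funext j
    simp only [unscale, hV, Pi.smul_apply, Complex.real_smul]
    rw [← mul_assoc, ← Complex.ofReal_mul, mul_div_cancel₀ _ hq.ne']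
  have hun0 : Tendsto (fun q : ℝ × (Fin n → ℂ) => q.1 • V q) l (𝓝 0) := by
    simpa using hfst.smul hVy
  -- By homogeneity of the form and `Rⱼ = o(|z|²)`, the defining function divided by `δ²` tends to
  -- the Hermitian form at `y`.
  have hX : ∀ j : Fin m, Tendsto (fun q : ℝ × (Fin n → ℂ) =>
      (hermForm (C.a j) (q.1 • V q) + C.R j (q.1 • V q)) / q.1 ^ 2) l
      (𝓝 (hermForm (C.a j) y)) := by
    intro j
    have h1 : Tendsto (fun q => hermForm (C.a j) (V q)) l (𝓝 (hermForm (C.a j) y)) :=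
      ((continuous_hermForm (C.a j)).tendsto y).comp hVy
    have h2 : Tendsto (fun q : ℝ × (Fin n → ℂ) => C.R j (q.1 • V q) / q.1 ^ 2) l (𝓝 0) := by
      have h3 := (C.isLittleO_R j).comp_tendsto hun0
      have h4 : ((fun z : Fin n → ℂ => ‖z‖ ^ 2) ∘ fun q : ℝ × (Fin n → ℂ) => q.1 • V q)
          =O[l] fun q => q.1 ^ 2 := by
        have h5 : V =O[l] fun _ => (1 : ℝ) := hVy.isBigO_one ℝ
        have h6 := (((Asymptotics.isBigO_refl (fun q : ℝ × (Fin n → ℂ) => q.1) l).smul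
          h5).norm_left.pow 2)
        simpa only [Function.comp_def, smul_eq_mul, mul_one] using h6
      exact (h3.trans_isBigO h4).tendsto_div_nhds_zero
    have h3 := h1.add h2
    rw [add_zero] at h3
    refine h3.congr' ?_
    filter_upwards [hpos] with q hq
    rw [hermForm_smul, add_div, mul_div_cancel_left₀ _ (by positivity)]
  have hball : ∀ᶠ q in l, q.1 • V q ∈ polydisk n ε :=
    hun0.eventually ((isOpen_polydisk n ε).mem_nhds fun j => by simpa using h.pos)
  have hineq : ∀ᶠ q in l, ∀ j : Fin m, hermForm (C.a j) (q.1 • V q) + C.R j (q.1 • V q)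
      < ((q.1 • V q) (Fin.castLE hmn j)).im := by
    rw [eventually_all]
    intro j
    have him : Tendsto (fun q : ℝ × (Fin n → ℂ) =>
        (cayleyInv hm hmn q.2 (Fin.castLE hmn j)).im) l
        (𝓝 (cayleyInv hm hmn w₀ (Fin.castLE hmn j)).im) :=
      (Complex.continuous_im.tendsto _).comp (hψ _)
    have hVim : ∀ q : ℝ × (Fin n → ℂ), 0 < q.1 → ((q.1 • V q) (Fin.castLE hmn j)).im
        = scaleWeight m q.1 (Fin.castLE hmn j)
          * (cayleyInv hm hmn q.2 (Fin.castLE hmn j)).im := fun q hq => by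
      simp only [hV, Pi.smul_apply, Complex.smul_im, smul_eq_mul, Complex.im_ofReal_mul]
      rw [← mul_assoc, mul_div_cancel₀ _ hq.ne']
    by_cases hj0 : (j : ℕ) = 0
    · have hn0 : 0 < n := lt_of_lt_of_le zero_lt_two (hm.trans hmn)
      have hm0 : 0 < m := lt_of_lt_of_le zero_lt_two hm
      have hj : j = ⟨0, hm0⟩ := Fin.ext hj0
      -- As `y` has only its `z''` part, the normal form of `a¹` reduces to `|z''|²`; without that
      -- normal form the limit need not be a ball.
      have hlt : hermForm (C.a j) y < (cayleyInv hm hmn w₀ (Fin.castLE hmn j)).im := by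
        have h0 : (Fin.castLE hmn j : Fin n) = ⟨0, hn0⟩ := Fin.ext hj0
        rw [h0, hj, C.hermForm_first]
        refine lt_of_eq_of_lt ?_ (sum_norm_cayleyInv_sq_lt hw₀)
        have e1 : y ⟨0, hn0⟩ = 0 := by simp [hy]
        have e2 : ∀ k : Fin (m - 1), y ⟨(k : ℕ) + 1, by omega⟩ = 0 := fun k => by
          simp only [hy]
          rw [if_neg (by omega), if_pos (by omega)]; simp
        simp only [e1, e2]
        simp only [norm_zero, zero_mul, Finset.sum_const_zero, ne_eq, OfNat.ofNat_ne_zero,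
          not_false_eq_true, zero_pow, zero_add]
        refine Finset.sum_congr rfl fun k _ => ?_
        split_ifs with hk
        · simp only [hy]
          rw [if_neg (by omega), if_neg (by omega)]; simp
        · rfl
      filter_upwards [(hX j).eventually_lt him hlt, hpos] with q hq hq0
      rw [div_lt_iff₀ (by positivity)] at hq
      rw [hVim q hq0]
      have : scaleWeight m q.1 (Fin.castLE hmn j) = q.1 ^ 2 := by
        simp [scaleWeight, hj0]
      rw [this]
      linarith
    -- For `j ≠ 0` the imaginary part has order `δ^{3/2}` with a positive limiting factor, while `Φⱼ
    -- / δ^{3/2}` is `δ^{1/2}` times a convergent quantity. The form of `aʲ` is therefore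
    -- irrelevant.
    · have hsq : Tendsto (fun q : ℝ × (Fin n → ℂ) => q.1 ^ (1 / 2 : ℝ)) l (𝓝 0) := by
        have := (Real.continuousAt_rpow_const 0 (1 / 2) (Or.inr (by norm_num))).tendsto.comp hfst
        simpa [Function.comp_def] using this
      have h1 := (hX j).mul hsq
      rw [mul_zero] at h1
      have hlt : 0 < (cayleyInv hm hmn w₀ (Fin.castLE hmn j)).im :=
        im_cayleyInv_pos hw₀ (by simp)
      filter_upwards [h1.eventually_lt him hlt, hpos] with q hq hq0
      rw [hVim q hq0]
      have e1 : scaleWeight m q.1 (Fin.castLE hmn j) = q.1 ^ (3 / 2 : ℝ) := by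
        simp only [scaleWeight, Fin.val_castLE]
        rw [if_neg hj0, if_pos j.2]
      have e2 : q.1 ^ 2 = q.1 ^ (3 / 2 : ℝ) * q.1 ^ (1 / 2 : ℝ) := by
        rw [← Real.rpow_add hq0]; norm_num
      have h32 : 0 < q.1 ^ (3 / 2 : ℝ) := by positivity
      have h12 : 0 < q.1 ^ (1 / 2 : ℝ) := by positivity
      rw [e1]
      rw [e2, div_mul_eq_mul_div, mul_div_mul_right _ _ h12.ne', div_lt_iff₀ h32] at hq
      linarith
  filter_upwards [hpos, hne, hun, hball, hineq] with q hq hq1 hqu hqb hqi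
  rw [h.mem_rescaledDomain_iff hq, hqu, h.mem_localDomain_iff]
  exact ⟨hq1, hqb, hqi⟩

/-- The preceding statement is joint in `(δ, w)`, so compactness of `K` yields one threshold for
`δ`. -/
theorem NormalizedChart.IsAdmissible.eventually_subset_rescaledDomain (h : C.IsAdmissible ε)
    {K : Set (Fin n → ℂ)} (hKB : K ⊆ ballPolydisk hm hmn) (hK : IsCompact K) :
    ∀ᶠ δ in 𝓝[>] (0 : ℝ), K ⊆ C.rescaledDomain ε δ := by
  have h1 : {q : ℝ × (Fin n → ℂ) | q.2 ∈ C.rescaledDomain ε q.1} ∈ 𝓝[>] (0 : ℝ) ×ˢ 𝓝ˢ K :=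
    hK.mem_prod_nhdsSet_of_forall fun w hw => h.eventually_mem_rescaledDomain (hKB hw)
  obtain ⟨a, ha, b, hb, hab⟩ := Filter.mem_prod_iff.mp h1
  filter_upwards [ha] with δ hδ w hw
  exact hab (mk_mem_prod hδ (subset_of_mem_nhdsSet hb hw))

end InnerBound

/-! ### The squeezing applied to the rescaled domains. -/

section Main

variable {n m : ℕ} {hm : 2 ≤ m} {hmn : m ≤ n} {Ω : Set (Fin n → ℂ)} {p : Fin n → ℂ}
  {C : NormalizedChart hm hmn Ω p} {ε : ℝ}

theorem NormalizedChart.IsAdmissible.eventually_isOpen_rescaledDomain (h : C.IsAdmissible ε)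
    (hΩ : IsOpen Ω) : ∀ᶠ δ in 𝓝[>] (0 : ℝ), IsOpen (C.rescaledDomain ε δ) := by
  filter_upwards [self_mem_nhdsWithin] with δ hδ
  exact h.isOpen_rescaledDomain hΩ hδ

theorem NormalizedChart.IsAdmissible.eventually_isBounded_rescaledDomain
    (h : C.IsAdmissible ε) :
    ∀ᶠ δ in 𝓝[>] (0 : ℝ), Bornology.IsBounded (C.rescaledDomain ε δ) := by
  filter_upwards [h.eventually_smul_mem one_half_pos one_half_lt_one] with δ hδ
  refine (Metric.isBounded_closedBall (x := (0 : Fin n → ℂ)) (r := 2)).subset fun w hw => ?_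
  rw [mem_closedBall_zero_iff, pi_norm_le_iff_of_nonneg zero_le_two]
  intro j
  have h1 := norm_lt_one_of_mem_ballPolydisk (hδ w hw) j
  rw [Pi.smul_apply, norm_smul] at h1
  norm_num at h1
  linarith

theorem NormalizedChart.IsAdmissible.tendstoUniformlyOn_iteratedFDeriv (h : C.IsAdmissible ε)
    (hΩ : IsOpen Ω) (k : ℕ) {S : Set (Fin n → ℂ)} (hS : IsCompact S)
    (hSB : S ⊆ ballPolydisk hm hmn) :
    TendstoUniformlyOn (fun δ => iteratedFDeriv ℝ k (bergmanKernel (C.rescaledDomain ε δ)))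
      (iteratedFDeriv ℝ k (bergmanKernel (ballPolydisk hm hmn))) (𝓝[>] (0 : ℝ)) S := by
  refine tendstoUniformlyOn_iteratedFDeriv_bergmanKernel isOpen_ballPolydisk
    (h.eventually_isOpen_rescaledDomain hΩ) (fun r h0 h1 => ?_)
    (fun r h0 h1 z hz => smul_mem_ballPolydisk h0 h1 hz)
    (fun r h0 h1 => h.eventually_smul_mem h0 h1)
    (fun K hKB hK => h.eventually_subset_rescaledDomain hKB hK) k hS hSB
  obtain ⟨K, hKB, hK, hz⟩ := exists_isCompact_dilate_ballPolydisk (hm := hm) (hmn := hmn) h0 h1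
  filter_upwards [h.eventually_subset_rescaledDomain hKB hK] with δ hδ z hrz
  exact hδ (hz z hrz)

end Main

/-! ### Positive definite forms as pulled-back Euclidean norms. -/

section HermFormNorm

open scoped Matrix

variable {n : ℕ}

theorem hermForm_conjTranspose_mul_self (B : Matrix (Fin n) (Fin n) ℂ) (z : Fin n → ℂ) :
    hermForm (Bᴴ * B) z = ∑ i, ‖∑ k, conj (B i k) * z k‖ ^ 2 := by
  have h : B *ᵥ star z = star (fun i => ∑ k, conj (B i k) * z k) := by
    funext i
    simp [Matrix.mulVec, dotProduct]
  rw [hermForm_eq_dotProduct, ← Matrix.mulVec_mulVec, Matrix.dotProduct_mulVec,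
    ← Matrix.star_mulVec, h, star_star]
  simp only [dotProduct, Complex.re_sum, Pi.star_apply, RCLike.star_def, Complex.mul_conj']
  exact Finset.sum_congr rfl fun i _ => by norm_cast

/-- Write `a = BᴴB`; definiteness makes the associated map injective, hence bijective by dimension.
-/
theorem exists_linearEquiv_norm_sq_eq_hermForm {a : Matrix (Fin n) (Fin n) ℂ} (ha : a.PosDef) :
    ∃ M : (Fin n → ℂ) ≃ₗ[ℂ] EuclideanSpace ℂ (Fin n), ∀ z, ‖M z‖ ^ 2 = hermForm a z := by
  obtain ⟨B, hB⟩ : ∃ B : Matrix (Fin n) (Fin n) ℂ, a = Bᴴ * B := by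
    open scoped MatrixOrder in
    exact CStarAlgebra.nonneg_iff_eq_star_mul_self.mp ha.posSemidef.nonneg
  set M₀ : (Fin n → ℂ) →ₗ[ℂ] EuclideanSpace ℂ (Fin n) :=
    (WithLp.linearEquiv 2 ℂ (Fin n → ℂ)).symm.toLinearMap ∘ₗ Matrix.mulVecLin (B.map conj)
  have hM₀ : ∀ z, ‖M₀ z‖ ^ 2 = hermForm a z := fun z => by
    rw [hB, hermForm_conjTranspose_mul_self, EuclideanSpace.norm_sq_eq]
    rfl
  have hinj : Function.Injective M₀ := by
    rw [injective_iff_map_eq_zero]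
    intro z hz
    by_contra hne
    have h1 := ha.re_dotProduct_pos (x := star z) (by simpa using hne)
    have h2 := hM₀ z
    rw [hz, hermForm_eq_dotProduct] at h2
    simp at h2 h1
    exact h1.ne' h2.symm
  exact ⟨LinearMap.linearEquivOfInjective M₀ hinj (by simp), hM₀⟩

/-- The converse passage; it allows coordinate changes to be made on norms and the matrix to be
recovered at the end. -/
theorem exists_posDef_hermForm_eq_norm_sq
    (N : (Fin n → ℂ) →ₗ[ℂ] EuclideanSpace ℂ (Fin n)) (hN : Function.Injective N) :
    ∃ a : Matrix (Fin n) (Fin n) ℂ, a.PosDef ∧ ∀ z, hermForm a z = ‖N z‖ ^ 2 := by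
  set B : Matrix (Fin n) (Fin n) ℂ := fun i k => conj (N (Pi.single k 1) i) with hB
  have hNB : ∀ z i, N z i = ∑ k, conj (B i k) * z k := fun z i => by
    rw [LinearMap.pi_apply_eq_sum_univ N z, WithLp.ofLp_sum, Finset.sum_apply]
    simp only [hB, Complex.conj_conj, PiLp.smul_apply, smul_eq_mul]
    refine Finset.sum_congr rfl fun k _ => ?_
    rw [mul_comm]
    have : (fun j => if k = j then (1 : ℂ) else 0) = Pi.single k 1 := by
      funext l
      simp [Pi.single_apply, eq_comm]
    rw [this]
  refine ⟨Bᴴ * B, Matrix.PosDef.conjTranspose_mul_self B ?_, fun z => ?_⟩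
  · intro u v huv
    apply star_injective
    apply hN
    ext i
    rw [hNB, hNB]
    have := congrArg conj (congrFun huv i)
    simpa [Matrix.mulVec, dotProduct] using this
  · rw [hermForm_conjTranspose_mul_self, EuclideanSpace.norm_sq_eq]
    simp only [hNB]

end HermFormNorm

/-! ### Linear algebra: decoupling the first coordinate. -/

section AdaptedCoordinates

variable {n m : ℕ}

theorem sum_eq_first_add_middle_add_last {M : Type*} [AddCommMonoid M] (hm : 1 ≤ m) (hmn : m ≤ n)
    (f : Fin n → M) :
    ∑ j, f j = f ⟨0, by omega⟩ + ∑ l : Fin (m - 1), f ⟨(l : ℕ) + 1, by omega⟩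
      + ∑ j : Fin n, if m ≤ (j : ℕ) then f j else 0 := by
  obtain ⟨m, rfl⟩ := Nat.exists_eq_add_of_le' hm
  obtain ⟨d, rfl⟩ := Nat.exists_eq_add_of_le hmn
  rw [Fin.sum_univ_add, Fin.sum_univ_add (f := fun j => if m + 1 ≤ (j : ℕ) then f j else 0),
    Fin.sum_univ_succ]
  have h1 : ∀ i : Fin (m + 1), ¬ m + 1 ≤ (Fin.castAdd d i : ℕ) := fun i => by
    simp only [Fin.val_castAdd]; omega
  have h2 : ∀ i : Fin d, m + 1 ≤ (Fin.natAdd (m + 1) i : ℕ) := fun i => by simp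
  simp only [h1, h2, if_true, if_false, Finset.sum_const_zero, zero_add]
  rfl

/-- A Gram-Schmidt basis: its first vector is proportional to `y 0`, and its first `m` vectors
span the same space as `y`. -/
theorem exists_orthonormalBasis_adapted (hm : 0 < m) (hmn : m ≤ n)
    {y : Fin m → EuclideanSpace ℂ (Fin n)} (hy : LinearIndependent ℂ y) :
    ∃ e : OrthonormalBasis (Fin n) ℂ (EuclideanSpace ℂ (Fin n)),
      (∃ c : ℂ, e ⟨0, by omega⟩ = c • y ⟨0, hm⟩) ∧ (∃ c : ℂ, y ⟨0, hm⟩ = c • e ⟨0, by omega⟩) ∧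
      ∀ j : Fin m, e (Fin.castLE hmn j) ∈ Submodule.span ℂ (Set.range y) := by
  set v : Fin n → EuclideanSpace ℂ (Fin n) := fun i =>
    if h : (i : ℕ) < m then InnerProductSpace.gramSchmidtNormed ℂ y ⟨i, h⟩ else 0 with hv
  have hon := InnerProductSpace.gramSchmidtNormed_orthonormal hy
  obtain ⟨e, he⟩ := Orthonormal.exists_orthonormalBasis_extension_of_card_eq (𝕜 := ℂ) (v := v)
    (s := {i | (i : ℕ) < m}) (by simp) (by
      have := hon.comp (fun i : {i : Fin n | (i : ℕ) < m} => (⟨i.1, i.2⟩ : Fin m))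
        (fun i j hij => by
          have := congrArg Fin.val hij
          exact Subtype.ext (Fin.ext this))
      convert this using 1
      funext i
      exact dif_pos i.2)
  have he' : ∀ j : Fin m, e (Fin.castLE hmn j) = InnerProductSpace.gramSchmidtNormed ℂ y j :=
    fun j => (he _ (by simp)).trans (dif_pos (by simp))
  have h0 : InnerProductSpace.gramSchmidt ℂ y ⟨0, hm⟩ = y ⟨0, hm⟩ := by
    have : Finset.Iio (⟨0, hm⟩ : Fin m) = ∅ := by
      ext i
      simp [Fin.lt_def]
    rw [InnerProductSpace.gramSchmidt_def, this]
    simp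
  have hy0 : y ⟨0, hm⟩ ≠ 0 := hy.ne_zero _
  have e0 : e ⟨0, by omega⟩ = ((‖y ⟨0, hm⟩‖ : ℂ)⁻¹) • y ⟨0, hm⟩ := by
    have := he' ⟨0, hm⟩
    rw [InnerProductSpace.gramSchmidtNormed, h0] at this
    exact this
  refine ⟨e, ⟨_, e0⟩, ⟨(‖y ⟨0, hm⟩‖ : ℂ), ?_⟩, fun j => ?_⟩
  · rw [e0, smul_smul, mul_inv_cancel₀ (by exact_mod_cast (norm_ne_zero_iff.mpr hy0)), one_smul]
  · rw [he', ← InnerProductSpace.span_gramSchmidt ℂ y,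
      ← InnerProductSpace.span_gramSchmidtNormed_range]
    exact Submodule.subset_span (Set.mem_range_self j)

/-- Removing a multiple of `t` changes the squared modulus by a term carrying the factor `t`; for
`t` the first functional, such terms can be absorbed. -/
theorem norm_sub_mul_sq (u s t : ℂ) :
    ‖u - s * t‖ ^ 2 = ‖u‖ ^ 2 + (t * conj (s * conj s * t - 2 * conj s * u)).re := by
  simp only [← Complex.normSq_eq_norm_sq, Complex.normSq_apply]
  simp
  ring

/-- Linear coordinates extending given independent functionals, in which a positive definite
Hermitian form is reduced, up to a term divisible by the first functional, to a form splitting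
off the first coordinate. -/
theorem exists_adapted_coordinates (hm : 2 ≤ m) (hmn : m ≤ n) {H : Matrix (Fin n) (Fin n) ℂ}
    (hH : H.PosDef) {L : Fin m → Fin n → ℂ} (hL : LinearIndependent ℂ L) :
    ∃ (A : (Fin n → ℂ) ≃L[ℂ] (Fin n → ℂ)) (P : Matrix (Fin (m - 1)) (Fin (m - 1)) ℂ)
      (g : (Fin n → ℂ) →L[ℂ] ℂ), IsUnit P ∧
      (∀ j w, A w (Fin.castLE hmn j) = ∑ k, L j k * w k) ∧
      ∀ w, hermForm H w + (A w ⟨0, by omega⟩ * conj (g w)).re =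
        ‖A w ⟨0, by omega⟩‖ ^ 2
          + ∑ l : Fin (m - 1), ‖∑ k : Fin (m - 1), A w ⟨(k : ℕ) + 1, by omega⟩ * P k l‖ ^ 2
          + ∑ j : Fin n, if m ≤ (j : ℕ) then ‖A w j‖ ^ 2 else 0 := by
  have hm0 : 0 < m := by omega
  have hn0 : 0 < n := by omega
  obtain ⟨M, hM⟩ := exists_linearEquiv_norm_sq_eq_hermForm hH
  set ℓ : Fin m → (Fin n → ℂ) →ₗ[ℂ] ℂ := fun j => ∑ k, L j k • LinearMap.proj k with hℓ
  have hℓa : ∀ j w, ℓ j w = ∑ k, L j k * w k := fun j w => by simp [hℓ, LinearMap.sum_apply]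
  -- The vectors representing the functionals `ℓ j` for the inner product defined by `H`.
  set y : Fin m → EuclideanSpace ℂ (Fin n) := fun j => (InnerProductSpace.toDual ℂ _).symm
    (LinearMap.toContinuousLinearMap (ℓ j ∘ₗ M.symm.toLinearMap)) with hy
  have hyℓ : ∀ j w, inner ℂ (y j) (M w) = ℓ j w := fun j w => by
    simp only [hy, InnerProductSpace.toDual_symm_apply]
    simp
  have hyi : LinearIndependent ℂ y := by
    rw [Fintype.linearIndependent_iff]
    intro c hc
    have h1 : ∑ j, conj (c j) • L j = 0 := by
      funext k
      have h2 : inner ℂ (∑ j, c j • y j) (M (Pi.single k 1)) = (0 : ℂ) := by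
        rw [hc, inner_zero_left]
      simp only [sum_inner, inner_smul_left, hyℓ, hℓa] at h2
      simpa [Pi.single_apply] using h2
    intro j
    simpa using Fintype.linearIndependent_iff.mp hL _ h1 j
  obtain ⟨e, ⟨c₀, hc₀⟩, ⟨c₁, hc₁⟩, hspan⟩ := exists_orthonormalBasis_adapted hm0 hmn hyi
  choose c hc using fun j => (Submodule.mem_span_range_iff_exists_fun ℂ).mp (hspan j)
  -- Coordinates in the adapted orthonormal basis, so `H = Σ |ψⱼ|²`. Here `ψ₀` is proportional to
  -- `ℓ₀`, and `ψⱼ` for `j < m` is a combination of the `ℓᵢ`.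
  set ψ : Fin n → (Fin n → ℂ) →ₗ[ℂ] ℂ := fun j => innerₛₗ ℂ (e j) ∘ₗ M.toLinearMap with hψ
  have hψa : ∀ j w, ψ j w = inner ℂ (e j) (M w) := fun j w => rfl
  have hψℓ : ∀ (j : Fin m) w, ψ (Fin.castLE hmn j) w = ∑ i, conj (c j i) * ℓ i w := fun j w => by
    rw [hψa, ← hc j, sum_inner]
    simp only [inner_smul_left, hyℓ]
  have hψ0 : ∀ w, ψ ⟨0, hn0⟩ w = conj c₀ * ℓ ⟨0, hm0⟩ w := fun w => by
    rw [hψa, hc₀, inner_smul_left, hyℓ]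
  have hℓ0 : ∀ w, ℓ ⟨0, hm0⟩ w = conj c₁ * ψ ⟨0, hn0⟩ w := fun w => by
    rw [← hyℓ, hc₁, inner_smul_left, hψa]
  set P : Matrix (Fin (m - 1)) (Fin (m - 1)) ℂ := fun k l =>
    conj (c ⟨(l : ℕ) + 1, by omega⟩ ⟨(k : ℕ) + 1, by omega⟩) with hP
  set s : Fin (m - 1) → ℂ := fun l => conj (c ⟨(l : ℕ) + 1, by omega⟩ ⟨0, hm0⟩) with hs
  have hψP : ∀ (l : Fin (m - 1)) w, ψ ⟨(l : ℕ) + 1, by omega⟩ w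
      = s l * ℓ ⟨0, hm0⟩ w + ∑ k : Fin (m - 1), ℓ ⟨(k : ℕ) + 1, by omega⟩ w * P k l := fun l w => by
    have h1 := hψℓ ⟨(l : ℕ) + 1, by omega⟩ w
    rw [sum_eq_first_add_middle_add_last hm0 le_rfl] at h1
    refine h1.trans ?_
    have h2 : ∀ j : Fin m, ¬ m ≤ (j : ℕ) := fun j => by omega
    simp only [h2, if_false, Finset.sum_const_zero, add_zero, hP, hs, mul_comm]
  -- The first `m` coordinates are prescribed; the others are taken orthonormal.
  set A₀ : (Fin n → ℂ) →ₗ[ℂ] (Fin n → ℂ) := LinearMap.pi fun j =>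
    if h : (j : ℕ) < m then ℓ ⟨j, h⟩ else ψ j with hA₀
  have hAℓ : ∀ (j : Fin n) (h : (j : ℕ) < m) w, A₀ w j = ℓ ⟨j, h⟩ w := fun j h w => by
    simp [hA₀, h]
  have hAψ : ∀ (j : Fin n) (_ : m ≤ (j : ℕ)) w, A₀ w j = ψ j w := fun j h w => by
    simp [hA₀, not_lt.mpr h]
  have hinj : Function.Injective A₀ := by
    rw [injective_iff_map_eq_zero]
    intro w hw
    have h1 : ∀ j, ψ j w = 0 := fun j => by
      by_cases hj : (j : ℕ) < m
      · have := hψℓ ⟨j, hj⟩ w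
        refine this.trans (Finset.sum_eq_zero fun i _ => ?_)
        have h2 := hAℓ (Fin.castLE hmn i) (by simp) w
        rw [hw] at h2
        have h3 : ℓ i w = 0 := h2.symm
        rw [h3, mul_zero]
      · rw [← hAψ j (by omega), hw]; rfl
    have h2 := e.sum_sq_norm_inner_right (M w)
    have h3 : ‖M w‖ ^ 2 = 0 := by
      rw [← h2]
      exact Finset.sum_eq_zero fun j _ => by rw [← hψa, h1]; simp
    simpa using h3
  -- If `P x = 0`, then `Σ x_l ψ_{l+1}` is a multiple of `ℓ₀`, hence of `ψ₀`; evaluating at the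
  -- orthonormal basis vectors forces `x = 0`.
  have hunit : IsUnit P := by
    rw [← Matrix.mulVec_injective_iff_isUnit]
    rw [← Matrix.coe_mulVecLin, injective_iff_map_eq_zero]
    intro x hx
    have h1 : ∀ w, ∑ l : Fin (m - 1), x l * ψ ⟨(l : ℕ) + 1, by omega⟩ w
        = (∑ l, x l * s l) * ℓ ⟨0, hm0⟩ w := fun w => by
      simp only [hψP, mul_add, Finset.sum_add_distrib]
      have h2 : ∑ l : Fin (m - 1), x l * ∑ k : Fin (m - 1), ℓ ⟨(k : ℕ) + 1, by omega⟩ w * P k l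
          = 0 := by
        simp only [Finset.mul_sum]
        rw [Finset.sum_comm]
        refine Finset.sum_eq_zero fun k _ => ?_
        have h3 : ∑ l, P k l * x l = 0 := congrFun hx k
        have h4 : ∑ l : Fin (m - 1), x l * (ℓ ⟨(k : ℕ) + 1, by omega⟩ w * P k l)
            = ℓ ⟨(k : ℕ) + 1, by omega⟩ w * ∑ l, P k l * x l := by
          rw [Finset.mul_sum]
          exact Finset.sum_congr rfl fun l _ => by ring
        rw [h4, h3, mul_zero]
      rw [h2, add_zero, Finset.sum_mul]
      exact Finset.sum_congr rfl fun l _ => by ring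
    funext l
    have h5 := h1 (M.symm (e ⟨(l : ℕ) + 1, by omega⟩))
    rw [hℓ0] at h5
    simp only [hψa, LinearEquiv.apply_symm_apply, e.inner_eq_ite, Fin.mk.injEq] at h5
    simpa [Fin.val_inj] using h5
  -- Collects the corrections: one replaces `|ψ₀|²` by `|ℓ₀|²`, the others remove the `ℓ₀` part of
  -- each `ψ_{l+1}`. All have the form `Re(ℓ₀ · conj(linear))`.
  set g : (Fin n → ℂ) →ₗ[ℂ] ℂ := (1 - conj c₀ * c₀) • ℓ ⟨0, hm0⟩
    + ∑ l : Fin (m - 1), ((s l * conj (s l)) • ℓ ⟨0, hm0⟩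
      - (2 * conj (s l)) • ψ ⟨(l : ℕ) + 1, by omega⟩) with hg
  refine ⟨(LinearEquiv.ofInjectiveEndo A₀ hinj).toContinuousLinearEquiv, P,
    LinearMap.toContinuousLinearMap g, hunit, fun j w => ?_, fun w => ?_⟩
  · have := hAℓ (Fin.castLE hmn j) (by simp) w
    rw [← hℓa]
    exact this
  · have hA0 : A₀ w ⟨0, hn0⟩ = ℓ ⟨0, hm0⟩ w := hAℓ ⟨0, hn0⟩ hm0 w
    have hAk : ∀ k : Fin (m - 1), A₀ w ⟨(k : ℕ) + 1, by omega⟩ = ℓ ⟨(k : ℕ) + 1, by omega⟩ w :=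
      fun k => hAℓ ⟨(k : ℕ) + 1, by omega⟩ (by simp; omega) w
    have hlast : (∑ j : Fin n, if m ≤ (j : ℕ) then ‖A₀ w j‖ ^ 2 else 0)
        = ∑ j : Fin n, if m ≤ (j : ℕ) then ‖ψ j w‖ ^ 2 else 0 :=
      Finset.sum_congr rfl fun j _ => by
        split_ifs with h
        · rw [hAψ j h]
        · rfl
    have hmid : ∀ l : Fin (m - 1), ‖∑ k : Fin (m - 1), ℓ ⟨(k : ℕ) + 1, by omega⟩ w * P k l‖ ^ 2
        = ‖ψ ⟨(l : ℕ) + 1, by omega⟩ w‖ ^ 2 + (ℓ ⟨0, hm0⟩ w * conj (s l * conj (s l) * ℓ ⟨0, hm0⟩ w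
          - 2 * conj (s l) * ψ ⟨(l : ℕ) + 1, by omega⟩ w)).re := fun l => by
      rw [← norm_sub_mul_sq, hψP l w, add_sub_cancel_left]
    have hfirst : ‖ℓ ⟨0, hm0⟩ w‖ ^ 2 = ‖ψ ⟨0, hn0⟩ w‖ ^ 2
        + (ℓ ⟨0, hm0⟩ w * conj ((1 - conj c₀ * c₀) * ℓ ⟨0, hm0⟩ w)).re := by
      rw [hψ0]
      simp only [← Complex.normSq_eq_norm_sq, Complex.normSq_apply]
      simp
      ring
    change hermForm H w + (A₀ w ⟨0, hn0⟩ * conj (g w)).re = ‖A₀ w ⟨0, hn0⟩‖ ^ 2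
      + ∑ l : Fin (m - 1), ‖∑ k : Fin (m - 1), A₀ w ⟨(k : ℕ) + 1, by omega⟩ * P k l‖ ^ 2
      + ∑ j : Fin n, if m ≤ (j : ℕ) then ‖A₀ w j‖ ^ 2 else 0
    rw [hlast, hA0]
    simp only [hAk, hmid, Finset.sum_add_distrib]
    rw [← hM, ← e.sum_sq_norm_inner_right, sum_eq_first_add_middle_add_last hm0 hmn, hfirst]
    have hgw : g w = (1 - conj c₀ * c₀) * ℓ ⟨0, hm0⟩ w
        + ∑ l : Fin (m - 1), (s l * conj (s l) * ℓ ⟨0, hm0⟩ w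
          - 2 * conj (s l) * ψ ⟨(l : ℕ) + 1, by omega⟩ w) := by
      simp [hg, LinearMap.sum_apply]
    rw [hgw, map_add, mul_add, Complex.add_re, map_sum, Finset.mul_sum, Complex.re_sum]
    simp only [hψa]
    ring

end AdaptedCoordinates

/-! ### Taylor expansion with Peano remainder. -/

section SecondOrderTaylor

/-- Second-order Taylor expansion with Peano remainder. -/
theorem ContDiffAt.taylor_two_isLittleO {E : Type*} [NormedAddCommGroup E] [NormedSpace ℝ E]
    {f : E → ℝ} {p : E} (hf : ContDiffAt ℝ 2 f p) :
    (fun w => f (p + w) - f p - fderiv ℝ f p w - 1 / 2 * fderiv ℝ (fderiv ℝ f) p w w)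
      =o[𝓝 0] fun w => ‖w‖ ^ 2 := by
  have hsymm : IsSymmSndFDerivAt ℝ f p := hf.isSymmSndFDerivAt (by simp)
  set S := fderiv ℝ (fderiv ℝ f) p with hS
  have hd : ∀ᶠ w in 𝓝 (0 : E), DifferentiableAt ℝ f (p + w) := by
    have h1 : ∀ᶠ z in 𝓝 p, DifferentiableAt ℝ f z := by
      filter_upwards [hf.eventually (by simp)] with z hz
      exact hz.differentiableAt (by simp)
    have h2 : Tendsto (fun w : E => p + w) (𝓝 0) (𝓝 p) := by
      have := (continuous_const_add p).tendsto (0 : E)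
      rwa [add_zero] at this
    exact h2.eventually h1
  have hd2 : HasFDerivAt (fderiv ℝ f) S p :=
    ((hf.fderiv_right (m := 1) (by norm_num)).differentiableAt (by simp)).hasFDerivAt
  have hrem := hasFDerivAt_iff_isLittleO_nhds_zero.mp hd2
  rw [Asymptotics.isLittleO_iff]
  intro c hc
  obtain ⟨r, hr, hball⟩ := Metric.eventually_nhds_iff_ball.mp
    (hd.and (Asymptotics.isLittleO_iff.mp hrem hc))
  filter_upwards [Metric.ball_mem_nhds (0 : E) hr] with w hw
  have hsub : Metric.closedBall (0 : E) ‖w‖ ⊆ Metric.ball 0 r :=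
    Metric.closedBall_subset_ball (by simpa using hw)
  -- By symmetry of `S` the remainder has derivative `f'(p + x) - f'(p) - S x`, which is `o(‖x‖)`.
  -- The mean value inequality on the ball of radius `‖w‖` finishes.
  have hder : ∀ x ∈ Metric.closedBall (0 : E) ‖w‖, HasFDerivWithinAt
      (fun w => f (p + w) - f p - fderiv ℝ f p w - 1 / 2 * S w w)
      (fderiv ℝ f (p + x) - fderiv ℝ f p - S x) (Metric.closedBall 0 ‖w‖) x := fun x hx => by
    have h1 : HasFDerivAt (fun w => f (p + w)) (fderiv ℝ f (p + x)) x := by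
      have := (hball x (hsub hx)).1.hasFDerivAt.comp x ((hasFDerivAt_id x).const_add p)
      rwa [ContinuousLinearMap.comp_id] at this
    have h2 : HasFDerivAt (fun w => S w w) ((S x).comp (ContinuousLinearMap.id ℝ E)
        + (S.flip x)) x := by
      exact S.hasFDerivAt.clm_apply (hasFDerivAt_id x)
    have h3 := ((h1.sub_const (f p)).sub (fderiv ℝ f p).hasFDerivAt).sub (h2.const_mul (1 / 2))
    refine (h3.congr_fderiv ?_).hasFDerivWithinAt
    ext v
    have := hsymm.eq v x
    simp only [sub_apply, smul_apply,
      add_apply, ContinuousLinearMap.comp_id, ContinuousLinearMap.flip_apply,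
      smul_eq_mul]
    rw [hS, this]
    ring
  have hbd : ∀ x ∈ Metric.closedBall (0 : E) ‖w‖,
      ‖fderiv ℝ f (p + x) - fderiv ℝ f p - S x‖ ≤ c * ‖w‖ := fun x hx => by
    refine (hball x (hsub hx)).2.trans ?_
    gcongr
    simpa using hx
  have := (convex_closedBall (0 : E) ‖w‖).norm_image_sub_le_of_norm_hasFDerivWithin_le hder hbd
    (x := 0) (y := w) (by simp) (by simp)
  simp only [add_zero, sub_self, map_zero, mul_zero, sub_zero] at this
  rw [norm_pow, norm_norm]
  linarith [this]

end SecondOrderTaylor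

/-! ### Splitting a real quadratic form into Hermitian and holomorphic parts. -/

section QuadraticPart

variable {n : ℕ}

/-- The parameter `σ` treats the bilinear (`σ = id`) and sesquilinear (`σ = conj`) cases at once. -/
theorem eq_sum_of_sesquilinear (σ : ℂ →+* ℂ) {F : (Fin n → ℂ) → (Fin n → ℂ) → ℂ}
    (hal : ∀ u u' v, F (u + u') v = F u v + F u' v) (hsl : ∀ (c : ℂ) u v, F (c • u) v = c * F u v)
    (har : ∀ u v v', F u (v + v') = F u v + F u v')
    (hsr : ∀ (c : ℂ) u v, F u (c • v) = σ c * F u v) (u v : Fin n → ℂ) :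
    F u v = ∑ k, ∑ l, F (Pi.single k 1) (Pi.single l 1) * u k * σ (v l) := by
  set G := LinearMap.mk₂'ₛₗ (RingHom.id ℂ) σ F hal hsl har hsr
  have h1 : F u v = G (∑ k, u k • Pi.single k 1) (∑ l, v l • Pi.single l 1) := by
    have : ∀ w : Fin n → ℂ, ∑ k, w k • (Pi.single k 1 : Fin n → ℂ) = w := fun w => by
      funext i
      simp [Finset.sum_apply, Pi.single_apply]
    rw [this, this]
    rfl
  rw [h1, map_sum G, LinearMap.sum_apply]
  refine Finset.sum_congr rfl fun k _ => ?_
  rw [map_sum]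
  refine Finset.sum_congr rfl fun l _ => ?_
  rw [map_smulₛₗ, map_smulₛₗ, LinearMap.smul_apply]
  simp only [RingHom.id_apply, smul_eq_mul]
  rw [LinearMap.mk₂'ₛₗ_apply]
  ring

/-- The complex bilinear part of a real symmetric bilinear form. -/
def bilinOf (S : (Fin n → ℂ) → (Fin n → ℂ) → ℝ) (u v : Fin n → ℂ) : ℂ :=
  (((S u v - S (Complex.I • u) (Complex.I • v) : ℝ) : ℂ)
    - Complex.I * ((S u (Complex.I • v) + S (Complex.I • u) v : ℝ) : ℂ)) / 4

theorem smul_eq_re_add_im (c : ℂ) (u : Fin n → ℂ) :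
    c • u = c.re • u + c.im • (Complex.I • u) := by
  funext i
  simp only [Pi.smul_apply, Pi.add_apply, smul_eq_mul, Complex.real_smul]
  conv_lhs => rw [← Complex.re_add_im c]
  ring

theorem smul_I_smul_eq (c : ℂ) (u : Fin n → ℂ) :
    Complex.I • (c • u) = c.re • (Complex.I • u) - c.im • u := by
  funext i
  simp only [Pi.smul_apply, Pi.sub_apply, smul_eq_mul, Complex.real_smul]
  conv_lhs => rw [← Complex.re_add_im c]
  linear_combination (c.im * u i : ℂ) * Complex.I_mul_I

variable (S : (Fin n → ℂ) →L[ℝ] (Fin n → ℂ) →L[ℝ] ℝ)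

theorem leviOf_eq_sum (w : Fin n → ℂ) : leviOf (fun u v => S u v) w w
    = ∑ k, ∑ l, leviOf (fun u v => S u v) (Pi.single k 1) (Pi.single l 1) * w k * conj (w l) := by
  refine eq_sum_of_sesquilinear (starRingEnd ℂ) (F := leviOf fun u v => S u v) ?_ ?_ ?_ ?_ w w
  · intro u u' v
    simp only [leviOf, smul_add, map_add, add_apply]
    push_cast; ring
  · intro c u v
    simp only [leviOf, smul_I_smul_eq]
    simp only [smul_eq_re_add_im c u, map_add, map_sub, map_smul,
      add_apply, sub_apply,
      smul_apply, smul_eq_mul]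
    apply Complex.ext <;> simp <;> ring
  · intro u v v'
    simp only [leviOf, smul_add, map_add]
    push_cast; ring
  · intro c u v
    simp only [leviOf, smul_I_smul_eq]
    simp only [smul_eq_re_add_im c v, map_add, map_sub, map_smul,
      smul_eq_mul]
    apply Complex.ext <;> simp <;> ring

theorem bilinOf_eq_sum (w : Fin n → ℂ) : bilinOf (fun u v => S u v) w w
    = ∑ k, ∑ l, bilinOf (fun u v => S u v) (Pi.single k 1) (Pi.single l 1) * w k * w l := by
  refine eq_sum_of_sesquilinear (RingHom.id ℂ) (F := bilinOf fun u v => S u v) ?_ ?_ ?_ ?_ w w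
  · intro u u' v
    simp only [bilinOf, smul_add, map_add, add_apply]
    push_cast; ring
  · intro c u v
    simp only [bilinOf, smul_I_smul_eq]
    simp only [smul_eq_re_add_im c u, map_add, map_sub, map_smul,
      add_apply, sub_apply,
      smul_apply, smul_eq_mul]
    apply Complex.ext <;> simp <;> ring
  · intro u v v'
    simp only [bilinOf, smul_add, map_add]
    push_cast; ring
  · intro c u v
    simp only [bilinOf, smul_I_smul_eq]
    simp only [smul_eq_re_add_im c v, map_add, map_sub, map_smul,
      smul_eq_mul]
    apply Complex.ext <;> simp <;> ring

/-- The Hermitian part comes from the mean of `S` over `w` and `iw`, the other from their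
half-difference. The latter is the real part of a holomorphic polynomial, so a coordinate change can
remove it. -/
theorem half_mul_eq_levi_add_bilin (w : Fin n → ℂ) :
    1 / 2 * S w w = (leviOf (fun u v => S u v) w w).re + (bilinOf (fun u v => S u v) w w).re := by
  simp only [leviOf, bilinOf]
  simp
  ring

theorem re_leviOf_fderiv {f : (Fin n → ℂ) → ℝ} {z : Fin n → ℂ} (hf : ContDiffAt ℝ 2 f z)
    (w : Fin n → ℂ) :
    (leviOf (fun u v => fderiv ℝ (fderiv ℝ f) z u v) w w).re = hermForm (complexHessian f z) w := by
  rw [leviOf_eq_sum, hermForm]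
  simp only [complexHessian_apply hf]

theorem fderiv_apply_eq_re {f : (Fin n → ℂ) → ℝ} {z : Fin n → ℂ} (hf : DifferentiableAt ℝ f z)
    (w : Fin n → ℂ) :
    fderiv ℝ f z w = (2 * ∑ k, wirtinger k (fun x => (f x : ℂ)) z * w k).re := by
  have h1 : HasFDerivAt (fun w => (f w : ℂ)) (Complex.ofRealCLM.comp (fderiv ℝ f z)) z :=
    Complex.ofRealCLM.hasFDerivAt.comp z hf.hasFDerivAt
  have h2 : w = ∑ k, ((w k).re • (Pi.single k 1 : Fin n → ℂ)
      + (w k).im • (Pi.single k Complex.I : Fin n → ℂ)) := by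
    funext i
    simp only [Finset.sum_apply, Pi.add_apply, Pi.smul_apply, Pi.single_apply]
    simp [Finset.sum_add_distrib]
  conv_lhs => rw [h2]
  rw [map_sum, Finset.mul_sum, Complex.re_sum]
  refine Finset.sum_congr rfl fun k _ => ?_
  rw [map_add, map_smul, map_smul, wirtinger, h1.fderiv]
  simp
  ring

end QuadraticPart

/-! ### Expansion of the defining functions. -/

section Expansion

variable {n : ℕ}

theorem isBigO_coord_norm (k : Fin n) :
    (fun w : Fin n → ℂ => w k) =O[𝓝 0] fun w => ‖w‖ :=
  Asymptotics.IsBigO.of_bound 1 (Eventually.of_forall fun w => by simpa using norm_le_pi_norm w k)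

/-- Second-order expansion of a real function multiplied by `1 + 2 Re b`: the real part of a
holomorphic polynomial, plus the Levi form, plus a mixed term contributed by `b`. -/
theorem exists_holomorphic_quadratic_expansion {ρ : (Fin n → ℂ) → ℝ} {p : Fin n → ℂ}
    (hρ : ContDiffAt ℝ 2 ρ p) (h0 : ρ p = 0) (b : (Fin n → ℂ) →L[ℂ] ℂ) :
    ∃ Q : (Fin n → ℂ) → ℂ, ContDiff ℂ 2 Q ∧ Q =O[𝓝 0] (fun w => ‖w‖ ^ 2) ∧
      (fun w => (1 + 2 * (b w).re) * ρ (p + w)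
        - ((2 * ∑ k, wirtinger k (fun x => (ρ x : ℂ)) p * w k + Q w).re
          + hermForm (complexHessian ρ p) w
          + ((2 * ∑ k, wirtinger k (fun x => (ρ x : ℂ)) p * w k) * conj (b w)).re))
        =o[𝓝 0] fun w => ‖w‖ ^ 2 := by
  set S := fderiv ℝ (fderiv ℝ ρ) p with hS
  set lam : (Fin n → ℂ) → ℂ := fun w => 2 * ∑ k, wirtinger k (fun x => (ρ x : ℂ)) p * w k
    with hlam
  have hd : DifferentiableAt ℝ ρ p := hρ.differentiableAt (by simp)
  have hlamO : lam =O[𝓝 0] fun w => ‖w‖ :=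
    (Asymptotics.IsBigO.fun_sum fun k _ => (isBigO_coord_norm k).const_mul_left _).const_mul_left _
  have hbO : (fun w => b w) =O[𝓝 0] fun w => ‖w‖ := (b.isBigO_id _).norm_right
  have hlamb : (fun w => lam w * b w) =O[𝓝 0] fun w => ‖w‖ ^ 2 := by
    simpa only [pow_two] using hlamO.mul hbO
  -- With `λ` the linear part, `2 Re b · Re λ = Re(λb) + Re(λ b̄)`: the holomorphic product goes
  -- into `Q`, the mixed one remains.
  refine ⟨fun w => bilinOf (fun u v => S u v) w w + lam w * b w, ?_, ?_, ?_⟩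
  · simp only [bilinOf_eq_sum, hlam]
    fun_prop
  · refine Asymptotics.IsBigO.add ?_ hlamb
    simp only [bilinOf_eq_sum]
    refine Asymptotics.IsBigO.fun_sum fun k _ => Asymptotics.IsBigO.fun_sum fun l _ => ?_
    simpa only [pow_two] using ((isBigO_coord_norm k).const_mul_left _).mul (isBigO_coord_norm l)
  · have h1 := hρ.taylor_two_isLittleO
    have h2 : (fun w => 2 * (b w).re * (ρ (p + w) - ρ p - fderiv ℝ ρ p w)) =o[𝓝 0]
        fun w => ‖w‖ ^ 2 := by
      have h3 : (fun w => 2 * (b w).re) =O[𝓝 0] fun w => ‖w‖ :=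
        ((Asymptotics.IsBigO.of_bound 1 (Eventually.of_forall fun w => by
          simpa using Complex.abs_re_le_norm (b w))).trans hbO).const_mul_left _
      have h4 := (hasFDerivAt_iff_isLittleO_nhds_zero.mp hd.hasFDerivAt).norm_right
      simpa only [pow_two] using h3.mul_isLittleO h4
    refine (h1.add h2).congr_left fun w => ?_
    have h5 := half_mul_eq_levi_add_bilin S w
    rw [hS, re_leviOf_fderiv hρ, ← hS] at h5
    have h6 := fderiv_apply_eq_re hd w
    rw [h5, h6, h0]
    change _ = (1 + 2 * (b w).re) * ρ (p + w) - ((lam w + (bilinOf (fun u v => S u v) w w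
      + lam w * b w)).re + hermForm (complexHessian ρ p) w + (lam w * conj (b w)).re)
    change ρ (p + w) - 0 - (lam w).re - _ + 2 * (b w).re * (ρ (p + w) - 0 - (lam w).re) = _
    simp only [Complex.add_re, Complex.mul_re, Complex.conj_re, Complex.conj_im]
    ring

/-- As a difference of squared norms it factors into an `O(|w|²)` difference and a sum tending to 0.
-/
theorem hermForm_sub_isLittleO {a : Matrix (Fin n) (Fin n) ℂ} (ha : a.PosDef)
    {u v : (Fin n → ℂ) → (Fin n → ℂ)} (hu : u =O[𝓝 0] fun w => ‖w‖)
    (hv : v =O[𝓝 0] fun w => ‖w‖) (huv : (fun w => u w - v w) =O[𝓝 0] fun w => ‖w‖ ^ 2) :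
    (fun w => hermForm a (u w) - hermForm a (v w)) =o[𝓝 0] fun w => ‖w‖ ^ 2 := by
  obtain ⟨M, hM⟩ := exists_linearEquiv_norm_sq_eq_hermForm ha
  set T := LinearMap.toContinuousLinearMap M.toLinearMap
  have hT : ∀ z, ‖T z‖ ^ 2 = hermForm a z := hM
  have h1 : (fun w => (‖T (u w)‖ - ‖T (v w)‖)) =O[𝓝 0] fun w => ‖w‖ ^ 2 := by
    refine Asymptotics.IsBigO.trans (Asymptotics.IsBigO.of_bound 1 (Eventually.of_forall
      fun w => ?_)) ((T.isBigO_comp (fun w => u w - v w) (𝓝 0)).trans huv)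
    rw [one_mul, map_sub]
    exact abs_norm_sub_norm_le _ _
  have h2 : (fun w => ‖T (u w)‖ + ‖T (v w)‖) =o[𝓝 0] fun _ => (1 : ℝ) := by
    have h3 : (fun w => ‖T (u w)‖ + ‖T (v w)‖) =O[𝓝 0] fun w : Fin n → ℂ => ‖w‖ :=
      ((T.isBigO_comp u (𝓝 0)).trans hu).norm_left.add
        ((T.isBigO_comp v (𝓝 0)).trans hv).norm_left
    refine h3.trans_isLittleO ?_
    rw [Asymptotics.isLittleO_one_iff]
    simpa using (continuous_norm.tendsto (0 : Fin n → ℂ))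
  have h4 := h1.mul_isLittleO h2
  simp only [mul_one] at h4
  refine h4.congr_left fun w => ?_
  rw [← hT, ← hT]
  ring

end Expansion

/-! ### Biholomorphic charts and the model form of `a¹`. -/

section Chart

variable {n m : ℕ}

/-- The holomorphic inverse function theorem with biholomorphic inverse on an open set. -/
theorem exists_biholomorphic_chart {E : Type*} [NormedAddCommGroup E] [NormedSpace ℂ E]
    [CompleteSpace E] {F : E → E} {p : E} {A : E ≃L[ℂ] E} (hF : ContDiff ℂ 2 F)
    (hA : HasFDerivAt F (A : E →L[ℂ] E) p) {W : Set E} (hW : IsOpen W) (hpW : p ∈ W) :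
    ∃ e : OpenPartialHomeomorph E E, p ∈ e.source ∧ e.source ⊆ W ∧ (∀ z, e z = F z) ∧
      DifferentiableOn ℂ e e.source ∧ DifferentiableOn ℂ e.symm e.target := by
  have hs : HasStrictFDerivAt F (A : E →L[ℂ] E) p :=
    hF.contDiffAt.hasStrictFDerivAt' hA (by simp)
  set e₀ := hs.toOpenPartialHomeomorph F
  have he₀ : ∀ z, e₀ z = F z := fun z => rfl
  -- Invertibility of the derivative is an open condition; restricting to it makes the inverse
  -- holomorphic on the whole target, not only at one point.
  set s : Set E := W ∩ fderiv ℂ F ⁻¹' Set.range ContinuousLinearEquiv.toContinuousLinearMap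
  have hso : IsOpen s :=
    hW.inter (ContinuousLinearEquiv.isOpen.preimage (hF.continuous_fderiv (by simp)))
  have hps : p ∈ s := ⟨hpW, A, hA.fderiv.symm⟩
  have hdiff : Differentiable ℂ F := hF.differentiable (by simp)
  refine ⟨e₀.restrOpen s hso, ⟨hs.mem_toOpenPartialHomeomorph_source, hps⟩,
    fun z hz => hz.2.1, he₀, hdiff.differentiableOn, fun ζ hζ => ?_⟩
  have h1 := (e₀.restrOpen s hso).map_target hζ
  obtain ⟨f', hf'⟩ := h1.2.2
  have h2 : HasFDerivAt (e₀.restrOpen s hso) (f' : E →L[ℂ] E) ((e₀.restrOpen s hso).symm ζ) := by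
    rw [hf']
    exact (hdiff _).hasFDerivAt
  exact ((e₀.restrOpen s hso).hasFDerivAt_symm hζ h2).differentiableAt.differentiableWithinAt

/-- Supplies the matrix `a¹`: the right side is the squared norm of the map acting by `P` on the
middle block and trivially elsewhere, injective since `P` is invertible. -/
theorem exists_posDef_hermForm_eq_split (hm : 2 ≤ m) (hmn : m ≤ n)
    {P : Matrix (Fin (m - 1)) (Fin (m - 1)) ℂ} (hP : IsUnit P) :
    ∃ a : Matrix (Fin n) (Fin n) ℂ, a.PosDef ∧ ∀ z : Fin n → ℂ, hermForm a z =
      ‖z ⟨0, by omega⟩‖ ^ 2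
        + ∑ l : Fin (m - 1), ‖∑ k : Fin (m - 1), z ⟨(k : ℕ) + 1, by omega⟩ * P k l‖ ^ 2
        + ∑ j : Fin n, if m ≤ (j : ℕ) then ‖z j‖ ^ 2 else 0 := by
  have hn0 : 0 < n := by omega
  set N₀ : (Fin n → ℂ) →ₗ[ℂ] (Fin n → ℂ) := LinearMap.pi fun j =>
    if h : 1 ≤ (j : ℕ) ∧ (j : ℕ) < m then
      ∑ k : Fin (m - 1), P k ⟨(j : ℕ) - 1, by omega⟩ • LinearMap.proj ⟨(k : ℕ) + 1, by omega⟩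
    else LinearMap.proj j with hN₀
  have hN0 : ∀ z, N₀ z ⟨0, hn0⟩ = z ⟨0, hn0⟩ := fun z => by simp [hN₀]
  have hNl : ∀ z (l : Fin (m - 1)), N₀ z ⟨(l : ℕ) + 1, by omega⟩
      = ∑ k : Fin (m - 1), z ⟨(k : ℕ) + 1, by omega⟩ * P k l := fun z l => by
    have : 1 ≤ (l : ℕ) + 1 ∧ (l : ℕ) + 1 < m := by omega
    simp [hN₀, this, LinearMap.sum_apply, mul_comm]
  have hNj : ∀ z (j : Fin n), m ≤ (j : ℕ) → N₀ z j = z j := fun z j hj => by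
    have : ¬ (1 ≤ (j : ℕ) ∧ (j : ℕ) < m) := by omega
    simp only [hN₀, LinearMap.pi_apply, dif_neg this, LinearMap.proj_apply]
  have hinj : Function.Injective N₀ := by
    rw [injective_iff_map_eq_zero]
    intro z hz
    have h1 : (fun k : Fin (m - 1) => z ⟨(k : ℕ) + 1, by omega⟩) = 0 := by
      apply Matrix.vecMul_injective_iff_isUnit.mpr hP
      beta_reduce
      rw [Matrix.zero_vecMul]
      funext l
      have := hNl z l
      rw [hz] at this
      exact this.symm
    funext j
    rcases Nat.eq_zero_or_pos (j : ℕ) with hj | hj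
    · have h2 : j = ⟨0, hn0⟩ := Fin.ext hj
      rw [h2, ← hN0 z, hz]
    · by_cases hjm : (j : ℕ) < m
      · have h2 := congrFun h1 ⟨(j : ℕ) - 1, by omega⟩
        have h3 : (⟨(j : ℕ) - 1 + 1, by omega⟩ : Fin n) = j := Fin.ext (by simp; omega)
        rw [← h3]
        exact h2
      · rw [← hNj z j (by omega), hz]
  obtain ⟨a, ha, haN⟩ := exists_posDef_hermForm_eq_norm_sq
    ((WithLp.linearEquiv 2 ℂ (Fin n → ℂ)).symm.toLinearMap ∘ₗ N₀)
    ((WithLp.linearEquiv 2 ℂ (Fin n → ℂ)).symm.injective.comp hinj)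
  refine ⟨a, ha, fun z => ?_⟩
  rw [haN, EuclideanSpace.norm_sq_eq]
  change ∑ j, ‖N₀ z j‖ ^ 2 = _
  rw [sum_eq_first_add_middle_add_last (by omega : 1 ≤ m) hmn]
  simp only [hN0, hNl]
  congr 1
  refine Finset.sum_congr rfl fun j _ => ?_
  split_ifs with hj
  · rw [hNj z j hj]
  · rfl

end Chart

/-! ### Existence of normalized coordinates and admissible radii. -/

section Existence

variable {n m : ℕ} {hm : 2 ≤ m} {hmn : m ≤ n} {Ω : Set (Fin n → ℂ)} {p : Fin n → ℂ}

theorem NormalizedChart.exists_isAdmissible (C : NormalizedChart hm hmn Ω p) :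
    ∃ ε, C.IsAdmissible ε := by
  have h0 : (0 : Fin n → ℂ) ∈ C.chart.target := by
    rw [← C.chart_center]
    exact C.chart.map_source C.mem_source
  have hR : ∀ᶠ z in 𝓝 (0 : Fin n → ℂ), ∀ j, ‖C.R j z‖ ≤ C.minEigenvalue / 2 * ‖‖z‖ ^ 2‖ :=
    eventually_all.mpr fun j => Asymptotics.isLittleO_iff.mp (C.isLittleO_R j)
      (half_pos C.minEigenvalue_pos)
  obtain ⟨ε, hε, hball⟩ := Metric.eventually_nhds_iff_ball.mp
    ((C.chart.open_target.eventually_mem h0).and hR)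
  have hsub : polydisk n ε ⊆ Metric.ball 0 ε := fun z hz => by
    rw [mem_ball_zero_iff, pi_norm_lt_iff hε]
    exact hz
  refine ⟨ε, hε, fun z hz => (hball z (hsub hz)).1, fun j z hz => ?_⟩
  refine ((hball z (hsub hz)).2 j).trans ?_
  rw [norm_pow, norm_norm]
  exact mul_le_mul_of_nonneg_left (norm_sq_le_sum z) (half_pos C.minEigenvalue_pos).le

theorem exists_normalizedChart (hm : 2 ≤ m) (hmn : m ≤ n)
    (hp : IsStronglyPseudoconvexPolyhedral m Ω p) : Nonempty (NormalizedChart hm hmn Ω p) := by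
  obtain ⟨-, U, ρ, hU, hpU, hC2, hpsh, h0, hΩU, hind⟩ := hp
  have hm0 : 0 < m := by omega
  have hn0 : 0 < n := by omega
  have hρ : ∀ j, ContDiffAt ℝ 2 (ρ j) p := fun j => (hC2 j).contDiffAt (hU.mem_nhds hpU)
  set lam : Fin m → (Fin n → ℂ) → ℂ := fun j w =>
    2 * ∑ k, wirtinger k (fun x => (ρ j x : ℂ)) p * w k with hlam
  -- The factor `-2i` turns `Re λⱼ` into `-Im` of the coordinate `-iλⱼ`, so that `ρⱼ < 0` becomes a
  -- lower bound for an imaginary part.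
  have hL : LinearIndependent ℂ fun (j : Fin m) (k : Fin n) =>
      -2 * Complex.I * wirtinger k (fun w => (ρ j w : ℂ)) p := by
    have hne : (-2 * Complex.I : ℂ) ≠ 0 := by simp
    exact hind.units_smul fun _ => Units.mk0 _ hne
  obtain ⟨A, P, g, hP, hA, hform⟩ := exists_adapted_coordinates hm hmn (hpsh ⟨0, hm0⟩ p hpU) hL
  have hAlam : ∀ j w, A w (Fin.castLE hmn j) = -Complex.I * lam j w := fun j w => by
    rw [hA, hlam]
    simp only [Finset.mul_sum]
    exact Finset.sum_congr rfl fun k _ => by ring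
  -- Only the first defining function is modified. As `λ₁ = i A₁`, the choice `b = i g` makes `λ₁ b̄
  -- = A₁ ḡ`, the term required by `hform`.
  set b : Fin m → (Fin n → ℂ) →L[ℂ] ℂ := fun j => if (j : ℕ) = 0 then Complex.I • g else 0 with hb
  choose Q hQc hQO hQe using fun j =>
    exists_holomorphic_quadratic_expansion (hρ j) (h0 j) (b j)
  have hex : ∀ j : Fin m, ∃ a : Matrix (Fin n) (Fin n) ℂ, a.PosDef ∧
      (∀ w, hermForm a (A w) = hermForm (complexHessian (ρ j) p) w
        + (lam j w * conj (b j w)).re) ∧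
      ((j : ℕ) = 0 → ∀ z : Fin n → ℂ, hermForm a z = ‖z ⟨0, hn0⟩‖ ^ 2
        + ∑ l : Fin (m - 1), ‖∑ k : Fin (m - 1), z ⟨(k : ℕ) + 1, by omega⟩ * P k l‖ ^ 2
        + ∑ j : Fin n, if m ≤ (j : ℕ) then ‖z j‖ ^ 2 else 0) := fun j => by
    by_cases hj : (j : ℕ) = 0
    · obtain ⟨a, ha, haz⟩ := exists_posDef_hermForm_eq_split hm hmn hP
      refine ⟨a, ha, fun w => ?_, fun _ => haz⟩
      have hj' : j = ⟨0, hm0⟩ := Fin.ext hj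
      have h1 : lam j w * conj (b j w) = A w ⟨0, hn0⟩ * conj (g w) := by
        have h2 := hAlam j w
        have h3 : Fin.castLE hmn j = ⟨0, hn0⟩ := Fin.ext hj
        rw [h3] at h2
        rw [h2, hb]
        simp only [hj, if_true]
        simp
        ring
      rw [h1, hj', hform w, haz]
    -- For the other functions no normal form is required; `a` is the Levi form transported by
    -- `A⁻¹`.
    · obtain ⟨M, hM⟩ := exists_linearEquiv_norm_sq_eq_hermForm (hpsh j p hpU)
      obtain ⟨a, ha, haN⟩ := exists_posDef_hermForm_eq_norm_sq
        (M.toLinearMap ∘ₗ A.symm.toLinearEquiv.toLinearMap)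
        (M.injective.comp A.symm.injective)
      refine ⟨a, ha, fun w => ?_, fun h => absurd h hj⟩
      have h1 : b j = 0 := by simp [hb, hj]
      rw [haN, h1, ← hM]
      simp
  choose a ha haA ha0 using hex
  set q : (Fin n → ℂ) → (Fin n → ℂ) := fun w i =>
    if h : (i : ℕ) < m then -Complex.I * Q ⟨i, h⟩ w else 0 with hq
  have hqc : ContDiff ℂ 2 q := contDiff_pi.mpr fun i => by
    by_cases h : (i : ℕ) < m
    · simpa only [hq, dif_pos h] using contDiff_const.mul (hQc ⟨i, h⟩)
    · simpa only [hq, dif_neg h] using contDiff_const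
  have hqO : q =O[𝓝 0] fun w => ‖w‖ ^ 2 := Asymptotics.isBigO_pi.mpr fun i => by
    by_cases h : (i : ℕ) < m
    · simpa only [hq, dif_pos h] using (hQO ⟨i, h⟩).const_mul_left (-Complex.I)
    · simpa only [hq, dif_neg h] using Asymptotics.isBigO_zero _ _
  have hq0 : q 0 = 0 := by
    obtain ⟨c, hc⟩ := hqO.bound
    simpa using hc.self_of_nhds
  set F : (Fin n → ℂ) → (Fin n → ℂ) := fun z => A (z - p) + q (z - p) with hF
  have hFp : F p = 0 := by simp [hF, hq0]
  have hFc : ContDiff ℂ 2 F := by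
    have h1 : ContDiff ℂ 2 fun z : Fin n → ℂ => z - p := contDiff_id.sub contDiff_const
    exact (A.contDiff.comp h1).add (hqc.comp h1)
  have hFd : HasFDerivAt F (A : (Fin n → ℂ) →L[ℂ] (Fin n → ℂ)) p := by
    rw [hasFDerivAt_iff_isLittleO_nhds_zero]
    have h1 : q =o[𝓝 0] fun w => w := by
      have h2 : (fun w : Fin n → ℂ => ‖w‖ ^ 2) =o[𝓝 0] fun w => w :=
        Asymptotics.isLittleO_norm_pow_id one_lt_two
      exact hqO.trans_isLittleO h2
    refine h1.congr_left fun w => ?_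
    rw [hFp]
    simp [hF]
  -- Here the factors `1 + 2 Re b` are positive, so multiplying by them keeps the sign of each `ρⱼ`.
  set W : Set (Fin n → ℂ) := U ∩ {z | ∀ j, 0 < 1 + 2 * (b j (z - p)).re} with hW
  have hWo : IsOpen W := by
    refine hU.inter ?_
    simp only [ofPred_forall]
    refine isOpen_iInter_of_finite fun j => isOpen_lt continuous_const ?_
    fun_prop
  have hpW : p ∈ W := ⟨hpU, fun j => by simp⟩
  obtain ⟨e, hpe, heW, heF, hed, hesd⟩ := exists_biholomorphic_chart hFc hFd hWo hpW
  have he0 : e p = 0 := (heF p).trans hFp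
  have h0t : (0 : Fin n → ℂ) ∈ e.target := by
    rw [← he0]
    exact e.map_source hpe
  have hes0 : e.symm 0 = p := by
    rw [← he0]
    exact e.left_inv hpe
  set μ : Fin m → (Fin n → ℂ) → ℝ := fun j z => (1 + 2 * (b j (z - p)).re) * ρ j z with hμ
  have hμlt : ∀ j, ∀ z ∈ e.source, (μ j z < 0 ↔ ρ j z < 0) := fun j z hz =>
    smul_neg_iff_of_pos_left ((heW hz).2 j)
  -- The holomorphic parts cancel against `Im F`, and replacing `A w` by `F (p + w)` in the form
  -- costs only `o(|w|²)`.
  have hkey : ∀ j, (fun w => μ j (p + w) + (F (p + w) (Fin.castLE hmn j)).im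
      - hermForm (a j) (F (p + w))) =o[𝓝 0] fun w => ‖w‖ ^ 2 := fun j => by
    have hAO : (fun w => A w) =O[𝓝 0] fun w : Fin n → ℂ => ‖w‖ :=
      ((A : (Fin n → ℂ) →L[ℂ] (Fin n → ℂ)).isBigO_id _).norm_right
    have hqO1 : q =O[𝓝 0] fun w => ‖w‖ := by
      refine hqO.trans ?_
      exact (Asymptotics.isLittleO_norm_pow_id one_lt_two).isBigO.norm_right
    have hFO : (fun w => A w + q w) =O[𝓝 0] fun w => ‖w‖ := hAO.add hqO1
    have h1 := hermForm_sub_isLittleO (ha j) hAO hFO (by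
      refine hqO.neg_left.congr_left fun w => ?_
      simp)
    refine ((hQe j).add h1).congr_left fun w => ?_
    have h2 : F (p + w) = A w + q w := by simp [hF]
    have h3 : q w (Fin.castLE hmn j) = -Complex.I * Q j w := by simp [hq]
    have h4 : p + w - p = w := add_sub_cancel_left p w
    rw [h2, Pi.add_apply, h3, hAlam, haA, hμ]
    simp only [h4]
    change _ - ((lam j w + Q j w).re + _ + (lam j w * conj (b j w)).re) + _ = _
    simp
    ring
  -- Chosen so that `Φⱼ < Im ζⱼ` says exactly `μⱼ < 0`; the description of the domain is then
  -- automatic, and the analytic content is `R j = o(|ζ|²)`.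
  set R : Fin m → (Fin n → ℂ) → ℝ := fun j ζ =>
    μ j (e.symm ζ) + (ζ (Fin.castLE hmn j)).im - hermForm (a j) ζ with hR
  have hsymmC : ContDiffOn ℝ 2 e.symm e.target :=
    contDiffOn_infty.mp
      ((hesd.contDiffOn_of_finiteDimensional e.open_target).restrict_scalars ℝ) 2
  have hsymmO : (fun ζ => e.symm ζ - p) =O[𝓝 0] fun ζ => ζ := by
    have h1 := (hesd.differentiableAt (e.open_target.mem_nhds h0t)).isBigO_sub
    simpa [hes0] using h1
  have hsymmT : Tendsto (fun ζ => e.symm ζ - p) (𝓝 0) (𝓝 0) := by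
    have h1 :=
      (hesd.differentiableAt (e.open_target.mem_nhds h0t)).continuousAt.tendsto.sub_const p
    rwa [hes0, sub_self] at h1
  refine ⟨{
    chart := e
    mem_source := hpe
    chart_center := he0
    holomorphic := hed
    holomorphic_symm := hesd
    a := a
    posDef := ha
    P := P
    isUnit_P := hP
    hermForm_first := ha0 ⟨0, hm0⟩ rfl
    R := R
    contDiffOn_R := fun j => ?_
    isLittleO_R := fun j => ?_
    image_eq := ?_ }⟩
  · have h1 : ContDiffOn ℝ 2 (μ j) U := by
      refine ContDiffOn.mul ?_ (hC2 j)
      have : ContDiff ℝ 2 fun z : Fin n → ℂ => (b j (z - p)).re :=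
        Complex.reCLM.contDiff.comp (((b j).restrictScalars ℝ).contDiff.comp
          (contDiff_id.sub contDiff_const))
      exact (contDiff_const.add (contDiff_const.mul this)).contDiffOn
    have h2 : ContDiffOn ℝ 2 (fun ζ => μ j (e.symm ζ)) e.target :=
      h1.comp hsymmC fun ζ hζ => (heW (e.map_target hζ)).1
    have h3 : ContDiff ℝ 2 fun ζ : Fin n → ℂ => (ζ (Fin.castLE hmn j)).im :=
      Complex.imCLM.contDiff.comp (contDiff_apply ℝ ℂ _)
    have h4 : ContDiff ℝ 2 (hermForm (a j)) := by
      obtain ⟨M, hM⟩ := exists_linearEquiv_norm_sq_eq_hermForm (ha j)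
      have h5 : hermForm (a j) = fun z => ‖LinearMap.toContinuousLinearMap
          (M.toLinearMap.restrictScalars ℝ) z‖ ^ 2 := funext fun z => (hM z).symm
      rw [h5]
      exact (ContinuousLinearMap.contDiff _).norm_sq ℝ
    exact (h2.add h3.contDiffOn).sub h4.contDiffOn
  · have h1 := ((hkey j).comp_tendsto hsymmT).trans_isBigO (hsymmO.norm_norm.pow 2)
    refine h1.congr' ?_ EventuallyEq.rfl
    filter_upwards [e.open_target.mem_nhds h0t] with ζ hζ
    have h2 : p + (e.symm ζ - p) = e.symm ζ := add_sub_cancel _ _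
    simp only [Function.comp_apply, h2, ← heF, e.right_inv hζ, hR]
  · rw [inter_comm, e.image_source_inter_eq']
    ext ζ
    simp only [mem_inter_iff, mem_preimage, mem_ofPred_eq]
    refine and_congr_right fun hζ => ?_
    have hs := e.map_target hζ
    have h1 : e.symm ζ ∈ Ω ↔ ∀ j, ρ j (e.symm ζ) < 0 := by
      have h2 : e.symm ζ ∈ Ω ∩ U ↔ _ := Set.ext_iff.mp hΩU _
      simpa [(heW hs).1] using h2
    rw [h1]
    refine forall_congr' fun j => ?_
    rw [← hμlt j _ hs]
    simp only [hR]
    constructor <;> intro h <;> linarith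

end Existence

end

theorem mainTheorem7 {n m : ℕ} (hm : 2 ≤ m) (hmn : m ≤ n) (Ω : Set (Fin n → ℂ))
    (hΩ : IsOpen Ω) (hΩc : IsConnected Ω) (p : Fin n → ℂ)
    (hp : IsStronglyPseudoconvexPolyhedral m Ω p) :
    (∃ (C : NormalizedChart hm hmn Ω p) (ε₀ : ℝ), C.IsAdmissible ε₀) ∧
    ∀ (C : NormalizedChart hm hmn Ω p) (ε₀ : ℝ), C.IsAdmissible ε₀ →
      -- the limit kernel and invariant are well defined, and so are the rescaled ones
      ContDiffOn ℝ ∞ (bergmanKernel (ballPolydisk hm hmn)) (ballPolydisk hm hmn) ∧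
      bergmanStar (ballPolydisk hm hmn) = ballPolydisk hm hmn ∧
      (∀ᶠ δ in 𝓝[>] (0 : ℝ),
        ContDiffOn ℝ ∞ (bergmanKernel (C.rescaledDomain ε₀ δ)) (C.rescaledDomain ε₀ δ)) ∧
      ∀ S : Set (Fin n → ℂ), IsCompact S → S ⊆ ballPolydisk hm hmn →
        (∀ᶠ δ in 𝓝[>] (0 : ℝ), S ⊆ bergmanStar (C.rescaledDomain ε₀ δ)) ∧
        -- convergence of the kernels in the smooth topology
        (∀ k : ℕ, TendstoUniformlyOn
          (fun δ z => iteratedFDeriv ℝ k (bergmanKernel (C.rescaledDomain ε₀ δ)) z)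
          (fun z => iteratedFDeriv ℝ k (bergmanKernel (ballPolydisk hm hmn)) z)
          (𝓝[>] (0 : ℝ)) S) ∧
        -- convergence of the canonical invariants
        TendstoUniformlyOn
          (fun δ z => bergmanInvariant (C.rescaledDomain ε₀ δ) z)
          (fun z => bergmanInvariant (ballPolydisk hm hmn) z)
          (𝓝[>] (0 : ℝ)) S := by
  obtain ⟨C₀⟩ := exists_normalizedChart hm hmn hp
  refine ⟨⟨C₀, C₀.exists_isAdmissible⟩, fun C ε₀ hA => ?_⟩
  refine ⟨contDiffOn_bergmanKernel isOpen_ballPolydisk,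
    bergmanStar_eq_of_bounded isOpen_ballPolydisk isBounded_ballPolydisk, ?_, fun S hS hSB => ⟨?_,
    fun k => hA.tendstoUniformlyOn_iteratedFDeriv hΩ k hS hSB, ?_⟩⟩
  · filter_upwards [hA.eventually_isOpen_rescaledDomain hΩ] with δ hδ
    exact contDiffOn_bergmanKernel hδ
  · filter_upwards [hA.eventually_isOpen_rescaledDomain hΩ,
      hA.eventually_isBounded_rescaledDomain, hA.eventually_subset_rescaledDomain hSB hS]
      with δ ho hb hs
    rwa [bergmanStar_eq_of_bounded ho hb]
  · exact tendstoUniformlyOn_bergmanInvariant isOpen_ballPolydisk isBounded_ballPolydisk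
      (hA.eventually_isOpen_rescaledDomain hΩ)
      (fun K hKB hK => hA.eventually_subset_rescaledDomain hKB hK)
      (fun k _ K hKB hK => hA.tendstoUniformlyOn_iteratedFDeriv hΩ k hK hKB) hS hSB
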